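/- Let $\Omega\subset\mathbb{R}^d$ ($d\ge 2$) be a nonempty bounded simply connected Lipschitz domain. Write $\|\cdot\|$ for the $L^2(\Omega)$ norm. Equip $H^1(\Omega)$ with the norm $(\|v\|^2+\|\nabla v\|^2)^{1/2}$ and $H^1_0(\Omega)$ with the norm $\|\nabla v\|$. Let $H^{-1}(\Omega):=(H^1_0(\Omega))'$ and $\widetilde H^{-1}(\Omega):=(H^1(\Omega))'$ carry the dual norms $\|\cdot\|_{-1}$ and $\|\cdot\|_{-1,\sim}$. For $s\in(0,1)$ let $$\widetilde H^{s}(\Omega):=[L^2(\Omega),H^1_0(\Omega)]_{s,2},\qquad H^s(\Omega):=[L^2(\Omega),H^1(\Omega)]_{s,2}$$ (real interpolation, $\|u\|_{[X_0,X_1]_{s,2}}^2=\int_0^\infty (t^{-s}K(t,u))^2\,\tfrac{dt}{t}$, $K(t,u)=\inf_{v\in X_1}(\|u-v\|_{X_0}+t\|v\|_{X_1})$), and let $H^{-s}(\Omega):=(\widetilde H^s(\Omega))'\subset H^{-1}(\Omega)$ and $\widetilde H^{-s}(\Omega):=(H^s(\Omega))'\subset\widetilde H^{-1}(\Omega)$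 carry the dual norms $\|\cdot\|_{-s}$ and $\|\cdot\|_{-s,\sim}$. Let $(\mathcal T_\ell)_{\ell\in\mathbb N_0}$ be a sequence of regular (conforming) simplicial meshes of $\Omega$, where $\mathcal T_{\ell+1}$ arises from $\mathcal T_\ell$ by refining elements. For an element $T$ let $\mathrm{gen}(T)$ be the number of iterated refinements that lead from an element of $\mathcal T_0$ to $T$. Assume that, with constants $C_{\mathrm{reg}},C_{\mathrm{ref}}>0$, $q_{\mathrm{ref}}\in(0,1)$, $k_{\mathrm{ref}}\in\mathbb N$, for all $\ell$: * $\mathrm{diam}(T)^d/|T|\le C_{\mathrm{reg}}$ for all $T\in\mathcal T_\ell$; * $C_{\mathrm{ref}}^{-1}\,\mathrm{diam}(T)\le q_{\mathrm{ref}}^{\mathrm{gen}(T)}\le C_{\mathrm{ref}}\,\mathrm{diam}(T)$ for all $T\in\mathcal T_\ell$; * $1\le|\mathrm{gen}(T)-\mathrm{gen}(T_F)|\le k_{\mathrm{ref}}$ for all $T\in\mathcal T_{\ell+1}\setminus\mathcal T_\ell$ with father $T_F\in\mathcal T_\ell$; * (uniformity) $\mathcal T_{\ell+1}\cap\mathcal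 T_\ell=\emptyset$, and $\mathrm{gen}(T)=\mathrm{gen}(T')$ for all $T,T'\in\mathcal T_\ell$. Let $h_\ell:=\max_{T\in\mathcal T_\ell}\mathrm{diam}(T)$, let $\mathcal P^0(\mathcal T_\ell)\subset L^2(\Omega)$ be the space of piecewise constant functions, and let $\Pi^{(-1)}_\ell$ and $\Pi^{(-1),\sim}_\ell$ be the orthogonal projections onto $\mathcal P^0(\mathcal T_\ell)$ in the Hilbert spaces $H^{-1}(\Omega)$ and $\widetilde H^{-1}(\Omega)$, respectively (functions in $L^2(\Omega)$ act as functionals through the $L^2(\Omega)$ inner product). Then for every $s\in(0,1)$ there are constants $c,C>0$, depending only on $s$, $\Omega$, $C_{\mathrm{reg}}$, $q_{\mathrm{ref}}$, $C_{\mathrm{ref}}$ and $k_{\mathrm{ref}}$, such that for every such sequence of meshes $$c\,\|\phi\|_{-s}^2\le\|\phi\|_{-1}^2+\sum_{\ell=0}^\infty h_\ell^{-2+2s}\|\phi-\Pi^{(-1)}_\ell\phi\|_{-1}^2\le C\,\|\phi\|_{-s}^2\qquad\text{for all }\phi\in H^{-s}(\Omega)$$ and $$c\,\|\phi\|_{-s,\sim}^2\le\|\phi\|_{-1,\sim}^2+\sum_{\ell=0}^\infty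 h_\ell^{-2+2s}\|\phi-\Pi^{(-1),\sim}_\ell\phi\|_{-1,\sim}^2\le C\,\|\phi\|_{-s,\sim}^2\qquad\text{for all }\phi\in\widetilde H^{-s}(\Omega),$$ where in both cases the series converges. -/

import Mathlib

open MeasureTheory Set Filter Topology
open scoped ENNReal NNReal InnerProductSpace

noncomputable section

namespace NegSobolev

/-! ### Real interpolation of a continuously embedded pair `X₁ → X₀` (the K-method) -/

section Interpolation

variable {X₀ X₁ : Type*} [NormedAddCommGroup X₀] [NormedSpace ℝ X₀]
  [NormedAddCommGroup X₁] [NormedSpace ℝ X₁]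

/-- The K-functional `K(t, u) = inf_{v ∈ X₁} (‖u - v‖₀ + t ‖v‖₁)`. -/
def kFunctional (j : X₁ →L[ℝ] X₀) (t : ℝ) (u : X₀) : ℝ≥0∞ :=
  ⨅ v : X₁, (‖u - j v‖ₑ + ENNReal.ofReal t * ‖v‖ₑ)

/-- The measure `dt / t` on `(0, ∞)`. -/
def dtOverT : Measure ℝ :=
  (volume.restrict (Ioi 0)).withDensity fun t => ENNReal.ofReal t⁻¹

/-- The norm `(∫₀^∞ (t^{-θ} K(t, u))² dt/t)^{1/2}` of `[X₀, X₁]_{θ,2}`, possibly infinite. -/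
def interpENorm (j : X₁ →L[ℝ] X₀) (θ : ℝ) (u : X₀) : ℝ≥0∞ :=
  (∫⁻ t, (ENNReal.ofReal (t ^ (-θ)) * kFunctional j t u) ^ (2 : ℝ) ∂dtOverT) ^ (1 / 2 : ℝ)

variable (j : X₁ →L[ℝ] X₀) (θ : ℝ)

theorem kFunctional_mono (u : X₀) : Monotone fun t => kFunctional j t u := by
  intro s t hst
  exact iInf_mono fun v => by gcongr

theorem kFunctional_add_le (t : ℝ) (u w : X₀) :
    kFunctional j t (u + w) ≤ kFunctional j t u + kFunctional j t w := by
  unfold kFunctional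
  simp_rw [ENNReal.iInf_add, ENNReal.add_iInf]
  refine le_iInf fun v => le_iInf fun v' => (iInf_le _ (v + v')).trans ?_
  have h1 : ‖u + w - j (v + v')‖ₑ ≤ ‖u - j v‖ₑ + ‖w - j v'‖ₑ := by
    have : u + w - j (v + v') = (u - j v) + (w - j v') := by rw [map_add]; abel
    rw [this]; exact enorm_add_le _ _
  have h2 : ‖v + v'‖ₑ ≤ ‖v‖ₑ + ‖v'‖ₑ := enorm_add_le _ _
  calc _ ≤ (‖u - j v‖ₑ + ‖w - j v'‖ₑ) + ENNReal.ofReal t * (‖v‖ₑ + ‖v'‖ₑ) := by gcongr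
    _ = _ := by ring

theorem kFunctional_smul_le (t : ℝ) (c : ℝ) (u : X₀) :
    kFunctional j t (c • u) ≤ ‖c‖ₑ * kFunctional j t u := by
  unfold kFunctional
  rcases eq_or_ne c 0 with rfl | hc
  · exact (iInf_le _ 0).trans (by simp)
  rw [ENNReal.mul_iInf_of_ne (by simpa using hc) (by simp)]
  refine le_iInf fun v => (iInf_le _ (c • v)).trans (le_of_eq ?_)
  rw [map_smul, ← smul_sub, enorm_smul, enorm_smul]
  ring

theorem measurable_integrand (u : X₀) :
    Measurable fun t : ℝ => ENNReal.ofReal (t ^ (-θ)) * kFunctional j t u :=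
  (by fun_prop : Measurable fun t : ℝ => ENNReal.ofReal (t ^ (-θ))).mul
    (kFunctional_mono j u).measurable

theorem interpENorm_add_le (u w : X₀) :
    interpENorm j θ (u + w) ≤ interpENorm j θ u + interpENorm j θ w := by
  refine le_trans ?_ (ENNReal.lintegral_Lp_add_le (p := 2)
    (measurable_integrand j θ u).aemeasurable (measurable_integrand j θ w).aemeasurable
    (by norm_num))
  unfold interpENorm
  gcongr with t
  simp only [Pi.add_apply]
  rw [← mul_add]
  gcongr
  exact kFunctional_add_le j t u w

theorem interpENorm_smul_le (c : ℝ) (u : X₀) :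
    interpENorm j θ (c • u) ≤ ‖c‖ₑ * interpENorm j θ u := by
  have h : ∫⁻ t, (ENNReal.ofReal (t ^ (-θ)) * kFunctional j t (c • u)) ^ (2 : ℝ) ∂dtOverT ≤
      ‖c‖ₑ ^ (2 : ℝ) *
        ∫⁻ t, (ENNReal.ofReal (t ^ (-θ)) * kFunctional j t u) ^ (2 : ℝ) ∂dtOverT := by
    rw [← lintegral_const_mul' _ _ (by finiteness)]
    refine lintegral_mono fun t => ?_
    rw [← ENNReal.mul_rpow_of_nonneg _ _ (by norm_num)]
    refine ENNReal.rpow_le_rpow ?_ (by norm_num)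
    calc _ ≤ ENNReal.ofReal (t ^ (-θ)) * (‖c‖ₑ * kFunctional j t u) := by
          gcongr; exact kFunctional_smul_le j t c u
      _ = _ := by ring
  refine (ENNReal.rpow_le_rpow h (by norm_num : (0 : ℝ) ≤ 1 / 2)).trans (le_of_eq ?_)
  rw [ENNReal.mul_rpow_of_nonneg _ _ (by norm_num), ← ENNReal.rpow_mul]
  norm_num [interpENorm]

theorem interpENorm_zero : interpENorm j θ 0 = 0 := by
  simpa using interpENorm_smul_le j θ 0 0

theorem enorm_le_kFunctional {t : ℝ} (ht : 0 < t) (u : X₀) :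
    ‖u‖ₑ ≤ (1 + ‖j‖ₑ / ENNReal.ofReal t) * kFunctional j t u := by
  have h0 : ENNReal.ofReal t ≠ 0 := by simpa using ht
  have hfin : (1 + ‖j‖ₑ / ENNReal.ofReal t) ≠ ∞ :=
    ENNReal.add_ne_top.2 ⟨by simp, (ENNReal.div_lt_top (by simp) h0).ne⟩
  unfold kFunctional
  rw [ENNReal.mul_iInf_of_ne (by simp) hfin]
  refine le_iInf fun v => ?_
  calc ‖u‖ₑ ≤ ‖u - j v‖ₑ + ‖j v‖ₑ := by
        simpa using enorm_add_le (u - j v) (j v)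
    _ ≤ ‖u - j v‖ₑ + ‖j‖ₑ * ‖v‖ₑ := by gcongr; exact j.le_opENorm v
    _ = 1 * ‖u - j v‖ₑ + ‖j‖ₑ / ENNReal.ofReal t * (ENNReal.ofReal t * ‖v‖ₑ) := by
        rw [one_mul, ← mul_assoc, ENNReal.div_mul_cancel h0 (by simp)]
    _ ≤ (1 + ‖j‖ₑ / ENNReal.ofReal t) * ‖u - j v‖ₑ +
        (1 + ‖j‖ₑ / ENNReal.ofReal t) * (ENNReal.ofReal t * ‖v‖ₑ) := by
        gcongr
        · simp
        · exact le_add_self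
    _ = _ := by ring

theorem eq_zero_of_interpENorm_eq_zero {u : X₀} (h : interpENorm j θ u = 0) : u = 0 := by
  have h1 : ∫⁻ t, (ENNReal.ofReal (t ^ (-θ)) * kFunctional j t u) ^ (2 : ℝ) ∂dtOverT = 0 := by
    simpa [interpENorm, ENNReal.rpow_eq_zero_iff, show ¬ ((2 : ℝ) < 0) by norm_num] using h
  rw [lintegral_eq_zero_iff ((measurable_integrand j θ u).pow_const _)] at h1
  unfold dtOverT at h1
  rw [Filter.EventuallyEq, ae_withDensity_iff (by fun_prop),
    ae_restrict_iff' measurableSet_Ioi] at h1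
  have hne : ∃ t : ℝ, t ∈ Ioi (0 : ℝ) ∧ (t ∈ Ioi (0 : ℝ) → ENNReal.ofReal t⁻¹ ≠ 0 →
      (ENNReal.ofReal (t ^ (-θ)) * kFunctional j t u) ^ (2 : ℝ) = (0 : ℝ → ℝ≥0∞) t) := by
    by_contra! hcon
    have : Ioi (0 : ℝ) ⊆ {t | ¬ (t ∈ Ioi (0 : ℝ) → ENNReal.ofReal t⁻¹ ≠ 0 →
      (ENNReal.ofReal (t ^ (-θ)) * kFunctional j t u) ^ (2 : ℝ) = (0 : ℝ → ℝ≥0∞) t)} := by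
      intro t ht
      have := hcon t ht
      simp only [mem_ofPred_eq]
      push Not
      exact this
    have h2 := measure_mono_null this h1
    simp at h2
  obtain ⟨t, ht, h3⟩ := hne
  have ht' : (0 : ℝ) < t := ht
  have h4 := h3 ht (by simpa using ht')
  have h5 : kFunctional j t u = 0 := by
    simp only [Pi.zero_apply, ENNReal.rpow_eq_zero_iff, mul_eq_zero, ENNReal.ofReal_eq_zero] at h4
    have := Real.rpow_pos_of_pos ht' (-θ)
    rcases h4 with ⟨h | h, _⟩ | ⟨_, h⟩
    · linarith
    · exact h
    · norm_num at h
  simpa [h5] using enorm_le_kFunctional j ht' u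

/-- The interpolation space `[X₀, X₁]_{θ,2}` as a subspace of `X₀`. -/
def interpSubmodule : Submodule ℝ X₀ where
  carrier := {u | interpENorm j θ u < ∞}
  add_mem' hu hw := (interpENorm_add_le j θ _ _).trans_lt (ENNReal.add_lt_top.2 ⟨hu, hw⟩)
  zero_mem' := by simp [interpENorm_zero]
  smul_mem' c _ hu := (interpENorm_smul_le j θ c _).trans_lt (ENNReal.mul_lt_top (by simp) hu)

/-- The interpolation space `[X₀, X₁]_{θ,2}`, with its own norm (not that of `X₀`). -/
def Interp : Type _ := ↥(interpSubmodule j θ)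

instance : AddCommGroup (Interp j θ) := inferInstanceAs (AddCommGroup ↥(interpSubmodule j θ))

instance : Module ℝ (Interp j θ) := inferInstanceAs (Module ℝ ↥(interpSubmodule j θ))

instance : Norm (Interp j θ) where
  norm u := (interpENorm j θ u.1).toReal

theorem interp_norm_def (u : Interp j θ) : ‖u‖ = (interpENorm j θ u.1).toReal := rfl

theorem interp_core : NormedSpace.Core ℝ (Interp j θ) where
  norm_nonneg u := ENNReal.toReal_nonneg
  norm_smul c u := by
    have hle : ∀ (c : ℝ) (u : Interp j θ), ‖c • u‖ ≤ ‖c‖ * ‖u‖ := fun c u => by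
      have h := ENNReal.toReal_mono
        (ENNReal.mul_lt_top (by simp) (show interpENorm j θ u.1 < ∞ from u.2)).ne
        (interpENorm_smul_le j θ c u.1)
      rw [ENNReal.toReal_mul, toReal_enorm] at h
      exact h
    refine le_antisymm (hle c u) ?_
    rcases eq_or_ne c 0 with rfl | hc
    · rw [norm_zero, zero_mul]; exact ENNReal.toReal_nonneg
    · have h := hle c⁻¹ (c • u)
      rw [inv_smul_smul₀ hc, norm_inv] at h
      have hc' : 0 < ‖c‖ := norm_pos_iff.2 hc
      rwa [inv_mul_eq_div, le_div_iff₀ hc', mul_comm] at h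
  norm_triangle u w := by
    have hu : interpENorm j θ u.1 < ∞ := u.2
    have hw : interpENorm j θ w.1 < ∞ := w.2
    have h := ENNReal.toReal_mono (ENNReal.add_lt_top.2 ⟨hu, hw⟩).ne
      (interpENorm_add_le j θ u.1 w.1)
    rw [ENNReal.toReal_add hu.ne hw.ne] at h
    exact h
  norm_eq_zero_iff u := by
    constructor
    · intro h
      have hu : interpENorm j θ u.1 < ∞ := u.2
      rw [interp_norm_def, ENNReal.toReal_eq_zero_iff, or_iff_left hu.ne] at h
      exact Subtype.ext (eq_zero_of_interpENorm_eq_zero j θ h)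
    · rintro rfl
      have : interpENorm j θ (0 : Interp j θ).1 = 0 := interpENorm_zero j θ
      rw [interp_norm_def, this, ENNReal.toReal_zero]

instance : NormedAddCommGroup (Interp j θ) := NormedAddCommGroup.ofCore (interp_core j θ)

instance : NormedSpace ℝ (Interp j θ) := NormedSpace.ofCore (interp_core j θ)

theorem kFunctional_map_le (t : ℝ) (v : X₁) :
    kFunctional j t (j v) ≤ ENNReal.ofReal (min ‖j‖ t) * ‖v‖ₑ := by
  rcases min_choice ‖j‖ t with h | h <;> rw [h]
  · refine (iInf_le _ 0).trans ?_
    simpa using j.le_opENorm v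
  · refine (iInf_le _ v).trans ?_
    simp

theorem lintegral_min_lt_top (hθ : θ ∈ Ioo (0 : ℝ) 1) (C : ℝ) :
    ∫⁻ t, (ENNReal.ofReal (t ^ (-θ)) * ENNReal.ofReal (min C t)) ^ (2 : ℝ) ∂dtOverT < ∞ := by
  unfold dtOverT
  rw [lintegral_withDensity_eq_lintegral_mul _ (by fun_prop) (by fun_prop),
    ← Ioc_union_Ioi_eq_Ioi zero_le_one]
  refine (lintegral_union_le _ _ _).trans_lt (ENNReal.add_lt_top.2 ⟨?_, ?_⟩)
  · have hint : IntegrableOn (fun t : ℝ => t ^ (1 - 2 * θ)) (Ioc 0 1) := by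
      rw [← intervalIntegrable_iff_integrableOn_Ioc_of_le zero_le_one]
      exact intervalIntegral.intervalIntegrable_rpow' (by linarith [hθ.2])
    refine (setLIntegral_mono' measurableSet_Ioc fun t ht => ?_).trans_lt hint.lintegral_lt_top
    have ht0 : 0 < t := ht.1
    have e : t ^ (1 - 2 * θ) = t⁻¹ * (t ^ (-θ) * t) ^ (2 : ℝ) := by
      rw [Real.mul_rpow (by positivity) ht0.le, ← Real.rpow_mul ht0.le, ← Real.rpow_neg_one,
        ← Real.rpow_add ht0, ← Real.rpow_add ht0]
      ring_nf
    rw [e, ENNReal.ofReal_mul (by positivity),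
      ← ENNReal.ofReal_rpow_of_nonneg (by positivity) (by norm_num),
      ENNReal.ofReal_mul (by positivity), Pi.mul_apply]
    gcongr
    exact min_le_right _ _
  · have hint : IntegrableOn (fun t : ℝ => |C| ^ (2 : ℝ) * t ^ (-1 - 2 * θ)) (Ioi 1) :=
      (integrableOn_Ioi_rpow_of_lt (by linarith [hθ.1]) zero_lt_one).const_mul _
    refine (setLIntegral_mono' measurableSet_Ioi fun t ht => ?_).trans_lt hint.lintegral_lt_top
    have ht0 : 0 < t := zero_lt_one.trans ht
    have e : |C| ^ (2 : ℝ) * t ^ (-1 - 2 * θ) = t⁻¹ * (t ^ (-θ) * |C|) ^ (2 : ℝ) := by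
      rw [Real.mul_rpow (by positivity) (abs_nonneg C), ← Real.rpow_mul ht0.le,
        ← Real.rpow_neg_one, ← mul_assoc, ← Real.rpow_add ht0]
      ring_nf
    rw [e, ENNReal.ofReal_mul (by positivity),
      ← ENNReal.ofReal_rpow_of_nonneg (by positivity) (by norm_num),
      ENNReal.ofReal_mul (by positivity), Pi.mul_apply]
    gcongr
    exact (min_le_left _ _).trans (le_abs_self C)

theorem interpENorm_map_le (v : X₁) :
    interpENorm j θ (j v) ≤ (∫⁻ t, (ENNReal.ofReal (t ^ (-θ)) *
      ENNReal.ofReal (min ‖j‖ t)) ^ (2 : ℝ) ∂dtOverT) ^ (1 / 2 : ℝ) * ‖v‖ₑ := by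
  have h : ∫⁻ t, (ENNReal.ofReal (t ^ (-θ)) * kFunctional j t (j v)) ^ (2 : ℝ) ∂dtOverT ≤
      (∫⁻ t, (ENNReal.ofReal (t ^ (-θ)) * ENNReal.ofReal (min ‖j‖ t)) ^ (2 : ℝ) ∂dtOverT) *
        ‖v‖ₑ ^ (2 : ℝ) := by
    unfold dtOverT
    rw [← lintegral_mul_const' _ _ (by finiteness),
      lintegral_withDensity_eq_lintegral_mul _ (by fun_prop)
        ((measurable_integrand j θ _).pow_const _),
      lintegral_withDensity_eq_lintegral_mul _ (by fun_prop) (by fun_prop)]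
    refine setLIntegral_mono' measurableSet_Ioi fun t ht => ?_
    simp only [Pi.mul_apply]
    rw [← ENNReal.mul_rpow_of_nonneg _ _ (by norm_num), mul_assoc (ENNReal.ofReal (t ^ (-θ)))]
    gcongr
    exact kFunctional_map_le j t v
  refine (ENNReal.rpow_le_rpow h (by norm_num : (0 : ℝ) ≤ 1 / 2)).trans (le_of_eq ?_)
  rw [ENNReal.mul_rpow_of_nonneg _ _ (by norm_num), ← ENNReal.rpow_mul ‖v‖ₑ]
  norm_num

/-- The continuous embedding `X₁ → [X₀, X₁]_{θ,2}` for `0 < θ < 1`. -/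
def interpIncl {θ : ℝ} (hθ : θ ∈ Ioo (0 : ℝ) 1) : X₁ →L[ℝ] Interp j θ :=
  LinearMap.mkContinuous
    { toFun := fun v => ⟨j v, (interpENorm_map_le j θ v).trans_lt
        (ENNReal.mul_lt_top (ENNReal.rpow_lt_top_of_nonneg (by norm_num)
          (lintegral_min_lt_top θ hθ ‖j‖).ne) (by simp))⟩
      map_add' := fun v w => Subtype.ext (map_add j v w)
      map_smul' := fun c v => Subtype.ext (map_smul j c v) }
    ((∫⁻ t, (ENNReal.ofReal (t ^ (-θ)) *
      ENNReal.ofReal (min ‖j‖ t)) ^ (2 : ℝ) ∂dtOverT) ^ (1 / 2 : ℝ)).toReal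
    fun v => by
      have h := ENNReal.toReal_mono (ENNReal.mul_lt_top (ENNReal.rpow_lt_top_of_nonneg
        (by norm_num : (0 : ℝ) ≤ 1 / 2) (lintegral_min_lt_top θ hθ ‖j‖).ne)
          (by simp : ‖v‖ₑ < ∞)).ne (interpENorm_map_le j θ v)
      rw [ENNReal.toReal_mul, toReal_enorm] at h
      exact h

end Interpolation

/-! ### The dual of a Hilbert space, as a Hilbert space -/

/-- The inner product on the dual of a real Hilbert space that induces the dual norm. -/
instance dualInnerProductSpace (V : Type*) [NormedAddCommGroup V] [InnerProductSpace ℝ V]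
    [CompleteSpace V] : InnerProductSpace ℝ (StrongDual ℝ V) where
  inner φ ψ := inner ℝ ((InnerProductSpace.toDual ℝ V).symm φ)
    ((InnerProductSpace.toDual ℝ V).symm ψ)
  norm_sq_eq_re_inner φ := by
    rw [real_inner_self_eq_norm_sq, LinearIsometryEquiv.norm_map]
    simp
  conj_inner_symm φ ψ := (conj_trivial _).trans (real_inner_comm _ _)
  add_left φ ψ χ := by rw [map_add, inner_add_left]
  smul_left φ ψ r := by rw [map_smulₛₗ, inner_smul_left]; simp

/-- The embedding `f ↦ ⟨f, j ·⟩` of a Hilbert space `X₀` into the dual of `X₁`. -/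
def dualEmbed {X₀ X₁ : Type*} [NormedAddCommGroup X₀] [InnerProductSpace ℝ X₀]
    [NormedAddCommGroup X₁] [NormedSpace ℝ X₁] (j : X₁ →L[ℝ] X₀) :
    X₀ →ₗ[ℝ] StrongDual ℝ X₁ where
  toFun f := (innerSL ℝ f).comp j
  map_add' f g := by ext v; simp
  map_smul' c f := by ext v; simp

/-! ### Lipschitz domains -/

/-- `d`-dimensional Euclidean space. -/
abbrev Euc (d : ℕ) := EuclideanSpace ℝ (Fin d)

/-- Near every boundary point, in suitable Cartesian coordinates (`e` is the last coordinate
direction), the set is the strict epigraph of a Lipschitz function. -/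
def HasLipschitzBoundary {d : ℕ} (S : Set (Euc d)) : Prop :=
  ∀ x ∈ frontier S, ∃ (e : Euc d) (γ : Euc d → ℝ) (K : ℝ≥0) (U : Set (Euc d)),
    ‖e‖ = 1 ∧ LipschitzWith K γ ∧ IsOpen U ∧ x ∈ U ∧
      ∀ y ∈ U, (y ∈ S ↔ γ (y - inner ℝ e y • e) < inner ℝ e y)

/-- A nonempty bounded simply connected Lipschitz domain in `ℝ^d`, `d ≥ 2`. -/
structure LipschitzDomain (d : ℕ) where
  carrier : Set (Euc d)
  two_le_dim : 2 ≤ d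
  isOpen : IsOpen carrier
  nonempty : carrier.Nonempty
  isBounded : Bornology.IsBounded carrier
  isSimplyConnected : IsSimplyConnected carrier
  hasLipschitzBoundary : HasLipschitzBoundary carrier

variable {d : ℕ} (Ω : LipschitzDomain d)

/-! ### Sobolev spaces of order one -/

/-- `L²(Ω)`. -/
abbrev L2 : Type := Lp ℝ 2 (volume.restrict Ω.carrier)

/-- `L²(Ω)^d`. -/
abbrev L2Vec : Type := Lp (Euc d) 2 (volume.restrict Ω.carrier)

/-- Smooth functions with compact support in `Ω`. -/
structure IsTestFunction (φ : Euc d → ℝ) : Prop where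
  contDiff : ContDiff ℝ (⊤ : ℕ∞) φ
  hasCompactSupport : HasCompactSupport φ
  tsupport_subset : tsupport φ ⊆ Ω.carrier

/-- `g` is the weak gradient of `u` in `Ω`. -/
def IsWeakGradient (u : L2 Ω) (g : L2Vec Ω) : Prop :=
  ∀ φ : Euc d → ℝ, IsTestFunction Ω φ → ∀ i : Fin d,
    ∫ x in Ω.carrier, u x * gradient φ x i = -∫ x in Ω.carrier, g x i * φ x

variable {Ω}

theorem IsTestFunction.continuous_gradient {φ : Euc d → ℝ} (h : IsTestFunction Ω φ) :
    Continuous (gradient φ) :=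
  (InnerProductSpace.toDual ℝ (Euc d)).symm.continuous.comp
    (h.contDiff.continuous_fderiv (by simp))

theorem IsTestFunction.hasCompactSupport_gradient {φ : Euc d → ℝ} (h : IsTestFunction Ω φ) :
    HasCompactSupport (gradient φ) :=
  (h.hasCompactSupport.fderiv ℝ).comp_left (map_zero _)

theorem IsTestFunction.memLp {φ : Euc d → ℝ} (h : IsTestFunction Ω φ) :
    MemLp φ 2 (volume.restrict Ω.carrier) :=
  (h.contDiff.continuous.memLp_of_hasCompactSupport h.hasCompactSupport).restrict _

theorem IsTestFunction.memLp_gradient {φ : Euc d → ℝ} (h : IsTestFunction Ω φ) :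
    MemLp (gradient φ) 2 (volume.restrict Ω.carrier) :=
  (h.continuous_gradient.memLp_of_hasCompactSupport h.hasCompactSupport_gradient).restrict _

theorem IsTestFunction.memLp_smul_single {φ : Euc d → ℝ} (h : IsTestFunction Ω φ) (i : Fin d) :
    MemLp (fun x => φ x • EuclideanSpace.single i (1 : ℝ)) 2 (volume.restrict Ω.carrier) :=
  ((h.contDiff.continuous.smul continuous_const).memLp_of_hasCompactSupport
    h.hasCompactSupport.smul_right).restrict _

theorem IsTestFunction.memLp_gradient_apply {φ : Euc d → ℝ} (h : IsTestFunction Ω φ)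
    (i : Fin d) : MemLp (fun x => gradient φ x i) 2 (volume.restrict Ω.carrier) :=
  h.memLp_gradient.eval_piLp i

/-- The weak-gradient condition, through inner products in `L²`. -/
theorem isWeakGradient_iff (u : L2 Ω) (g : L2Vec Ω) :
    IsWeakGradient Ω u g ↔ ∀ φ : Euc d → ℝ, ∀ h : IsTestFunction Ω φ, ∀ i : Fin d,
      inner ℝ ((h.memLp_gradient_apply i).toLp _) u =
        -inner ℝ ((h.memLp_smul_single i).toLp _) g := by
  refine forall_congr' fun φ => forall_congr' fun h => forall_congr' fun i => ?_
  rw [L2.inner_def, L2.inner_def]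
  have h1 : ∫ x in Ω.carrier, inner ℝ ((h.memLp_gradient_apply i).toLp _ x) (u x) =
      ∫ x in Ω.carrier, u x * gradient φ x i := by
    refine integral_congr_ae ?_
    filter_upwards [(h.memLp_gradient_apply i).coeFn_toLp] with x hx
    rw [hx]; simp
  have h2 : ∫ x in Ω.carrier, inner ℝ ((h.memLp_smul_single i).toLp _ x) (g x) =
      ∫ x in Ω.carrier, g x i * φ x := by
    refine integral_congr_ae ?_
    filter_upwards [(h.memLp_smul_single i).coeFn_toLp] with x hx
    rw [hx, inner_smul_left, EuclideanSpace.inner_single_left]; simp [mul_comm]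
  rw [h1, h2]

variable (Ω)

/-- `H¹(Ω)`: the pairs `(u, ∇u)` with `u ∈ L²(Ω)` and weak gradient `∇u ∈ L²(Ω)^d`; the inherited
norm is `(‖u‖² + ‖∇u‖²)^{1/2}`. -/
def h1Submodule : Submodule ℝ (WithLp 2 (L2 Ω × L2Vec Ω)) where
  carrier := {p | IsWeakGradient Ω p.fst p.snd}
  add_mem' {p q} hp hq := by
    simp only [mem_ofPred_eq, isWeakGradient_iff] at *
    intro φ h i
    rw [WithLp.add_fst, WithLp.add_snd, inner_add_right, inner_add_right, hp φ h i, hq φ h i]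
    ring
  zero_mem' := by
    simp only [mem_ofPred_eq, isWeakGradient_iff]
    intro φ h i
    simp
  smul_mem' c p hp := by
    simp only [mem_ofPred_eq, isWeakGradient_iff] at *
    intro φ h i
    rw [WithLp.smul_fst, WithLp.smul_snd, inner_smul_right, inner_smul_right, hp φ h i]
    ring

/-- The Hilbert space `H¹(Ω)`. -/
abbrev H1 : Type := ↥(h1Submodule Ω)

theorem isClosed_h1Submodule : IsClosed (h1Submodule Ω : Set (WithLp 2 (L2 Ω × L2Vec Ω))) := by
  have : (h1Submodule Ω : Set (WithLp 2 (L2 Ω × L2Vec Ω))) =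
      {p | IsWeakGradient Ω p.fst p.snd} := rfl
  rw [this]
  simp only [isWeakGradient_iff, ofPred_forall]
  refine isClosed_iInter fun φ => isClosed_iInter fun h => isClosed_iInter fun i => ?_
  exact isClosed_eq (by fun_prop) (by fun_prop)

instance : CompleteSpace (H1 Ω) := (isClosed_h1Submodule Ω).completeSpace_coe

/-- The embedding `H¹(Ω) → L²(Ω)`. -/
def h1ToL2 : H1 Ω →L[ℝ] L2 Ω := (WithLp.fstL 2 ℝ (L2 Ω) (L2Vec Ω)).comp (h1Submodule Ω).subtypeL

/-- The weak gradient on `H¹(Ω)`. -/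
def h1Grad : H1 Ω →L[ℝ] L2Vec Ω :=
  (WithLp.sndL 2 ℝ (L2 Ω) (L2Vec Ω)).comp (h1Submodule Ω).subtypeL

/-- The elements of `H¹(Ω)` given by smooth functions with compact support in `Ω`. -/
def testSubmodule : Submodule ℝ (H1 Ω) where
  carrier := {v | ∃ φ : Euc d → ℝ, IsTestFunction Ω φ ∧
    h1ToL2 Ω v =ᵐ[volume.restrict Ω.carrier] φ ∧
    h1Grad Ω v =ᵐ[volume.restrict Ω.carrier] gradient φ}
  add_mem' {v w} := by
    rintro ⟨φ, hφ, h1, h2⟩ ⟨ψ, hψ, h3, h4⟩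
    refine ⟨φ + ψ, ⟨hφ.contDiff.add hψ.contDiff, hφ.hasCompactSupport.add hψ.hasCompactSupport,
      (tsupport_add φ ψ).trans (union_subset hφ.tsupport_subset hψ.tsupport_subset)⟩, ?_, ?_⟩
    · rw [map_add]
      exact (Lp.coeFn_add _ _).trans (h1.add h3)
    · rw [map_add]
      refine (Lp.coeFn_add _ _).trans ((h2.add h4).trans (Eventually.of_forall fun x => ?_))
      have e1 := hφ.contDiff.differentiable (by simp) x
      have e2 := hψ.contDiff.differentiable (by simp) x
      simp [gradient, fderiv_add e1 e2]
  zero_mem' := by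
    refine ⟨0, ⟨contDiff_const, HasCompactSupport.zero, by simp [tsupport]⟩, ?_, ?_⟩
    · rw [map_zero]; exact Lp.coeFn_zero _ _ _
    · rw [map_zero]
      refine (Lp.coeFn_zero _ _ _).trans (Eventually.of_forall fun x => ?_)
      simp [gradient]
  smul_mem' c v := by
    rintro ⟨φ, hφ, h1, h2⟩
    refine ⟨c • φ, ⟨hφ.contDiff.const_smul c, hφ.hasCompactSupport.smul_left (f := fun _ => c),
      (closure_mono (Function.support_const_smul_subset c φ)).trans hφ.tsupport_subset⟩, ?_, ?_⟩
    · rw [map_smul]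
      exact (Lp.coeFn_smul _ _).trans (h1.const_smul c)
    · rw [map_smul]
      refine (Lp.coeFn_smul _ _).trans ((h2.const_smul c).trans (Eventually.of_forall fun x => ?_))
      have e1 := hφ.contDiff.differentiable (by simp) x
      simp [gradient, fderiv_const_smul e1]

/-- `H¹₀(Ω)`, the closure in `H¹(Ω)` of the smooth functions with compact support in `Ω`. -/
def h10Submodule : Submodule ℝ (H1 Ω) := (testSubmodule Ω).topologicalClosure

theorem friedrichs_test : ∃ C : ℝ, 0 ≤ C ∧ ∀ v ∈ testSubmodule Ω,
    ‖h1ToL2 Ω v‖ ≤ C * ‖h1Grad Ω v‖ := by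
  have hd : (2 : ℝ) ≤ d := by exact_mod_cast Ω.two_le_dim
  set p : ℝ≥0 := ⟨2 * d / (d + 2), by positivity⟩ with hp
  have hp1 : (1 : ℝ≥0) ≤ p := by
    rw [← NNReal.coe_le_coe, hp]
    change (1 : ℝ) ≤ 2 * d / (d + 2)
    rw [le_div_iff₀ (by positivity)]; linarith
  have hp2 : p ≤ 2 := by
    rw [← NNReal.coe_le_coe, hp]
    change (2 * d / (d + 2) : ℝ) ≤ 2
    rw [div_le_iff₀ (by positivity)]; linarith
  have hpd : p < Module.finrank ℝ (Euc d) := by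
    rw [finrank_euclideanSpace_fin, ← NNReal.coe_lt_coe, hp]
    change (2 * d / (d + 2) : ℝ) < d
    rw [div_lt_iff₀ (by positivity)]; nlinarith
  have hpq : ((p⁻¹ : ℝ≥0) : ℝ) - (Module.finrank ℝ (Euc d) : ℝ)⁻¹ ≤ ((2 : ℝ≥0) : ℝ)⁻¹ := by
    rw [finrank_euclideanSpace_fin, NNReal.coe_inv, hp]
    change (2 * d / (d + 2) : ℝ)⁻¹ - (d : ℝ)⁻¹ ≤ 2⁻¹
    refine le_of_eq ?_
    have : (d : ℝ) ≠ 0 := by positivity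
    field_simp
    ring
  have hvol : volume Ω.carrier < ⊤ := Ω.isBounded.measure_lt_top
  set A : ℝ≥0∞ := (eLpNormLESNormFDerivOfLeConst ℝ (volume : Measure (Euc d)) Ω.carrier p 2 : ℝ≥0∞)
    * (volume Ω.carrier) ^ (1 / (p : ℝ≥0∞).toReal - 1 / (2 : ℝ≥0∞).toReal) with hA
  have hA_top : A ≠ ⊤ := by
    refine ENNReal.mul_ne_top (by simp) (ENNReal.rpow_ne_top_of_nonneg ?_ hvol.ne)
    have : (0 : ℝ) < p := lt_of_lt_of_le one_pos (by exact_mod_cast hp1)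
    have h2 : (p : ℝ) ≤ 2 := by exact_mod_cast hp2
    simpa using one_div_le_one_div_of_le this h2
  refine ⟨A.toReal, ENNReal.toReal_nonneg, ?_⟩
  rintro v ⟨φ, hφ, h1, h2⟩
  have hsupp : φ.support ⊆ Ω.carrier := subset_closure.trans hφ.tsupport_subset
  have hsupp' : (fderiv ℝ φ).support ⊆ Ω.carrier :=
    (support_fderiv_subset ℝ).trans hφ.tsupport_subset
  have key := eLpNorm_le_eLpNorm_fderiv_of_le (μ := (volume : Measure (Euc d)))
    (hφ.contDiff.of_le (by simp)) hsupp hp1 hpd hpq Ω.isBounded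
  rw [← eLpNorm_restrict_eq_of_support_subset hsupp,
    ← eLpNorm_restrict_eq_of_support_subset (f := fderiv ℝ φ) hsupp'] at key
  have hm : AEStronglyMeasurable (fderiv ℝ φ) (volume.restrict Ω.carrier) :=
    (hφ.contDiff.continuous_fderiv (by simp)).aestronglyMeasurable
  have hold := eLpNorm_le_eLpNorm_mul_rpow_measure_univ (p := (p : ℝ≥0∞)) (q := 2)
    (by exact_mod_cast hp2) hm
  have hgr : eLpNorm (fderiv ℝ φ) 2 (volume.restrict Ω.carrier) =
      eLpNorm (gradient φ) 2 (volume.restrict Ω.carrier) :=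
    eLpNorm_congr_norm_ae (Eventually.of_forall fun x => by simp [gradient])
  rw [Measure.restrict_apply_univ, hgr] at hold
  have hfin : eLpNorm φ 2 (volume.restrict Ω.carrier) ≤
      A * eLpNorm (gradient φ) 2 (volume.restrict Ω.carrier) := by
    refine (le_trans (by exact_mod_cast key) (mul_le_mul_right hold _)).trans (le_of_eq ?_)
    rw [hA]; ring
  rw [Lp.norm_def, Lp.norm_def, ← ENNReal.toReal_mul, eLpNorm_congr_ae h1, eLpNorm_congr_ae h2]
  exact ENNReal.toReal_mono (ENNReal.mul_ne_top hA_top hφ.memLp_gradient.eLpNorm_ne_top) hfin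

theorem friedrichs : ∃ C : ℝ, 0 ≤ C ∧ ∀ v ∈ h10Submodule Ω,
    ‖h1ToL2 Ω v‖ ≤ C * ‖h1Grad Ω v‖ := by
  obtain ⟨C, hC, h⟩ := friedrichs_test Ω
  refine ⟨C, hC, fun v hv => ?_⟩
  have hcl : IsClosed {v : H1 Ω | ‖h1ToL2 Ω v‖ ≤ C * ‖h1Grad Ω v‖} :=
    isClosed_le (by fun_prop) (by fun_prop)
  exact closure_minimal h hcl hv

/-- The Hilbert space `H¹₀(Ω)`, normed by `‖∇v‖`. -/
def H10 : Type := ↥(h10Submodule Ω)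

namespace H10

instance : AddCommGroup (H10 Ω) := inferInstanceAs (AddCommGroup ↥(h10Submodule Ω))

instance : Module ℝ (H10 Ω) := inferInstanceAs (Module ℝ ↥(h10Submodule Ω))

/-- The inclusion `H¹₀(Ω) ⊆ H¹(Ω)` as a linear map. -/
def toH1 : H10 Ω →ₗ[ℝ] H1 Ω := (h10Submodule Ω).subtype

/-- The gradient on `H¹₀(Ω)`. -/
def grad : H10 Ω →ₗ[ℝ] L2Vec Ω := (h1Grad Ω).toLinearMap ∘ₗ toH1 Ω

theorem toH1_injective : Function.Injective (toH1 Ω) := Subtype.val_injective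

theorem toH1_mem (v : H10 Ω) : toH1 Ω v ∈ h10Submodule Ω := v.2

theorem eq_zero_of_grad_eq_zero (v : H10 Ω) (h1 : grad Ω v = 0) : v = 0 := by
  obtain ⟨C, -, hC⟩ := friedrichs Ω
  have h2 : h1ToL2 Ω (toH1 Ω v) = 0 := by
    have h3 : h1Grad Ω (toH1 Ω v) = 0 := h1
    have := hC _ (toH1_mem Ω v)
    rw [h3, norm_zero, mul_zero] at this
    exact norm_le_zero_iff.1 this
  refine toH1_injective Ω ((Subtype.ext ?_ : toH1 Ω v = 0).trans (map_zero _).symm)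
  exact (WithLp.ofLp_injective 2) (Prod.ext h2 h1)

/-- The inner product `⟨∇v, ∇w⟩` on `H¹₀(Ω)`. -/
@[reducible]
def core : InnerProductSpace.Core ℝ (H10 Ω) where
  inner v w := inner ℝ (grad Ω v) (grad Ω w)
  conj_inner_symm v w := (conj_trivial _).trans (real_inner_comm _ _)
  re_inner_nonneg v := (real_inner_self_nonneg : 0 ≤ inner ℝ (grad Ω v) (grad Ω v))
  add_left v w z := by rw [map_add, inner_add_left]
  smul_left v w r := by rw [map_smul, inner_smul_left]
  definite v hv := eq_zero_of_grad_eq_zero Ω v (inner_self_eq_zero.1 hv)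

instance : NormedAddCommGroup (H10 Ω) := (core Ω).toNormedAddCommGroup

instance : InnerProductSpace ℝ (H10 Ω) := InnerProductSpace.ofCore (core Ω).toCore

theorem norm_eq (v : H10 Ω) : ‖v‖ = ‖h1Grad Ω (toH1 Ω v)‖ := by
  have h : ‖v‖ ^ 2 = ‖grad Ω v‖ ^ 2 := by
    rw [← real_inner_self_eq_norm_sq, ← real_inner_self_eq_norm_sq]
    rfl
  exact (sq_eq_sq₀ (norm_nonneg _) (norm_nonneg _)).1 h

theorem h1_norm_sq (v : H1 Ω) : ‖v‖ ^ 2 = ‖h1ToL2 Ω v‖ ^ 2 + ‖h1Grad Ω v‖ ^ 2 :=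
  WithLp.prod_norm_sq_eq_of_L2 v.1

/-- The embedding `H¹₀(Ω) → L²(Ω)`. -/
def toL2 : H10 Ω →L[ℝ] L2 Ω :=
  LinearMap.mkContinuousOfExistsBound ((h1ToL2 Ω).toLinearMap ∘ₗ toH1 Ω) (by
    obtain ⟨C, -, h⟩ := friedrichs Ω
    exact ⟨C, fun v => by rw [norm_eq]; exact h _ (toH1_mem Ω v)⟩)

instance : CompleteSpace (H10 Ω) := by
  have hcl : CompleteSpace ↥(h10Submodule Ω) :=
    ((testSubmodule Ω).isClosed_topologicalClosure).completeSpace_coe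
  obtain ⟨C, hC, h⟩ := friedrichs Ω
  have b1 (v : H10 Ω) : ‖toH1 Ω v‖ ≤ (C + 1) * ‖v‖ := by
    rw [norm_eq]
    refine le_of_sq_le_sq ?_ (by positivity)
    rw [h1_norm_sq]
    have := h _ (toH1_mem Ω v)
    have h1 := norm_nonneg (h1Grad Ω (toH1 Ω v))
    have h2 := norm_nonneg (h1ToL2 Ω (toH1 Ω v))
    have h3 := mul_self_le_mul_self h2 this
    nlinarith [mul_nonneg hC (sq_nonneg ‖h1Grad Ω (toH1 Ω v)‖)]
  have b2 (v : H10 Ω) : ‖v‖ ≤ 1 * ‖toH1 Ω v‖ := by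
    rw [norm_eq, one_mul]
    refine le_of_sq_le_sq ?_ (norm_nonneg _)
    rw [h1_norm_sq]
    have := sq_nonneg ‖h1ToL2 Ω (toH1 Ω v)‖
    linarith
  let e : H10 Ω ≃ₗ[ℝ] ↥(h10Submodule Ω) :=
    { toFun := fun v => ⟨toH1 Ω v, toH1_mem Ω v⟩
      invFun := fun v => (v : ↥(h10Submodule Ω))
      left_inv := fun v => rfl
      right_inv := fun v => rfl
      map_add' := fun v w => rfl
      map_smul' := fun c v => rfl }
  let e' := e.toContinuousLinearEquivOfBounds (C + 1) 1 (fun v => b1 v)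
    (fun v => b2 (e.symm v))
  exact e'.symm.isUniformEmbedding.isUniformInducing.completeSpace_congr
    e'.symm.surjective |>.1 hcl

end H10

/-! ### Sobolev spaces of negative order -/

/-- `H^{-1}(Ω) = (H¹₀(Ω))'`, with the norm dual to `‖∇·‖`. -/
abbrev HNegOne : Type := StrongDual ℝ (H10 Ω)

/-- `H̃^{-1}(Ω) = (H¹(Ω))'`. -/
abbrev HTildeNegOne : Type := StrongDual ℝ (H1 Ω)

/-- `H̃^s(Ω) = [L²(Ω), H¹₀(Ω)]_{s,2}`. -/
abbrev HTildePos (s : ℝ) : Type := Interp (H10.toL2 Ω) s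

/-- `H^s(Ω) = [L²(Ω), H¹(Ω)]_{s,2}`. -/
abbrev HPos (s : ℝ) : Type := Interp (h1ToL2 Ω) s

/-- `H^{-s}(Ω) = (H̃^s(Ω))'`. -/
abbrev HNeg (s : ℝ) : Type := StrongDual ℝ (HTildePos Ω s)

/-- `H̃^{-s}(Ω) = (H^s(Ω))'`. -/
abbrev HTildeNeg (s : ℝ) : Type := StrongDual ℝ (HPos Ω s)

variable {Ω}

/-- The embedding `H^{-s}(Ω) → H^{-1}(Ω)`, restriction of functionals to `H¹₀(Ω)`. -/
def HNeg.toNegOne {s : ℝ} (hs : s ∈ Ioo (0 : ℝ) 1) (φ : HNeg Ω s) : HNegOne Ω :=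
  φ.comp (interpIncl (H10.toL2 Ω) hs)

/-- The embedding `H̃^{-s}(Ω) → H̃^{-1}(Ω)`, restriction of functionals to `H¹(Ω)`. -/
def HTildeNeg.toNegOne {s : ℝ} (hs : s ∈ Ioo (0 : ℝ) 1) (φ : HTildeNeg Ω s) : HTildeNegOne Ω :=
  φ.comp (interpIncl (h1ToL2 Ω) hs)

/-! ### Meshes -/

/-- The closed convex hull of a finite vertex set. -/
def hull (T : Finset (Euc d)) : Set (Euc d) := convexHull ℝ (T : Set (Euc d))

/-- `T` is the vertex set of a nondegenerate `d`-simplex. -/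
structure IsSimplex (T : Finset (Euc d)) : Prop where
  card_eq : T.card = d + 1
  affineIndependent : AffineIndependent ℝ ((↑) : T → Euc d)

variable (Ω) in
/-- A regular (conforming) simplicial mesh of `Ω`. Its elements are the open simplices
`interior (hull T)`, `T ∈ elems`. -/
structure Mesh where
  elems : Set (Finset (Euc d))
  finite : elems.Finite
  isSimplex : ∀ T ∈ elems, IsSimplex T
  cover : closure Ω.carrier = ⋃ T ∈ elems, hull T
  conforming : ∀ T ∈ elems, ∀ T' ∈ elems,
    hull T ∩ hull T' = convexHull ℝ ((T : Set (Euc d)) ∩ (T' : Set (Euc d)))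

namespace Mesh

/-- The mesh size, the largest element diameter. -/
def size (𝒯 : Mesh Ω) : ℝ := sSup ((fun T => Metric.diam (hull T)) '' 𝒯.elems)

/-- The piecewise constants `P⁰(𝒯) ⊆ L²(Ω)`. -/
def P0 (𝒯 : Mesh Ω) : Submodule ℝ (L2 Ω) where
  carrier := {u | ∀ T ∈ 𝒯.elems, ∃ c : ℝ,
    ∀ᵐ x ∂volume.restrict Ω.carrier, x ∈ interior (hull T) → u x = c}
  add_mem' {u w} hu hw T hT := by
    obtain ⟨a, ha⟩ := hu T hT
    obtain ⟨b, hb⟩ := hw T hT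
    refine ⟨a + b, ?_⟩
    filter_upwards [ha, hb, Lp.coeFn_add u w] with x h1 h2 h3 hx
    rw [h3, Pi.add_apply, h1 hx, h2 hx]
  zero_mem' T hT := by
    refine ⟨0, ?_⟩
    filter_upwards [Lp.coeFn_zero ℝ 2 (volume.restrict Ω.carrier)] with x hx _
    rw [hx, Pi.zero_apply]
  smul_mem' r u hu T hT := by
    obtain ⟨a, ha⟩ := hu T hT
    refine ⟨r * a, ?_⟩
    filter_upwards [ha, Lp.coeFn_smul r u] with x h1 h2 hx
    rw [h2, Pi.smul_apply, h1 hx, smul_eq_mul]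

theorem ae_mem_interior (𝒯 : Mesh Ω) :
    ∀ᵐ x ∂volume.restrict Ω.carrier, ∃ T ∈ 𝒯.elems, x ∈ interior (hull T) := by
  have hfr : ∀ᵐ x ∂(volume : Measure (Euc d)), ∀ T ∈ 𝒯.elems, x ∉ frontier (hull T) := by
    rw [ae_ball_iff 𝒯.finite.countable]
    intro T _
    exact measure_eq_zero_iff_ae_notMem.1
      ((convex_convexHull ℝ (T : Set (Euc d))).addHaar_frontier volume)
  filter_upwards [ae_restrict_of_ae hfr, ae_restrict_mem Ω.isOpen.measurableSet] with x h1 h2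
  have h3 : x ∈ ⋃ T ∈ 𝒯.elems, hull T := 𝒯.cover ▸ subset_closure h2
  simp only [mem_iUnion, exists_prop] at h3
  obtain ⟨T, hT, hx⟩ := h3
  refine ⟨T, hT, ?_⟩
  by_contra hcon
  exact h1 T hT ⟨subset_closure hx, hcon⟩

instance finiteDimensional_P0 (𝒯 : Mesh Ω) : FiniteDimensional ℝ 𝒯.P0 := by
  have : Finite 𝒯.elems := 𝒯.finite
  have hvol : volume Ω.carrier ≠ ⊤ := Ω.isBounded.measure_lt_top.ne
  choose c hc using fun (u : 𝒯.P0) (T : 𝒯.elems) => u.2 T.1 T.2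
  let χ : 𝒯.elems → L2 Ω := fun T => indicatorConstLp 2
    (μ := volume.restrict Ω.carrier) (s := interior (hull T.1)) isOpen_interior.measurableSet
    (ne_top_of_le_ne_top hvol (by
      rw [Measure.restrict_apply isOpen_interior.measurableSet]
      exact measure_mono inter_subset_right)) (1 : ℝ)
  let f : 𝒯.P0 →ₗ[ℝ] (𝒯.elems → ℝ) :=
    LinearMap.pi fun T => (innerₛₗ ℝ (χ T)) ∘ₗ 𝒯.P0.subtype
  refine FiniteDimensional.of_injective f ((injective_iff_map_eq_zero f).2 fun u hu => ?_)
  refine Subtype.ext (Lp.ext ?_)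
  refine EventuallyEq.trans ?_ (Lp.coeFn_zero _ _ _).symm
  have hz : ∀ᵐ x ∂volume.restrict Ω.carrier, ∀ T : 𝒯.elems,
      x ∈ interior (hull T.1) → u.1 x = 0 := by
    rw [ae_all_iff]
    intro T
    have h0 : inner ℝ (χ T) u.1 = 0 := congrFun hu T
    rw [L2.inner_indicatorConstLp_one] at h0
    have h1 : ∫ x in interior (hull T.1), u.1 x ∂volume.restrict Ω.carrier =
        ∫ x in interior (hull T.1), c u T ∂volume.restrict Ω.carrier :=
      setIntegral_congr_ae isOpen_interior.measurableSet (hc u T)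
    rw [h1, setIntegral_const, smul_eq_mul, mul_eq_zero] at h0
    rcases h0 with h0 | h0
    · have h2 : (volume.restrict Ω.carrier) (interior (hull T.1)) = 0 := by
        rw [measureReal_def, ENNReal.toReal_eq_zero_iff] at h0
        refine h0.resolve_right (ne_top_of_le_ne_top hvol ?_)
        rw [Measure.restrict_apply isOpen_interior.measurableSet]
        exact measure_mono inter_subset_right
      filter_upwards [measure_eq_zero_iff_ae_notMem.1 h2] with x hx hx'
      exact absurd hx' hx
    · filter_upwards [hc u T] with x hx hx'
      rw [hx hx', h0]
  filter_upwards [hz, 𝒯.ae_mem_interior] with x h1 ⟨T, hT, hx⟩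
  exact h1 ⟨T, hT⟩ hx

/-- The `H^{-1}(Ω)`-orthogonal projection onto `P⁰(𝒯) ⊆ H^{-1}(Ω)`. -/
def projNegOne (𝒯 : Mesh Ω) : HNegOne Ω →L[ℝ] HNegOne Ω :=
  (𝒯.P0.map (dualEmbed (H10.toL2 Ω))).starProjection

/-- The `H̃^{-1}(Ω)`-orthogonal projection onto `P⁰(𝒯) ⊆ H̃^{-1}(Ω)`. -/
def projTildeNegOne (𝒯 : Mesh Ω) : HTildeNegOne Ω →L[ℝ] HTildeNegOne Ω :=
  Submodule.starProjection (𝕜 := ℝ) (E := HTildeNegOne Ω) (𝒯.P0.map (dualEmbed (h1ToL2 Ω)))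

end Mesh

/-! ### Mesh refinement -/

/-- A rule that refines (e.g. bisects) a simplex into at least two simplices. -/
structure RefinementRule (d : ℕ) where
  children : Finset (Euc d) → Set (Finset (Euc d))
  finite : ∀ T, IsSimplex T → (children T).Finite
  two_le_ncard : ∀ T, IsSimplex T → 2 ≤ (children T).ncard
  isSimplex : ∀ T, IsSimplex T → ∀ T' ∈ children T, IsSimplex T'
  hull_eq : ∀ T, IsSimplex T → hull T = ⋃ T' ∈ children T, hull T'
  disjoint : ∀ T, IsSimplex T →
    (children T).PairwiseDisjoint fun T' => interior (hull T')

namespace RefinementRule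

variable (R : RefinementRule d)

/-- `T` arises from `T₀` by finitely many (possibly no) refinements. -/
def Descendant (T₀ T : Finset (Euc d)) : Prop :=
  Relation.ReflTransGen (fun S S' => S' ∈ R.children S) T₀ T

/-- The simplices obtained from those in `S` by exactly `n` iterated refinements. -/
def iter (S : Set (Finset (Euc d))) : ℕ → Set (Finset (Euc d))
  | 0 => S
  | n + 1 => ⋃ T ∈ iter S n, R.children T

/-- The generation of `T` with respect to the initial mesh `𝒯₀`: the number of iterated
refinements that lead from an element of `𝒯₀` to `T`. -/
def gen (𝒯₀ : Mesh Ω) (T : Finset (Euc d)) : ℕ := sInf {n | T ∈ R.iter 𝒯₀.elems n}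

/-- A sequence of uniform meshes generated by `R`, with shape regularity constant `Creg`,
reduction parameters `qref`, `Cref` and generation increment bound `kref`. -/
structure IsUniformSequence (Creg qref Cref : ℝ) (kref : ℕ) (𝒯 : ℕ → Mesh Ω) : Prop where
  /-- `𝒯 (ℓ + 1)` is generated from `𝒯 ℓ` by refinement. -/
  refines : ∀ ℓ, ∀ T ∈ (𝒯 (ℓ + 1)).elems, ∃ TF ∈ (𝒯 ℓ).elems, R.Descendant TF T
  shapeRegular : ∀ ℓ, ∀ T ∈ (𝒯 ℓ).elems,
    Metric.diam (hull T) ^ d / volume.real (hull T) ≤ Creg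
  diam_gen : ∀ ℓ, ∀ T ∈ (𝒯 ℓ).elems, Cref⁻¹ * Metric.diam (hull T) ≤ qref ^ R.gen (𝒯 0) T ∧
    qref ^ R.gen (𝒯 0) T ≤ Cref * Metric.diam (hull T)
  gen_father : ∀ ℓ, ∀ T ∈ (𝒯 (ℓ + 1)).elems \ (𝒯 ℓ).elems, ∀ TF ∈ (𝒯 ℓ).elems,
    R.Descendant TF T → 1 ≤ |(R.gen (𝒯 0) T : ℤ) - R.gen (𝒯 0) TF| ∧
      |(R.gen (𝒯 0) T : ℤ) - R.gen (𝒯 0) TF| ≤ kref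
  all_refined : ∀ ℓ, (𝒯 (ℓ + 1)).elems \ (𝒯 ℓ).elems = (𝒯 (ℓ + 1)).elems
  gen_eq : ∀ ℓ, ∀ T ∈ (𝒯 ℓ).elems, ∀ T' ∈ (𝒯 ℓ).elems, R.gen (𝒯 0) T = R.gen (𝒯 0) T'

end RefinementRule

end NegSobolev

end

open NegSobolev

/-!
The two norm equivalences are instances of one abstract statement, `NegSobolev.exists_norm_equiv`,
for a bounded map `j : V → H` of Hilbert spaces (`H¹₀(Ω)` or `H¹(Ω)` into `L²(Ω)`), a nested
sequence of finite-dimensional subspaces `S ℓ` of `H`, and scales `q ^ g ℓ` with `g` strictly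
increasing by bounded steps. Two properties of the subspaces are used: every `f : H` is approximated
by `S ℓ` in the dual of `V` up to `q ^ g ℓ * ‖f‖`, and elements of `S ℓ` satisfy the inverse
estimate `q ^ g ℓ * ‖f‖ ≲ ‖f‖_{V'}`.

*Upper bound* (`sum_error_sq_le`). The Riesz representatives in `V` of the projection errors of a
functional have, by duality and the approximation property, an `H` norm smaller than their `V` norm
by the factor `q ^ g ℓ`. Each lives at its own scale, and elements at distinct geometric scales are
almost orthogonal in the real interpolation space (`norm_sq_sum_le`, Schur's test for the kernel
`scaleKernel`). Testing the functional with their weighted sum bounds the sum of the weighted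
squared errors.

*Lower bound* (`norm_sq_le_error`). By nestedness, the increments of consecutive projections are
bounded by the projection errors. By the inverse estimate, the increment at level `ℓ` acts on `v`
through the `K`-functional of `v` at the scale `q ^ g ℓ`, and these values are square summable with
weights because the interpolation norm is an integral of the `K`-functional over all scales. The
Cauchy–Schwarz inequality and the density of `V` in the interpolation space
(`denseRange_interpIncl`) conclude.

For piecewise constants, the approximation property follows by duality from the Poincaré inequality
on each element (`exists_const_lintegral_sub_sq_le`). It is proved for smooth functions on convex
sets by integration along segments, and carried over to `H¹(Ω)` by mollification inside the element
and Fatou's lemma. The inverse estimate (`exists_inverse_estimate`) comes from testing with a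
combination of bump functions, one in a ball inscribed in each element; shape regularity makes the
radius of the ball comparable to the diameter. The estimate in the norm of `H⁻¹(Ω)` implies the one
in the dual of `H¹(Ω)`. Finally, refined simplices have disjoint interiors, so that the generation
of an element is unambiguous, and in a uniform sequence it increases strictly with the level
(`RefinementRule.IsUniformSequence.exists_gen`); the mesh sizes are therefore comparable to distinct
powers of `qref`.
-/

/-! ### Real interpolation: the `K`-functional at geometric scales -/

namespace NegSobolev

section Interpolation

variable {X₀ X₁ : Type*} [NormedAddCommGroup X₀] [NormedSpace ℝ X₀]
  [NormedAddCommGroup X₁] [NormedSpace ℝ X₁] (j : X₁ →L[ℝ] X₀)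

theorem kFunctional_le_enorm (t : ℝ) (u : X₀) : kFunctional j t u ≤ ‖u‖ₑ :=
  (iInf_le _ 0).trans (by simp)

theorem kFunctional_ne_top (t : ℝ) (u : X₀) : kFunctional j t u ≠ ∞ :=
  ne_top_of_le_ne_top (by simp) (kFunctional_le_enorm j t u)

/-- The function `t ↦ K(t, u) / t` is nonincreasing. -/
theorem kFunctional_le_div_mul {t r : ℝ} (ht : 0 < t) (htr : t ≤ r) (u : X₀) :
    kFunctional j r u ≤ ENNReal.ofReal (r / t) * kFunctional j t u := by
  have hr : 0 < r := ht.trans_le htr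
  unfold kFunctional
  rw [ENNReal.mul_iInf_of_ne (by simp only [ne_eq, ENNReal.ofReal_eq_zero, not_le]; positivity)
    (by simp)]
  refine iInf_mono fun v => ?_
  rw [mul_add, ← mul_assoc, ← ENNReal.ofReal_mul (by positivity), div_mul_cancel₀ _ ht.ne']
  gcongr
  refine le_mul_of_one_le_left (by simp) ?_
  rw [← ENNReal.ofReal_one]
  exact ENNReal.ofReal_le_ofReal ((one_le_div ht).2 htr)

/-- Integration against the measure `dt / t` on the positive half-line. -/
theorem lintegral_dtOverT {f : ℝ → ℝ≥0∞} (hf : Measurable f) :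
    ∫⁻ t, f t ∂dtOverT = ∫⁻ t in Ioi 0, ENNReal.ofReal t⁻¹ * f t := by
  unfold dtOverT
  rw [lintegral_withDensity_eq_lintegral_mul _ (by fun_prop) hf]
  rfl

theorem measurable_sq_integrand (θ : ℝ) (u : X₀) :
    Measurable fun t : ℝ => (ENNReal.ofReal (t ^ (-θ)) * kFunctional j t u) ^ (2 : ℝ) :=
  (measurable_integrand j θ u).pow_const _

theorem interpENorm_sq (θ : ℝ) (u : X₀) : interpENorm j θ u ^ 2 =
    ∫⁻ t in Ioi 0, ENNReal.ofReal t⁻¹ *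
      (ENNReal.ofReal (t ^ (-θ)) * kFunctional j t u) ^ (2 : ℝ) := by
  rw [← lintegral_dtOverT (measurable_sq_integrand j θ u), interpENorm, ← ENNReal.rpow_natCast,
    ← ENNReal.rpow_mul]
  norm_num

/-- The part of the interpolation norm over `[τ, τ/q)` controls `τ^{-θ} K(τ, u)`. -/
theorem mul_kFunctional_sq_le_setLIntegral {θ q τ : ℝ} (hθ : 0 ≤ θ) (hq : q ∈ Ioo (0 : ℝ) 1)
    (hτ : 0 < τ) (u : X₀) :
    ENNReal.ofReal (q ^ (2 * θ) * (1 - q)) *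
        (ENNReal.ofReal (τ ^ (-θ)) * kFunctional j τ u) ^ (2 : ℝ) ≤
      ∫⁻ t in Ico τ (τ / q), ENNReal.ofReal t⁻¹ *
        (ENNReal.ofReal (t ^ (-θ)) * kFunctional j t u) ^ (2 : ℝ) := by
  obtain ⟨hq0, hq1⟩ := hq
  have hlen : τ / q - τ = (1 - q) * (τ / q) := by field_simp
  have hconst : ENNReal.ofReal (q ^ (2 * θ) * (1 - q)) *
        (ENNReal.ofReal (τ ^ (-θ)) * kFunctional j τ u) ^ (2 : ℝ) =
      ∫⁻ _ in Ico τ (τ / q), ENNReal.ofReal (τ / q)⁻¹ *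
        (ENNReal.ofReal ((τ / q) ^ (-θ)) * kFunctional j τ u) ^ (2 : ℝ) := by
    rw [setLIntegral_const, Real.volume_Ico, hlen, Real.div_rpow hτ.le hq0.le,
      ENNReal.mul_rpow_of_nonneg _ _ (by norm_num), ENNReal.mul_rpow_of_nonneg _ _ (by norm_num),
      ENNReal.ofReal_rpow_of_nonneg (by positivity) (by norm_num),
      ENNReal.ofReal_rpow_of_nonneg (by positivity) (by norm_num)]
    have e : (τ ^ (-θ) / q ^ (-θ)) ^ (2 : ℝ) = (τ ^ (-θ)) ^ (2 : ℝ) * q ^ (2 * θ) := by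
      rw [Real.div_rpow (by positivity) (by positivity), div_eq_mul_inv,
        ← Real.rpow_mul hq0.le, ← Real.rpow_neg hq0.le]
      ring_nf
    rw [e]
    have h1 : (0 : ℝ) ≤ 1 - q := by linarith
    have h2 : ENNReal.ofReal (q ^ (2 * θ) * (1 - q)) * ENNReal.ofReal ((τ ^ (-θ)) ^ (2 : ℝ)) =
        ENNReal.ofReal (τ / q)⁻¹ * ENNReal.ofReal ((τ ^ (-θ)) ^ (2 : ℝ) * q ^ (2 * θ)) *
          ENNReal.ofReal ((1 - q) * (τ / q)) := by
      rw [← ENNReal.ofReal_mul (by positivity), ← ENNReal.ofReal_mul (by positivity),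
        ← ENNReal.ofReal_mul (by positivity)]
      congr 1
      field_simp
    rw [← mul_assoc, h2]
    ring
  rw [hconst]
  refine setLIntegral_mono' measurableSet_Ico fun t ht => ?_
  have ht0 : 0 < t := hτ.trans_le ht.1
  gcongr ENNReal.ofReal ?_ * (ENNReal.ofReal ?_ * ?_) ^ (2 : ℝ)
  · exact inv_anti₀ ht0 ht.2.le
  · exact Real.rpow_le_rpow_of_nonpos ht0 ht.2.le (by linarith)
  · exact kFunctional_mono j u ht.1

/-- Sampling the K-functional along distinct powers of `q` is controlled by the norm. -/
theorem tsum_kFunctional_sq_le {θ q : ℝ} (hθ : 0 ≤ θ) (hq : q ∈ Ioo (0 : ℝ) 1)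
    {g : ℕ → ℕ} (hg : StrictMono g) (u : X₀) :
    ∑' ℓ, ENNReal.ofReal (q ^ (2 * θ) * (1 - q)) *
        (ENNReal.ofReal ((q ^ g ℓ) ^ (-θ)) * kFunctional j (q ^ g ℓ) u) ^ (2 : ℝ) ≤
      interpENorm j θ u ^ 2 := by
  obtain ⟨hq0, hq1⟩ := hq
  rw [interpENorm_sq]
  calc _ ≤ ∑' ℓ, ∫⁻ t in Ico (q ^ g ℓ) (q ^ g ℓ / q), ENNReal.ofReal t⁻¹ *
        (ENNReal.ofReal (t ^ (-θ)) * kFunctional j t u) ^ (2 : ℝ) :=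
        ENNReal.tsum_le_tsum fun ℓ =>
          mul_kFunctional_sq_le_setLIntegral j hθ ⟨hq0, hq1⟩ (by positivity) u
    _ = ∫⁻ t in ⋃ ℓ, Ico (q ^ g ℓ) (q ^ g ℓ / q), ENNReal.ofReal t⁻¹ *
        (ENNReal.ofReal (t ^ (-θ)) * kFunctional j t u) ^ (2 : ℝ) := by
        rw [lintegral_iUnion (fun _ => measurableSet_Ico)]
        have key : ∀ m n, m < n → Disjoint (Ico (q ^ g m) (q ^ g m / q))
            (Ico (q ^ g n) (q ^ g n / q)) := by
          intro m n hmn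
          refine Set.disjoint_left.2 fun t h1 h2 => ?_
          have h3 : q ^ g n / q ≤ q ^ g m := by
            rw [div_le_iff₀ hq0, ← pow_succ]
            exact pow_le_pow_of_le_one hq0.le hq1.le (hg hmn)
          exact absurd (h2.2.trans_le h3) (not_lt.2 h1.1)
        intro m n hmn
        rcases lt_or_gt_of_ne hmn with h | h
        · exact key m n h
        · exact (key n m h).symm
    _ ≤ _ := by
        refine lintegral_mono_set (iUnion_subset fun ℓ t ht => ?_)
        exact (show (0 : ℝ) < q ^ g ℓ by positivity).trans_le ht.1

theorem interp_enorm_sq (θ : ℝ) (u : Interp j θ) :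
    interpENorm j θ u.1 ^ 2 = ENNReal.ofReal (‖u‖ ^ 2) := by
  have hu : interpENorm j θ u.1 < ∞ := u.2
  rw [interp_norm_def, ENNReal.ofReal_pow (by simp), ENNReal.ofReal_toReal hu.ne]

/-- `tsum_kFunctional_sq_le` for finite sums of real numbers. -/
theorem sum_kFunctional_sq_le {θ q : ℝ} (hθ : 0 ≤ θ) (hq : q ∈ Ioo (0 : ℝ) 1)
    {g : ℕ → ℕ} (hg : StrictMono g) (u : Interp j θ) (F : Finset ℕ) :
    q ^ (2 * θ) * (1 - q) *
      ∑ ℓ ∈ F, ((q ^ g ℓ) ^ (-θ) * (kFunctional j (q ^ g ℓ) u.1).toReal) ^ 2 ≤ ‖u‖ ^ 2 := by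
  obtain ⟨hq0, hq1⟩ := hq
  have h1 : (0 : ℝ) ≤ 1 - q := by linarith
  have h := (ENNReal.sum_le_tsum F).trans (tsum_kFunctional_sq_le j hθ ⟨hq0, hq1⟩ hg u.1)
  rw [interp_enorm_sq] at h
  rw [← ENNReal.ofReal_le_ofReal_iff (by positivity)]
  refine le_trans (le_of_eq ?_) h
  rw [Finset.mul_sum, ENNReal.ofReal_sum_of_nonneg (fun _ _ => by positivity)]
  refine Finset.sum_congr rfl fun ℓ _ => ?_
  rw [ENNReal.ofReal_mul (by positivity), ENNReal.ofReal_pow (by positivity)]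
  congr 1
  rw [← ENNReal.rpow_natCast]
  congr 1
  rw [ENNReal.ofReal_mul (by positivity)]
  congr 1
  exact ENNReal.ofReal_toReal (kFunctional_ne_top _ _ _)

/-- A decomposition of `u` that attains the `K`-functional up to a factor two. A zero value is
excluded because the infimum need not be attained. -/
theorem exists_kFunctional_le (t : ℝ) (u : X₀) (hu : kFunctional j t u ≠ 0) :
    ∃ v : X₁, ‖u - j v‖ₑ + ENNReal.ofReal t * ‖v‖ₑ ≤ 2 * kFunctional j t u := by
  have h : kFunctional j t u < 2 * kFunctional j t u := by
    rw [two_mul]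
    exact ENNReal.lt_add_right (kFunctional_ne_top _ _ _) hu
  obtain ⟨v, hv⟩ := iInf_lt_iff.1 h
  exact ⟨v, hv.le⟩

/-- The remainder of a decomposition that is nearly optimal at the scale `t` has, at every scale
`r`, a `K`-functional dominated by that of `u`. This provides the dominating function for the
density of `X₁` in the interpolation space. -/
theorem kFunctional_sub_le_three_mul {t : ℝ} (ht : 0 < t) (u : X₀) {v : X₁}
    (hv : ‖u - j v‖ₑ + ENNReal.ofReal t * ‖v‖ₑ ≤ 2 * kFunctional j t u) {r : ℝ} (hr : 0 < r) :
    kFunctional j r (u - j v) ≤ 3 * kFunctional j r u := by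
  -- above the scale `t` the term `‖u - j v‖` is small enough, below it the term `r ‖v‖` is
  rcases le_total t r with h | h
  · calc kFunctional j r (u - j v) ≤ ‖u - j v‖ₑ := kFunctional_le_enorm _ _ _
      _ ≤ 2 * kFunctional j t u := le_self_add.trans hv
      _ ≤ 3 * kFunctional j r u := by
        gcongr
        · norm_num
        · exact kFunctional_mono j u h
  · have h1 : kFunctional j r (-(j v)) ≤ ENNReal.ofReal r * ‖v‖ₑ := by
      refine (iInf_le _ (-v)).trans ?_
      simp
    have h2 : ENNReal.ofReal r * ‖v‖ₑ ≤ 2 * kFunctional j r u := by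
      have h3 : ENNReal.ofReal t * ‖v‖ₑ ≤ 2 * kFunctional j t u := le_add_self.trans hv
      have h4 := kFunctional_le_div_mul j hr h u
      calc ENNReal.ofReal r * ‖v‖ₑ = ENNReal.ofReal (r / t) * (ENNReal.ofReal t * ‖v‖ₑ) := by
            rw [← mul_assoc, ← ENNReal.ofReal_mul (by positivity), div_mul_cancel₀ _ ht.ne']
        _ ≤ ENNReal.ofReal (r / t) * (2 * (ENNReal.ofReal (t / r) * kFunctional j r u)) := by
            exact mul_le_mul_right (h3.trans (mul_le_mul_right h4 _)) _
        _ = ENNReal.ofReal (r / t) * ENNReal.ofReal (t / r) * (2 * kFunctional j r u) := by ring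
        _ = _ := by
            rw [← ENNReal.ofReal_mul (by positivity)]
            rw [show r / t * (t / r) = 1 by field_simp]; simp
    rw [sub_eq_add_neg]
    calc _ ≤ kFunctional j r u + kFunctional j r (-(j v)) := kFunctional_add_le _ _ _ _
      _ ≤ kFunctional j r u + 2 * kFunctional j r u := by gcongr; exact h1.trans h2
      _ = _ := by ring

theorem tendsto_kFunctional_zero {θ : ℝ} (hθ : 0 < θ) (u : Interp j θ) :
    Tendsto (fun n : ℕ => kFunctional j ((1 / 2 : ℝ) ^ n) u.1) atTop (𝓝 0) := by
  have hq : (1 / 2 : ℝ) ∈ Ioo (0 : ℝ) 1 := by norm_num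
  have hlim : Tendsto (fun n : ℕ => ENNReal.ofReal
      (((1 / 2 : ℝ) ^ θ) ^ n * √(‖u‖ ^ 2 / ((1 / 2 : ℝ) ^ (2 * θ) * (1 - 1 / 2))))) atTop (𝓝 0) := by
    rw [← ENNReal.ofReal_zero]
    refine ENNReal.tendsto_ofReal ?_
    rw [← zero_mul (√(‖u‖ ^ 2 / ((1 / 2 : ℝ) ^ (2 * θ) * (1 - 1 / 2))))]
    exact (tendsto_pow_atTop_nhds_zero_of_lt_one (by positivity)
      (Real.rpow_lt_one (by norm_num) (by norm_num) hθ)).mul_const _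
  refine tendsto_of_tendsto_of_tendsto_of_le_of_le tendsto_const_nhds hlim (fun _ => zero_le)
    fun n => ?_
  have h := sum_kFunctional_sq_le j hθ.le hq strictMono_id u {n}
  rw [Finset.sum_singleton, id, ← le_div_iff₀' (by positivity)] at h
  have h2 := Real.le_sqrt_of_sq_le h
  rw [← ENNReal.ofReal_toReal (kFunctional_ne_top j ((1 / 2 : ℝ) ^ n) u.1)]
  refine ENNReal.ofReal_le_ofReal ?_
  refine le_trans (le_of_eq ?_) (mul_le_mul_of_nonneg_left h2 (by positivity))
  rw [← mul_assoc, ← Real.rpow_natCast, ← Real.rpow_natCast, ← Real.rpow_mul (by norm_num),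
    ← Real.rpow_mul (by norm_num), ← Real.rpow_add (by norm_num)]
  ring_nf
  simp

/-- The space `X₁` is dense in `[X₀, X₁]_{θ,2}`: nearly optimal elements `v n` for the
`K`-functional of `u` at the scales `2⁻ⁿ` converge to `u`, by dominated convergence in the integral
that defines the interpolation norm. -/
theorem denseRange_interpIncl {θ : ℝ} (hθ : θ ∈ Ioo (0 : ℝ) 1) :
    DenseRange (interpIncl j hθ) := by
  intro u
  by_cases h0 : ∃ n : ℕ, kFunctional j ((1 / 2 : ℝ) ^ n) u.1 = 0
  -- a vanishing `K`-functional forces `u = 0`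
  · obtain ⟨n, hn⟩ := h0
    have h1 := enorm_le_kFunctional j (by positivity : (0 : ℝ) < (1 / 2) ^ n) u.1
    rw [hn, mul_zero, nonpos_iff_eq_zero, enorm_eq_zero] at h1
    have : u = interpIncl j hθ 0 := by rw [map_zero]; exact Subtype.ext h1
    rw [this]
    exact subset_closure ⟨0, rfl⟩
  push Not at h0
  choose v hv using fun n : ℕ => exists_kFunctional_le j
    ((1 / 2) ^ n) u.1 (h0 n)
  refine mem_closure_of_tendsto (f := fun n => interpIncl j hθ (v n)) (b := atTop) ?_
    (Eventually.of_forall fun n => ⟨v n, rfl⟩)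
  rw [tendsto_iff_norm_sub_tendsto_zero]
  have hlim : Tendsto (fun n => ∫⁻ t in Ioi 0, ENNReal.ofReal t⁻¹ *
      (ENNReal.ofReal (t ^ (-θ)) * kFunctional j t (u.1 - j (v n))) ^ (2 : ℝ)) atTop
      (𝓝 (∫⁻ t in Ioi (0 : ℝ), 0)) := by
    refine tendsto_lintegral_of_dominated_convergence (fun t => 9 * (ENNReal.ofReal t⁻¹ *
      (ENNReal.ofReal (t ^ (-θ)) * kFunctional j t u.1) ^ (2 : ℝ))) (fun n => ?_) (fun n => ?_)
      ?_ ?_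
    · exact (by fun_prop : Measurable fun t : ℝ => ENNReal.ofReal t⁻¹).mul
        (measurable_sq_integrand j θ _)
    -- the factor `9` is the square of the `3` of `kFunctional_sub_le_three_mul`
    · filter_upwards [ae_restrict_mem measurableSet_Ioi] with t ht
      have h := kFunctional_sub_le_three_mul j (by positivity) u.1 (hv n) ht
      calc _ ≤ ENNReal.ofReal t⁻¹ *
          (ENNReal.ofReal (t ^ (-θ)) * (3 * kFunctional j t u.1)) ^ (2 : ℝ) := by gcongr
        _ = ENNReal.ofReal t⁻¹ *
          (3 * (ENNReal.ofReal (t ^ (-θ)) * kFunctional j t u.1)) ^ (2 : ℝ) := by ring_nf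
        _ = _ := by
          rw [ENNReal.mul_rpow_of_nonneg 3 _ (by norm_num)]
          have : (3 : ℝ≥0∞) ^ (2 : ℝ) = 9 := by
            rw [ENNReal.rpow_ofNat]; norm_num
          rw [this]; ring
    · rw [lintegral_const_mul' _ _ (by simp), ← interpENorm_sq, interp_enorm_sq]
      finiteness
    · refine Eventually.of_forall fun t => ?_
      have h1 : Tendsto (fun n => kFunctional j t (u.1 - j (v n))) atTop (𝓝 0) := by
        have h2 := ENNReal.Tendsto.const_mul (a := 2) (tendsto_kFunctional_zero j hθ.1 u)
          (Or.inr (by simp))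
        rw [mul_zero] at h2
        exact tendsto_of_tendsto_of_tendsto_of_le_of_le tendsto_const_nhds h2 (fun _ => zero_le)
          fun n => (kFunctional_le_enorm _ _ _).trans (le_self_add.trans (hv n))
      have h3 := ENNReal.Tendsto.const_mul (a := ENNReal.ofReal (t ^ (-θ))) h1
          (Or.inr (by simp))
      rw [mul_zero] at h3
      have h4 := ENNReal.Tendsto.const_mul (a := ENNReal.ofReal t⁻¹)
        (((ENNReal.continuous_rpow_const (y := 2)).tendsto _).comp h3) (Or.inr (by simp))
      simpa using h4
  rw [lintegral_zero] at hlim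
  have h2 : Tendsto (fun n => ‖interpIncl j hθ (v n) - u‖ ^ 2) atTop (𝓝 0) := by
    have h3 := (ENNReal.tendsto_toReal (by simp)).comp hlim
    refine h3.congr fun n => ?_
    rw [Function.comp, ← interpENorm_sq, norm_sub_rev,
      show u.1 - j (v n) = (u - interpIncl j hθ (v n)).1 from rfl, interp_enorm_sq,
      ENNReal.toReal_ofReal (by positivity)]
  have h4 := (Real.continuous_sqrt.tendsto _).comp h2
  rw [Real.sqrt_zero] at h4
  exact h4.congr fun n => Real.sqrt_sq (norm_nonneg _)

end Interpolation
end NegSobolev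

/-! ### Sums over scales -/

namespace NegSobolev

/-- A finite geometric sum with terms at most one is bounded independently of its length and of its
first index. -/
theorem sum_mul_pow_le {ρ A : ℝ} (hρ : ρ ∈ Ioo (0 : ℝ) 1) (hA : 0 ≤ A) (F : Finset ℕ)
    (h : ∀ n ∈ F, A * ρ ^ n ≤ 1) : ∑ n ∈ F, A * ρ ^ n ≤ (1 - ρ)⁻¹ := by
  obtain ⟨h0, h1⟩ := hρ
  have h2 : 0 < 1 - ρ := by linarith
  rcases F.eq_empty_or_nonempty with rfl | hF
  · simpa using h2.le
  calc ∑ n ∈ F, A * ρ ^ n ≤ ∑ n ∈ Finset.Ico (F.min' hF) (F.max' hF + 1), A * ρ ^ n := by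
        refine Finset.sum_le_sum_of_subset_of_nonneg (fun n hn => ?_)
          fun _ _ _ => by positivity
        exact Finset.mem_Ico.2 ⟨F.min'_le n hn, Nat.lt_succ_of_le (F.le_max' n hn)⟩
    _ ≤ A * (ρ ^ F.min' hF / (1 - ρ)) := by
        rw [← Finset.mul_sum]
        gcongr
        exact geom_sum_Ico_le_of_lt_one h0.le h1
    _ = A * ρ ^ F.min' hF * (1 - ρ)⁻¹ := by ring
    _ ≤ 1 * (1 - ρ)⁻¹ := by gcongr; exact h _ (F.min'_mem hF)
    _ = _ := one_mul _

/-- The counterpart of `sum_mul_pow_le` for increasing geometric sums. -/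
theorem sum_mul_inv_pow_le {ρ A : ℝ} (hρ : ρ ∈ Ioo (0 : ℝ) 1) (hA : 0 ≤ A) (F : Finset ℕ)
    (h : ∀ n ∈ F, A * (ρ ^ n)⁻¹ ≤ 1) : ∑ n ∈ F, A * (ρ ^ n)⁻¹ ≤ (1 - ρ)⁻¹ := by
  obtain ⟨h0, h1⟩ := hρ
  have h2 : 0 < 1 - ρ := by linarith
  rcases F.eq_empty_or_nonempty with rfl | hF
  · simpa using h2.le
  have key : ∀ M : ℕ, ∑ n ∈ Finset.range (M + 1), (ρ ^ n)⁻¹ ≤ (ρ ^ M)⁻¹ * (1 - ρ)⁻¹ := by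
    intro M
    induction M with
    | zero => simpa using (one_le_inv₀ h2).2 (by linarith)
    | succ M ih =>
      rw [Finset.sum_range_succ]
      refine (add_le_add_left ih _).trans (le_of_eq ?_)
      rw [pow_succ]
      field_simp
      ring
  calc ∑ n ∈ F, A * (ρ ^ n)⁻¹ ≤ ∑ n ∈ Finset.range (F.max' hF + 1), A * (ρ ^ n)⁻¹ := by
        refine Finset.sum_le_sum_of_subset_of_nonneg (fun n hn => ?_)
          fun _ _ _ => by positivity
        exact Finset.mem_range.2 (Nat.lt_succ_of_le (F.le_max' n hn))
    _ ≤ A * ((ρ ^ F.max' hF)⁻¹ * (1 - ρ)⁻¹) := by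
        rw [← Finset.mul_sum]
        gcongr
        exact key _
    _ = A * (ρ ^ F.max' hF)⁻¹ * (1 - ρ)⁻¹ := by ring
    _ ≤ 1 * (1 - ρ)⁻¹ := by gcongr; exact h _ (F.max'_mem hF)
    _ = _ := one_mul _

/-- The kernel `min(r^{-θ}, r^{1-θ})` that governs the interaction of the scales `τ` and `t` in
the real interpolation norm, at `r = t / τ`. -/
noncomputable def scaleKernel (θ r : ℝ) : ℝ := min (r ^ (-θ)) (r ^ (1 - θ))

theorem scaleKernel_nonneg (θ : ℝ) {r : ℝ} (hr : 0 ≤ r) : 0 ≤ scaleKernel θ r :=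
  le_min (by positivity) (by positivity)

@[fun_prop]
theorem measurable_scaleKernel (θ : ℝ) : Measurable (scaleKernel θ) := by
  unfold scaleKernel
  fun_prop

/-- The kernel is summable over all scales `q ^ n`, uniformly in `t`. -/
theorem sum_scaleKernel_le {θ q : ℝ} (hθ : θ ∈ Ioo (0 : ℝ) 1) (hq : q ∈ Ioo (0 : ℝ) 1) {t : ℝ}
    (ht : 0 < t) (F : Finset ℕ) :
    ∑ n ∈ F, scaleKernel θ (t / q ^ n) ≤ (1 - q ^ (1 - θ))⁻¹ + (1 - q ^ θ)⁻¹ := by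
  obtain ⟨hq0, hq1⟩ := hq
  obtain ⟨hθ0, hθ1⟩ := hθ
  rw [← Finset.sum_filter_add_sum_filter_not F (fun n => t ≤ q ^ n)]
  have e1 : ∀ n : ℕ, (t / q ^ n) ^ (1 - θ) = t ^ (1 - θ) * ((q ^ (1 - θ)) ^ n)⁻¹ := by
    intro n
    rw [Real.div_rpow ht.le (by positivity), div_eq_mul_inv, ← Real.rpow_natCast,
      ← Real.rpow_mul hq0.le, ← Real.rpow_natCast, ← Real.rpow_mul hq0.le, mul_comm (n : ℝ)]
  have e2 : ∀ n : ℕ, (t / q ^ n) ^ (-θ) = t ^ (-θ) * (q ^ θ) ^ n := by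
    intro n
    rw [Real.div_rpow ht.le (by positivity), div_eq_mul_inv, ← Real.rpow_neg (by positivity),
      neg_neg, ← Real.rpow_natCast,
      ← Real.rpow_mul hq0.le, ← Real.rpow_natCast, ← Real.rpow_mul hq0.le, mul_comm (n : ℝ)]
  -- the scales above `t` and those below it form one geometric sum each
  gcongr ?_ + ?_
  · refine (Finset.sum_le_sum fun n _ => (min_le_right _ _).trans (e1 n).le).trans ?_
    refine sum_mul_inv_pow_le ⟨by positivity, Real.rpow_lt_one hq0.le hq1 (by linarith)⟩
      (by positivity) _ fun n hn => ?_
    rw [← e1]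
    refine Real.rpow_le_one (by positivity) ?_ (by linarith)
    exact (div_le_one (by positivity)).2 (Finset.mem_filter.1 hn).2
  · refine (Finset.sum_le_sum fun n _ => (min_le_left _ _).trans (e2 n).le).trans ?_
    refine sum_mul_pow_le ⟨by positivity, Real.rpow_lt_one hq0.le hq1 (by linarith)⟩
      (by positivity) _ fun n hn => ?_
    rw [← e2]
    refine Real.rpow_le_one_of_one_le_of_nonpos ?_ (by linarith)
    exact (one_le_div (by positivity)).2 (not_le.1 (Finset.mem_filter.1 hn).2).le

/-- The kernel is integrable against `dt / t`, uniformly in the scale `τ`. -/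
theorem lintegral_scaleKernel_le {θ τ : ℝ} (hθ : θ ∈ Ioo (0 : ℝ) 1) (hτ : 0 < τ) :
    ∫⁻ t in Ioi (0 : ℝ), ENNReal.ofReal (t⁻¹ * scaleKernel θ (t / τ)) ≤
      ENNReal.ofReal ((1 - θ)⁻¹ + θ⁻¹) := by
  obtain ⟨hθ0, hθ1⟩ := hθ
  have h1θ : 0 < 1 - θ := by linarith
  rw [← Ioc_union_Ioi_eq_Ioi hτ.le, ENNReal.ofReal_add (by positivity) (by positivity)]
  refine (lintegral_union_le _ _ _).trans (add_le_add ?_ ?_)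
  · have hint : IntegrableOn (fun t : ℝ => τ ^ (θ - 1) * t ^ (-θ)) (Ioc 0 τ) := by
      rw [← intervalIntegrable_iff_integrableOn_Ioc_of_le hτ.le]
      exact (intervalIntegral.intervalIntegrable_rpow' (by linarith)).const_mul _
    have hval : ∫ t in Ioc 0 τ, τ ^ (θ - 1) * t ^ (-θ) = (1 - θ)⁻¹ := by
      rw [integral_const_mul, ← intervalIntegral.integral_of_le hτ.le,
        integral_rpow (Or.inl (by linarith)), Real.zero_rpow (by linarith), sub_zero,
        ← mul_div_assoc, ← Real.rpow_add hτ]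
      rw [show θ - 1 + (-θ + 1) = 0 by ring, Real.rpow_zero, one_div, neg_add_eq_sub]
    rw [← hval, ofReal_integral_eq_lintegral_ofReal hint]
    · refine setLIntegral_mono' measurableSet_Ioc fun t ht => ENNReal.ofReal_le_ofReal ?_
      have ht0 : 0 < t := ht.1
      calc t⁻¹ * scaleKernel θ (t / τ) ≤ t⁻¹ * (t / τ) ^ (1 - θ) := by
            gcongr; exact min_le_right _ _
        _ = τ ^ (θ - 1) * t ^ (-θ) := by
            rw [Real.div_rpow ht0.le hτ.le, div_eq_mul_inv, ← Real.rpow_neg hτ.le,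
              ← Real.rpow_neg_one, ← mul_assoc, ← Real.rpow_add ht0]
            ring_nf
    · filter_upwards [ae_restrict_mem measurableSet_Ioc] with t ht
      have := ht.1
      simp only [Pi.zero_apply]
      positivity
  · have hint : IntegrableOn (fun t : ℝ => τ ^ θ * t ^ (-θ - 1)) (Ioi τ) :=
      (integrableOn_Ioi_rpow_of_lt (by linarith) hτ).const_mul _
    have hval : ∫ t in Ioi τ, τ ^ θ * t ^ (-θ - 1) = θ⁻¹ := by
      rw [integral_const_mul, integral_Ioi_rpow_of_lt (by linarith) hτ, sub_add_cancel,
        neg_div_neg_eq, ← mul_div_assoc, ← Real.rpow_add hτ, add_neg_cancel, Real.rpow_zero,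
        one_div]
    rw [← hval, ofReal_integral_eq_lintegral_ofReal hint]
    · refine setLIntegral_mono' measurableSet_Ioi fun t ht => ENNReal.ofReal_le_ofReal ?_
      have ht0 : 0 < t := hτ.trans ht
      calc t⁻¹ * scaleKernel θ (t / τ) ≤ t⁻¹ * (t / τ) ^ (-θ) := by
            gcongr; exact min_le_left _ _
        _ = τ ^ θ * t ^ (-θ - 1) := by
            rw [Real.div_rpow ht0.le hτ.le, div_eq_mul_inv, ← Real.rpow_neg hτ.le, neg_neg,
              ← Real.rpow_neg_one, ← mul_assoc, ← Real.rpow_add ht0]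
            ring_nf
    · filter_upwards [ae_restrict_mem measurableSet_Ioi] with t ht
      have := hτ.trans ht
      simp only [Pi.zero_apply]
      positivity

/-- The product of the two Schur constants of `scaleKernel`: its sum over the scales `q ^ n` and its
integral against `dt / t`. It is the constant of almost orthogonality in `norm_sq_sum_le`. -/
noncomputable def scaleConst (θ q : ℝ) : ℝ :=
  ((1 - q ^ (1 - θ))⁻¹ + (1 - q ^ θ)⁻¹) * ((1 - θ)⁻¹ + θ⁻¹)

theorem scaleConst_nonneg {θ q : ℝ} (hθ : θ ∈ Ioo (0 : ℝ) 1) (hq : q ∈ Ioo (0 : ℝ) 1) :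
    0 ≤ scaleConst θ q := by
  have h1 := Real.rpow_le_one hq.1.le hq.2.le hθ.1.le
  have h2 := Real.rpow_le_one hq.1.le hq.2.le (by linarith [hθ.2] : (0 : ℝ) ≤ 1 - θ)
  exact mul_nonneg (add_nonneg (inv_nonneg.2 (by linarith)) (inv_nonneg.2 (by linarith)))
    (add_nonneg (inv_nonneg.2 (by linarith [hθ.2])) (inv_nonneg.2 hθ.1.le))

section Interpolation

variable {X₀ X₁ : Type*} [NormedAddCommGroup X₀] [NormedSpace ℝ X₀]
  [NormedAddCommGroup X₁] [NormedSpace ℝ X₁] (j : X₁ →L[ℝ] X₀)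

theorem kFunctional_sum_le {ι : Type*} (t : ℝ) (u : ι → X₀) (F : Finset ι) :
    kFunctional j t (∑ i ∈ F, u i) ≤ ∑ i ∈ F, kFunctional j t (u i) := by
  classical
  induction F using Finset.induction_on with
  | empty => simpa using kFunctional_le_enorm j t (0 : X₀)
  | insert i F hi ih =>
    rw [Finset.sum_insert hi, Finset.sum_insert hi]
    exact (kFunctional_add_le j t _ _).trans (by gcongr)

/-- An element of `X₁` that lives at the scale `τ`, that is, whose norms in `X₀` and `X₁` are in the
ratio `τ`, contributes to the interpolation norm at `t` through `scaleKernel θ (t / τ)`. -/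
theorem rpow_mul_kFunctional_map_le {θ τ b t : ℝ} (hτ : 0 < τ) (hb : 0 ≤ b) (ht : 0 < t) {v : X₁}
    (h0 : ‖j v‖ ≤ b * τ ^ θ) (h1 : ‖v‖ ≤ b * τ ^ (θ - 1)) :
    ENNReal.ofReal (t ^ (-θ)) * kFunctional j t (j v) ≤
      ENNReal.ofReal (b * scaleKernel θ (t / τ)) := by
  have k0 : kFunctional j t (j v) ≤ ENNReal.ofReal (b * τ ^ θ) := by
    refine (kFunctional_le_enorm _ _ _).trans ?_
    rw [← ofReal_norm]
    exact ENNReal.ofReal_le_ofReal h0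
  have k1 : kFunctional j t (j v) ≤ ENNReal.ofReal (t * (b * τ ^ (θ - 1))) := by
    refine (iInf_le _ v).trans ?_
    rw [sub_self, enorm_zero, zero_add, ENNReal.ofReal_mul ht.le, ← ofReal_norm]
    gcongr
  have e0 : b * (t / τ) ^ (-θ) = t ^ (-θ) * (b * τ ^ θ) := by
    rw [Real.div_rpow ht.le hτ.le, div_eq_mul_inv, ← Real.rpow_neg hτ.le, neg_neg]
    ring
  have e1 : b * (t / τ) ^ (1 - θ) = t ^ (-θ) * (t * (b * τ ^ (θ - 1))) := by
    rw [Real.div_rpow ht.le hτ.le, div_eq_mul_inv, ← Real.rpow_neg hτ.le, neg_sub,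
      show t ^ (1 - θ) = t ^ (-θ) * t by
        rw [← Real.rpow_add_one ht.ne']; ring_nf]
    ring
  rw [scaleKernel, mul_min_of_nonneg _ _ hb, ENNReal.ofReal_min, e0, e1,
    ENNReal.ofReal_mul (p := t ^ (-θ)) (by positivity),
    ENNReal.ofReal_mul (p := t ^ (-θ)) (by positivity)]
  exact le_min (by gcongr) (by gcongr)

/-- Elements `v ℓ` that live at the distinct scales `q ^ g ℓ` are almost orthogonal in the
interpolation space. This is Schur's test for `scaleKernel`: the Cauchy–Schwarz inequality in `ℓ`
for each `t`, then integration in `t`. -/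
theorem norm_sq_sum_le {θ q : ℝ} (hθ : θ ∈ Ioo (0 : ℝ) 1) (hq : q ∈ Ioo (0 : ℝ) 1)
    {g : ℕ → ℕ} (hg : StrictMono g) (v : ℕ → X₁) (b : ℕ → ℝ) (hb : ∀ ℓ, 0 ≤ b ℓ)
    (h0 : ∀ ℓ, ‖j (v ℓ)‖ ≤ b ℓ * (q ^ g ℓ) ^ θ)
    (h1 : ∀ ℓ, ‖v ℓ‖ ≤ b ℓ * (q ^ g ℓ) ^ (θ - 1)) (F : Finset ℕ) :
    ‖interpIncl j hθ (∑ ℓ ∈ F, v ℓ)‖ ^ 2 ≤ scaleConst θ q * ∑ ℓ ∈ F, b ℓ ^ 2 := by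
  have hq0 : 0 < q := hq.1
  set A : ℝ := (1 - q ^ (1 - θ))⁻¹ + (1 - q ^ θ)⁻¹ with hA
  have hA0 : 0 ≤ A := by
    have h1 := Real.rpow_le_one hq0.le hq.2.le hθ.1.le
    have h2 := Real.rpow_le_one hq0.le hq.2.le (by linarith [hθ.2] : (0 : ℝ) ≤ 1 - θ)
    exact add_nonneg (inv_nonneg.2 (by linarith)) (inv_nonneg.2 (by linarith))
  have hB0 : 0 ≤ (1 - θ)⁻¹ + θ⁻¹ :=
    add_nonneg (inv_nonneg.2 (by linarith [hθ.2])) (inv_nonneg.2 hθ.1.le)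
  have hpt : ∀ t ∈ Ioi (0 : ℝ), ENNReal.ofReal t⁻¹ * (ENNReal.ofReal (t ^ (-θ)) *
      kFunctional j t (j (∑ ℓ ∈ F, v ℓ))) ^ (2 : ℝ) ≤
      ∑ ℓ ∈ F, ENNReal.ofReal (A * b ℓ ^ 2) *
        ENNReal.ofReal (t⁻¹ * scaleKernel θ (t / q ^ g ℓ)) := by
    intro t ht
    have ht0 : 0 < t := ht
    set κ : ℕ → ℝ := fun ℓ => scaleKernel θ (t / q ^ g ℓ) with hκ
    have hκ0 : ∀ ℓ, 0 ≤ κ ℓ := fun ℓ => scaleKernel_nonneg θ (by positivity)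
    have hsum : ∑ ℓ ∈ F, κ ℓ ≤ A := by
      have := sum_scaleKernel_le hθ hq ht0 (F.map ⟨g, hg.injective⟩)
      rwa [Finset.sum_map] at this
    have hK : ENNReal.ofReal (t ^ (-θ)) * kFunctional j t (j (∑ ℓ ∈ F, v ℓ)) ≤
        ENNReal.ofReal (∑ ℓ ∈ F, b ℓ * κ ℓ) := by
      rw [map_sum, ENNReal.ofReal_sum_of_nonneg fun ℓ _ => mul_nonneg (hb ℓ) (hκ0 ℓ)]
      refine (mul_le_mul_right (kFunctional_sum_le j t _ F) _).trans ?_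
      rw [Finset.mul_sum]
      exact Finset.sum_le_sum fun ℓ _ =>
        rpow_mul_kFunctional_map_le j (by positivity) (hb ℓ) ht0 (h0 ℓ) (h1 ℓ)
    have hCS : (∑ ℓ ∈ F, b ℓ * κ ℓ) ^ 2 ≤ A * ∑ ℓ ∈ F, b ℓ ^ 2 * κ ℓ := by
      have h := Finset.sum_sq_le_sum_mul_sum_of_sq_le_mul F (r := fun ℓ => b ℓ * κ ℓ)
        (f := κ) (g := fun ℓ => b ℓ ^ 2 * κ ℓ) (fun ℓ _ => hκ0 ℓ)
        (fun ℓ _ => mul_nonneg (sq_nonneg _) (hκ0 ℓ)) (fun ℓ _ => le_of_eq (by ring))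
      refine h.trans (mul_le_mul_of_nonneg_right hsum ?_)
      exact Finset.sum_nonneg fun ℓ _ => mul_nonneg (sq_nonneg _) (hκ0 ℓ)
    calc _ ≤ ENNReal.ofReal t⁻¹ * (ENNReal.ofReal (∑ ℓ ∈ F, b ℓ * κ ℓ)) ^ (2 : ℝ) := by gcongr
      _ = ENNReal.ofReal (t⁻¹ * (∑ ℓ ∈ F, b ℓ * κ ℓ) ^ 2) := by
        rw [ENNReal.ofReal_mul (by positivity), ENNReal.ofReal_pow
          (Finset.sum_nonneg fun ℓ _ => mul_nonneg (hb ℓ) (hκ0 ℓ))]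
        norm_num
      _ ≤ ENNReal.ofReal (t⁻¹ * (A * ∑ ℓ ∈ F, b ℓ ^ 2 * κ ℓ)) := by gcongr
      _ = ENNReal.ofReal (∑ ℓ ∈ F, (A * b ℓ ^ 2) * (t⁻¹ * κ ℓ)) := by
        congr 1
        rw [Finset.mul_sum, Finset.mul_sum]
        exact Finset.sum_congr rfl fun ℓ _ => by ring
      _ = _ := by
        rw [ENNReal.ofReal_sum_of_nonneg fun ℓ _ => mul_nonneg (by positivity)
          (mul_nonneg (by positivity) (hκ0 ℓ))]
        exact Finset.sum_congr rfl fun ℓ _ => ENNReal.ofReal_mul (by positivity)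
  rw [scaleConst, ← hA, ← ENNReal.ofReal_le_ofReal_iff (mul_nonneg (mul_nonneg hA0 hB0)
    (Finset.sum_nonneg fun ℓ _ => sq_nonneg _)), ← interp_enorm_sq,
    show (interpIncl j hθ (∑ ℓ ∈ F, v ℓ)).1 = j (∑ ℓ ∈ F, v ℓ) from rfl, interpENorm_sq]
  refine (setLIntegral_mono' measurableSet_Ioi hpt).trans ?_
  rw [lintegral_finsetSum' _ (fun ℓ _ => by fun_prop)]
  calc _ ≤ ∑ ℓ ∈ F, ENNReal.ofReal (A * b ℓ ^ 2) * ENNReal.ofReal ((1 - θ)⁻¹ + θ⁻¹) := by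
        refine Finset.sum_le_sum fun ℓ _ => ?_
        rw [lintegral_const_mul' _ _ (by simp)]
        gcongr
        exact lintegral_scaleKernel_le hθ (by positivity)
    _ = ENNReal.ofReal (∑ ℓ ∈ F, (A * b ℓ ^ 2) * ((1 - θ)⁻¹ + θ⁻¹)) := by
        rw [ENNReal.ofReal_sum_of_nonneg fun ℓ _ => by positivity]
        exact Finset.sum_congr rfl fun ℓ _ => (ENNReal.ofReal_mul (by positivity)).symm
    _ = _ := by
        congr 1
        rw [Finset.mul_sum]
        exact Finset.sum_congr rfl fun ℓ _ => by ring

end Interpolation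
end NegSobolev

/-! ### Norm equivalence in the dual of an interpolation space -/

namespace NegSobolev

section Abstract

variable {V H : Type*} [NormedAddCommGroup V] [InnerProductSpace ℝ V]
  [NormedAddCommGroup H] [InnerProductSpace ℝ H] {j : V →L[ℝ] H}

theorem dualEmbed_apply (f : H) (v : V) : dualEmbed j f v = inner ℝ f (j v) := rfl

/-- A bound by all decompositions of `u` is a bound by the `K`-functional, as a real number. -/
theorem le_mul_kFunctional {t c x : ℝ} (ht : 0 ≤ t) (hc : 0 ≤ c) {u : H}
    (h : ∀ w : V, x ≤ c * (‖u - j w‖ + t * ‖w‖)) : x ≤ c * (kFunctional j t u).toReal := by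
  rcases hc.eq_or_lt with rfl | hc
  · simpa using h 0
  rw [← div_le_iff₀' hc, ← ENNReal.ofReal_le_iff_le_toReal (kFunctional_ne_top j t u)]
  refine le_iInf fun w => ?_
  rw [← ofReal_norm, ← ofReal_norm, ← ENNReal.ofReal_mul ht,
    ← ENNReal.ofReal_add (norm_nonneg _) (by positivity)]
  exact ENNReal.ofReal_le_ofReal ((div_le_iff₀' hc).2 (h w))

/-- An inverse estimate `τ ‖f‖ ≤ CB ‖f‖_{V'}` bounds the action of `f` on `V` by the
K-functional at scale `τ`. -/
theorem abs_dualEmbed_le {f : H} {τ CB : ℝ} (hτ : 0 < τ) (hCB : 0 ≤ CB)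
    (hB : τ * ‖f‖ ≤ CB * ‖dualEmbed j f‖) (v : V) :
    |dualEmbed j f v| ≤
      (CB + 1) * (τ⁻¹ * ‖dualEmbed j f‖) * (kFunctional j τ (j v)).toReal := by
  refine le_mul_kFunctional hτ.le (by positivity) fun w => ?_
  have h1 : dualEmbed j f v = inner ℝ f (j v - j w) + dualEmbed j f w := by
    rw [dualEmbed_apply, dualEmbed_apply, inner_sub_right]; ring
  have h2 : |inner ℝ f (j v - j w)| ≤ ‖f‖ * ‖j v - j w‖ := abs_real_inner_le_norm _ _
  have h3 : |dualEmbed j f w| ≤ ‖dualEmbed j f‖ * ‖w‖ := (dualEmbed j f).le_opNorm w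
  have h4 : ‖f‖ ≤ CB * (τ⁻¹ * ‖dualEmbed j f‖) := by
    calc ‖f‖ = τ⁻¹ * (τ * ‖f‖) := by field_simp
      _ ≤ τ⁻¹ * (CB * ‖dualEmbed j f‖) := by gcongr
      _ = _ := by ring
  have h5 : ‖dualEmbed j f‖ = τ⁻¹ * ‖dualEmbed j f‖ * τ := by field_simp
  set D := τ⁻¹ * ‖dualEmbed j f‖ with hD
  have hD0 : 0 ≤ D := by positivity
  rw [h1]
  calc |inner ℝ f (j v - j w) + dualEmbed j f w| ≤ ‖f‖ * ‖j v - j w‖ + ‖dualEmbed j f‖ * ‖w‖ :=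
        (abs_add_le _ _).trans (add_le_add h2 h3)
    _ ≤ CB * D * ‖j v - j w‖ + D * τ * ‖w‖ := by rw [← h5]; gcongr
    _ ≤ (CB + 1) * D * ‖j v - j w‖ + (CB + 1) * D * (τ * ‖w‖) := by
        gcongr ?_ * _ + ?_
        · nlinarith
        · have : 0 ≤ CB * D * (τ * ‖w‖) := by positivity
          nlinarith
    _ = _ := by ring

variable [CompleteSpace V]

variable (j) in
/-- The orthogonal projection, in the dual of `V`, onto a finite-dimensional subspace of `H`
(embedded into the dual through the inner product of `H`). -/
noncomputable def dualProj (S : Submodule ℝ H) [FiniteDimensional ℝ S] :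
    StrongDual ℝ V →L[ℝ] StrongDual ℝ V :=
  (S.map (dualEmbed j)).starProjection

theorem dual_inner_eq (φ χ : StrongDual ℝ V) :
    inner ℝ φ χ = φ ((InnerProductSpace.toDual ℝ V).symm χ) :=
  InnerProductSpace.toDual_symm_apply

theorem inner_sub_dualProj (S : Submodule ℝ H) [FiniteDimensional ℝ S] {χ : StrongDual ℝ V}
    (hχ : χ ∈ S.map (dualEmbed j)) (φ : StrongDual ℝ V) :
    inner ℝ χ (φ - dualProj j S φ) = 0 :=
  Submodule.inner_right_of_mem_orthogonal hχ (Submodule.sub_starProjection_mem_orthogonal φ)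

theorem dualProj_mem (S : Submodule ℝ H) [FiniteDimensional ℝ S] (φ : StrongDual ℝ V) :
    dualProj j S φ ∈ S.map (dualEmbed j) :=
  Submodule.starProjection_apply_mem _ _

theorem norm_dualProj_le (S : Submodule ℝ H) [FiniteDimensional ℝ S] (φ : StrongDual ℝ V) :
    ‖dualProj j S φ‖ ≤ ‖φ‖ :=
  Submodule.norm_starProjection_apply_le _ _

/-- Duality: an approximation estimate for `dualProj j S` on `H` makes the Riesz representative
of a projection error small in `H`. -/
theorem norm_map_riesz_le {S : Submodule ℝ H} [FiniteDimensional ℝ S] {ε : ℝ} (hε : 0 ≤ ε)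
    (hJ : ∀ f : H, ‖dualEmbed j f - dualProj j S (dualEmbed j f)‖ ≤ ε * ‖f‖)
    (φ : StrongDual ℝ V) :
    ‖j ((InnerProductSpace.toDual ℝ V).symm (φ - dualProj j S φ))‖ ≤
      ε * ‖φ - dualProj j S φ‖ := by
  set r := φ - dualProj j S φ with hr
  set f := j ((InnerProductSpace.toDual ℝ V).symm r) with hf
  have h1 : ‖f‖ ^ 2 = inner ℝ (dualEmbed j f - dualProj j S (dualEmbed j f)) r := by
    rw [inner_sub_left, inner_sub_dualProj S (dualProj_mem S _), sub_zero, dual_inner_eq,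
      dualEmbed_apply, real_inner_self_eq_norm_sq]
  have h2 : ‖f‖ ^ 2 ≤ ε * ‖f‖ * ‖r‖ := by
    rw [h1]
    exact (real_inner_le_norm _ _).trans (by gcongr; exact hJ f)
  rcases (norm_nonneg f).eq_or_lt with h0 | h0
  · rw [← h0]; positivity
  · have : ‖f‖ * ‖f‖ ≤ ‖f‖ * (ε * ‖r‖) := by nlinarith
    exact le_of_mul_le_mul_left this h0

theorem apply_riesz_sub_dualProj (S : Submodule ℝ H) [FiniteDimensional ℝ S]
    (φ : StrongDual ℝ V) :
    φ ((InnerProductSpace.toDual ℝ V).symm (φ - dualProj j S φ)) =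
      ‖φ - dualProj j S φ‖ ^ 2 := by
  rw [← dual_inner_eq, ← real_inner_self_eq_norm_sq, inner_sub_left,
    inner_sub_dualProj S (dualProj_mem S _), sub_zero]

variable {θ q : ℝ} {S : ℕ → Submodule ℝ H} [∀ ℓ, FiniteDimensional ℝ (S ℓ)] {g : ℕ → ℕ}

/-- The weighted projection errors of a functional on the interpolation space are controlled by its
norm. The functional is tested with a weighted sum of the Riesz representatives of its projection
errors, whose terms live at the scales `q ^ g ℓ` by `norm_map_riesz_le`, so that `norm_sq_sum_le`
bounds the test element. -/
theorem sum_error_sq_le (hθ : θ ∈ Ioo (0 : ℝ) 1) (hq : q ∈ Ioo (0 : ℝ) 1)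
    (hg : StrictMono g) {CJ : ℝ} (hCJ : 0 ≤ CJ)
    (hJ : ∀ ℓ, ∀ f : H,
      ‖dualEmbed j f - dualProj j (S ℓ) (dualEmbed j f)‖ ≤ CJ * q ^ g ℓ * ‖f‖)
    (φ : StrongDual ℝ (Interp j θ)) (F : Finset ℕ) :
    ∑ ℓ ∈ F, ((q ^ g ℓ) ^ (θ - 1) * ‖φ.comp (interpIncl j hθ) -
        dualProj j (S ℓ) (φ.comp (interpIncl j hθ))‖) ^ 2 ≤
      scaleConst θ q * (CJ + 1) ^ 2 * ‖φ‖ ^ 2 := by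
  have hq0 : 0 < q := hq.1
  set φ' : StrongDual ℝ V := φ.comp (interpIncl j hθ) with hφ'
  set a : ℕ → ℝ := fun ℓ => ‖φ' - dualProj j (S ℓ) φ'‖ with ha
  set ψ : ℕ → V := fun ℓ => (InnerProductSpace.toDual ℝ V).symm (φ' - dualProj j (S ℓ) φ')
  have ha0 : ∀ ℓ, 0 ≤ a ℓ := fun ℓ => norm_nonneg _
  have hψ1 : ∀ ℓ, ‖ψ ℓ‖ = a ℓ := fun ℓ => LinearIsometryEquiv.norm_map _ _
  have hψ0 : ∀ ℓ, ‖j (ψ ℓ)‖ ≤ CJ * q ^ g ℓ * a ℓ := fun ℓ =>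
    norm_map_riesz_le (by positivity) (hJ ℓ) φ'
  set b : ℕ → ℝ := fun ℓ => (CJ + 1) * ((q ^ g ℓ) ^ (θ - 1) * a ℓ) with hb
  set v : ℕ → V := fun ℓ => ((q ^ g ℓ) ^ (θ - 1)) ^ 2 • ψ ℓ with hv
  set X : ℝ := ∑ ℓ ∈ F, ((q ^ g ℓ) ^ (θ - 1) * a ℓ) ^ 2 with hX
  have hX0 : 0 ≤ X := Finset.sum_nonneg fun ℓ _ => sq_nonneg _
  have hw := norm_sq_sum_le j hθ hq hg v b (fun ℓ => by positivity) (fun ℓ => by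
      have hτ : 0 < q ^ g ℓ := by positivity
      have e : (q ^ g ℓ) ^ θ = (q ^ g ℓ) ^ (θ - 1) * q ^ g ℓ := by
        rw [← Real.rpow_add_one hτ.ne', sub_add_cancel]
      rw [hv, map_smul, norm_smul, Real.norm_of_nonneg (by positivity), e]
      calc _ ≤ ((q ^ g ℓ) ^ (θ - 1)) ^ 2 * (CJ * q ^ g ℓ * a ℓ) := by gcongr; exact hψ0 ℓ
        _ ≤ ((q ^ g ℓ) ^ (θ - 1)) ^ 2 * ((CJ + 1) * q ^ g ℓ * a ℓ) := by gcongr; linarith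
        _ = _ := by rw [hb]; ring)
    (fun ℓ => by
      rw [hv, norm_smul, Real.norm_of_nonneg (by positivity), hψ1]
      calc _ = 1 * ((q ^ g ℓ) ^ (θ - 1) * a ℓ) * (q ^ g ℓ) ^ (θ - 1) := by ring
        _ ≤ (CJ + 1) * ((q ^ g ℓ) ^ (θ - 1) * a ℓ) * (q ^ g ℓ) ^ (θ - 1) := by
          gcongr; linarith) F
  have hb2 : ∑ ℓ ∈ F, b ℓ ^ 2 = (CJ + 1) ^ 2 * X := by
    rw [hX, Finset.mul_sum]
    exact Finset.sum_congr rfl fun ℓ _ => by rw [hb]; ring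
  have hXφ : X = φ (interpIncl j hθ (∑ ℓ ∈ F, v ℓ)) := by
    change X = φ' (∑ ℓ ∈ F, v ℓ)
    rw [map_sum]
    refine Finset.sum_congr rfl fun ℓ _ => ?_
    rw [hv, map_smul, apply_riesz_sub_dualProj, smul_eq_mul, mul_pow]
  have h1 : X ≤ ‖φ‖ * ‖interpIncl j hθ (∑ ℓ ∈ F, v ℓ)‖ := by
    conv_lhs => rw [hXφ]
    exact (le_abs_self _).trans (φ.le_opNorm _)
  have h2 : X * X ≤ X * (scaleConst θ q * (CJ + 1) ^ 2 * ‖φ‖ ^ 2) := by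
    rw [hb2] at hw
    calc X * X ≤ (‖φ‖ * ‖interpIncl j hθ (∑ ℓ ∈ F, v ℓ)‖) *
          (‖φ‖ * ‖interpIncl j hθ (∑ ℓ ∈ F, v ℓ)‖) := mul_self_le_mul_self hX0 h1
      _ = ‖φ‖ ^ 2 * ‖interpIncl j hθ (∑ ℓ ∈ F, v ℓ)‖ ^ 2 := by ring
      _ ≤ ‖φ‖ ^ 2 * (scaleConst θ q * ((CJ + 1) ^ 2 * X)) := by gcongr
      _ = _ := by ring
  rcases hX0.eq_or_lt with h0 | h0
  · rw [← h0]
    have hc := scaleConst_nonneg hθ hq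
    positivity
  · exact le_of_mul_le_mul_left h2 h0

/-- A functional on the interpolation space is controlled by its projection errors. The projections
decompose into increments, each of which acts through the `K`-functional at its own scale by
`abs_dualEmbed_le`. Sampling the `K`-functional at these scales is bounded by the interpolation
norm, and the density of `V` passes to the limit. -/
theorem norm_sq_le_error (hθ : θ ∈ Ioo (0 : ℝ) 1) (hq : q ∈ Ioo (0 : ℝ) 1)
    (hg : StrictMono g) {CB : ℝ} (hCB : 0 ≤ CB)
    (hB : ∀ ℓ, ∀ f ∈ S ℓ, q ^ g ℓ * ‖f‖ ≤ CB * ‖dualEmbed j f‖) (hS : Monotone S)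
    (hg0 : g 0 = 0) {k : ℕ} (hk : ∀ ℓ, g (ℓ + 1) ≤ g ℓ + k) (φ : StrongDual ℝ (Interp j θ))
    (hsum : Summable fun ℓ => ((q ^ g ℓ) ^ (θ - 1) * ‖φ.comp (interpIncl j hθ) -
        dualProj j (S ℓ) (φ.comp (interpIncl j hθ))‖) ^ 2) :
    ‖φ‖ ^ 2 ≤ (CB + 1) ^ 2 * ((q ^ k) ^ (θ - 1)) ^ 2 / (q ^ (2 * θ) * (1 - q)) *
      (‖φ.comp (interpIncl j hθ)‖ ^ 2 + ∑' ℓ, ((q ^ g ℓ) ^ (θ - 1) *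
        ‖φ.comp (interpIncl j hθ) - dualProj j (S ℓ) (φ.comp (interpIncl j hθ))‖) ^ 2) := by
  have hq0 : 0 < q := hq.1
  have hq1 : 0 < 1 - q := by linarith [hq.2]
  set φ' : StrongDual ℝ V := φ.comp (interpIncl j hθ) with hφ'
  set P : ℕ → StrongDual ℝ V := fun ℓ => dualProj j (S ℓ) φ' with hP
  set a : ℕ → ℝ := fun ℓ => ‖φ' - P ℓ‖ with ha
  set ω : ℕ → ℝ := fun ℓ => (q ^ g ℓ) ^ (θ - 1) with hω
  set Q : ℝ := (q ^ k) ^ (θ - 1) with hQ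
  have hω0 : ∀ ℓ, 0 < ω ℓ := fun ℓ => by positivity
  have hω1 : ∀ ℓ, 1 ≤ ω ℓ := fun ℓ => Real.one_le_rpow_of_pos_of_le_one_of_nonpos
    (by positivity) (pow_le_one₀ hq0.le hq.2.le) (by linarith [hθ.2])
  have hQ1 : 1 ≤ Q := Real.one_le_rpow_of_pos_of_le_one_of_nonpos
    (by positivity) (pow_le_one₀ hq0.le hq.2.le) (by linarith [hθ.2])
  -- consecutive weights differ by at most the factor `Q`, as generations grow by at most `k`
  have hωs : ∀ ℓ, ω (ℓ + 1) ≤ Q * ω ℓ := fun ℓ => by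
    rw [hω, hQ, ← Real.mul_rpow (by positivity) (by positivity), ← pow_add]
    exact Real.rpow_le_rpow_of_nonpos (by positivity)
      (pow_le_pow_of_le_one hq0.le hq.2.le ((hk ℓ).trans_eq (add_comm _ _)))
      (by linarith [hθ.2])
  set A : ℝ := ∑' ℓ, (ω ℓ * a ℓ) ^ 2 with hA
  -- the increments of the projections
  set δ : ℕ → StrongDual ℝ V := fun ℓ => ℓ.casesOn (P 0) fun m => P (m + 1) - P m with hδ
  have hδsum : ∀ L, ∑ ℓ ∈ Finset.range (L + 1), δ ℓ = P L := by
    intro L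
    rw [Finset.sum_range_succ', hδ]
    simp only [Finset.sum_range_sub]
    exact sub_add_cancel _ _
  have hmap : ∀ m, (S m).map (dualEmbed j) ≤ (S (m + 1)).map (dualEmbed j) := fun m =>
    Submodule.map_mono (hS m.le_succ)
  have hδmem : ∀ ℓ, δ ℓ ∈ (S ℓ).map (dualEmbed j) := by
    rintro (_ | m)
    · exact dualProj_mem _ _
    · exact sub_mem (dualProj_mem _ _) (hmap m (dualProj_mem _ _))
  have hδ0 : ‖δ 0‖ ≤ ‖φ'‖ := norm_dualProj_le _ _
  have hδs : ∀ m, ‖δ (m + 1)‖ ≤ a m := by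
    intro m
    have e : δ (m + 1) = dualProj j (S (m + 1)) (φ' - P m) := by
      rw [map_sub]
      have : dualProj j (S (m + 1)) (P m) = P m :=
        Submodule.starProjection_eq_self_iff.2 (hmap m (dualProj_mem _ _))
      rw [this]
    rw [e]
    exact norm_dualProj_le _ _
  have hβ : ∀ L, ∑ ℓ ∈ Finset.range (L + 1), (ω ℓ * ‖δ ℓ‖) ^ 2 ≤ Q ^ 2 * (‖φ'‖ ^ 2 + A) := by
    intro L
    rw [Finset.sum_range_succ', mul_add, add_comm]
    refine add_le_add ?_ ?_
    · have e : ω 0 = 1 := by rw [hω]; simp [hg0]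
      rw [e, one_mul]
      calc ‖δ 0‖ ^ 2 ≤ 1 * ‖φ'‖ ^ 2 := by rw [one_mul]; gcongr
        _ ≤ _ := by gcongr; exact one_le_pow₀ hQ1
    · calc _ ≤ ∑ m ∈ Finset.range L, Q ^ 2 * (ω m * a m) ^ 2 := by
            refine Finset.sum_le_sum fun m _ => ?_
            rw [← mul_pow, ← mul_assoc]
            have := hω0 (m + 1)
            exact pow_le_pow_left₀ (by positivity)
              (mul_le_mul (hωs m) (hδs m) (norm_nonneg _)
                (mul_nonneg (by linarith) (hω0 m).le)) 2
        _ ≤ Q ^ 2 * A := by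
            rw [← Finset.mul_sum]
            gcongr
            exact hsum.sum_le_tsum _ fun _ _ => sq_nonneg _
  set D : ℝ := (CB + 1) ^ 2 * Q ^ 2 / (q ^ (2 * θ) * (1 - q)) * (‖φ'‖ ^ 2 + A) with hD
  have hA0 : 0 ≤ A := tsum_nonneg fun _ => sq_nonneg _
  have hD0 : 0 ≤ D := by positivity
  have hPv : ∀ L v, (P L v) ^ 2 ≤ D * ‖interpIncl j hθ v‖ ^ 2 := by
    intro L v
    set κ : ℕ → ℝ := fun ℓ => (q ^ g ℓ) ^ (-θ) * (kFunctional j (q ^ g ℓ) (j v)).toReal with hκ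
    have h1 : |P L v| ≤ ∑ ℓ ∈ Finset.range (L + 1), (CB + 1) * ((ω ℓ * ‖δ ℓ‖) * κ ℓ) := by
      rw [← hδsum, sum_apply]
      refine (Finset.abs_sum_le_sum_abs _ _).trans (Finset.sum_le_sum fun ℓ _ => ?_)
      obtain ⟨f, hf, hfδ⟩ := hδmem ℓ
      have h := abs_dualEmbed_le (by positivity) hCB (hB ℓ f hf) v
      rw [hfδ] at h
      refine h.trans (le_of_eq ?_)
      have e : (q ^ g ℓ)⁻¹ = ω ℓ * (q ^ g ℓ) ^ (-θ) := by
        rw [hω, ← Real.rpow_add (by positivity), ← Real.rpow_neg_one]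
        ring_nf
      rw [e, hκ]
      ring
    have h2 := Finset.sum_mul_sq_le_sq_mul_sq (Finset.range (L + 1))
      (fun ℓ => ω ℓ * ‖δ ℓ‖) κ
    have h3 : ∑ ℓ ∈ Finset.range (L + 1), κ ℓ ^ 2 ≤
        ‖interpIncl j hθ v‖ ^ 2 / (q ^ (2 * θ) * (1 - q)) := by
      rw [le_div_iff₀' (by positivity)]
      exact sum_kFunctional_sq_le j hθ.1.le hq hg (interpIncl j hθ v) _
    rw [← Finset.mul_sum] at h1
    calc (P L v) ^ 2 = |P L v| ^ 2 := (sq_abs _).symm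
      _ ≤ ((CB + 1) * ∑ ℓ ∈ Finset.range (L + 1), (ω ℓ * ‖δ ℓ‖) * κ ℓ) ^ 2 := by gcongr
      _ = (CB + 1) ^ 2 * (∑ ℓ ∈ Finset.range (L + 1), (ω ℓ * ‖δ ℓ‖) * κ ℓ) ^ 2 := mul_pow _ _ _
      _ ≤ (CB + 1) ^ 2 * ((Q ^ 2 * (‖φ'‖ ^ 2 + A)) *
          (‖interpIncl j hθ v‖ ^ 2 / (q ^ (2 * θ) * (1 - q)))) := by
          gcongr
          refine h2.trans (mul_le_mul (hβ L) h3 (Finset.sum_nonneg fun _ _ => sq_nonneg _)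
            (by positivity))
      _ = _ := by rw [hD]; ring
  have ha_lim : Tendsto a atTop (𝓝 0) := by
    have h1 := hsum.tendsto_atTop_zero
    have h2 := (Real.continuous_sqrt.tendsto _).comp h1
    rw [Real.sqrt_zero] at h2
    refine squeeze_zero (fun ℓ => norm_nonneg _) (fun ℓ => ?_) h2
    rw [Function.comp, Real.sqrt_sq (mul_nonneg (hω0 ℓ).le (norm_nonneg _))]
    exact le_mul_of_one_le_left (norm_nonneg _) (hω1 ℓ)
  have hP_lim : Tendsto P atTop (𝓝 φ') := by
    rw [tendsto_iff_norm_sub_tendsto_zero]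
    exact ha_lim.congr fun ℓ => norm_sub_rev _ _
  have hv : ∀ v, (φ (interpIncl j hθ v)) ^ 2 ≤ D * ‖interpIncl j hθ v‖ ^ 2 := by
    intro v
    have h1 : Tendsto (fun L => (P L v) ^ 2) atTop (𝓝 ((φ' v) ^ 2)) :=
      (((ContinuousLinearMap.apply ℝ ℝ v).continuous.tendsto _).comp hP_lim).pow 2
    exact le_of_tendsto h1 (Eventually.of_forall fun L => hPv L v)
  have hu : ∀ u, (φ u) ^ 2 ≤ D * ‖u‖ ^ 2 := fun u =>
    (denseRange_interpIncl j hθ).induction_on (p := fun u => (φ u) ^ 2 ≤ D * ‖u‖ ^ 2) u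
      (isClosed_le (by fun_prop) (by fun_prop)) hv
  have hop : ‖φ‖ ≤ √D := by
    refine φ.opNorm_le_bound (Real.sqrt_nonneg _) fun u => ?_
    refine abs_le_of_sq_le_sq (?_ : (φ u) ^ 2 ≤ (√D * ‖u‖) ^ 2) (by positivity)
    rw [mul_pow, Real.sq_sqrt hD0]
    exact hu u
  calc ‖φ‖ ^ 2 ≤ √D ^ 2 := by gcongr
    _ = D := Real.sq_sqrt hD0

end Abstract
end NegSobolev

/-! ### Generations in a uniform sequence of meshes -/

namespace NegSobolev

variable {d : ℕ}

theorem IsSimplex.affineSpan_eq_top {T : Finset (Euc d)} (hT : IsSimplex T) :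
    affineSpan ℝ (T : Set (Euc d)) = ⊤ := by
  have h := (hT.affineIndependent.affineSpan_eq_top_iff_card_eq_finrank_add_one).2 (by
    simp [hT.card_eq])
  rwa [Subtype.range_coe_subtype] at h

theorem IsSimplex.interior_nonempty {T : Finset (Euc d)} (hT : IsSimplex T) :
    (interior (hull T)).Nonempty :=
  interior_convexHull_nonempty_iff_affineSpan_eq_top.2 hT.affineSpan_eq_top

theorem isCompact_hull (T : Finset (Euc d)) : IsCompact (hull T) :=
  T.finite_toSet.isCompact_convexHull ℝ

theorem convex_hull (T : Finset (Euc d)) : Convex ℝ (hull T) := convex_convexHull ℝ _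

theorem Mesh.nonempty_elems {Ω : LipschitzDomain d} (𝒯 : Mesh Ω) : 𝒯.elems.Nonempty := by
  obtain ⟨x, hx⟩ := Ω.nonempty
  have h : x ∈ ⋃ T ∈ 𝒯.elems, hull T := 𝒯.cover ▸ subset_closure hx
  simp only [mem_iUnion, exists_prop] at h
  obtain ⟨T, hT, -⟩ := h
  exact ⟨T, hT⟩

/-- Distinct elements of a conforming mesh do not overlap. -/
theorem Mesh.pairwiseDisjoint_interior {Ω : LipschitzDomain d} (𝒯 : Mesh Ω) :
    𝒯.elems.PairwiseDisjoint fun T => interior (hull T) := by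
  intro T hT T' hT' hne
  refine Set.disjoint_left.2 fun x hx hx' => ?_
  -- a common interior point would make the common face full-dimensional
  have hsub : interior (hull T) ∩ interior (hull T') ⊆
      interior (convexHull ℝ ((T : Set (Euc d)) ∩ (T' : Set (Euc d)))) := by
    refine interior_maximal ?_ (isOpen_interior.inter isOpen_interior)
    rw [← 𝒯.conforming T hT T' hT']
    exact inter_subset_inter interior_subset interior_subset
  have htop := interior_convexHull_nonempty_iff_affineSpan_eq_top.1 ⟨x, hsub ⟨hx, hx'⟩⟩
  obtain ⟨p, hp, hp'⟩ : ∃ p ∈ T, p ∉ T' := by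
    by_contra! h
    exact hne (Finset.eq_of_subset_of_card_le h
      ((𝒯.isSimplex T' hT').card_eq.trans (𝒯.isSimplex T hT).card_eq.symm).le)
  have h := (𝒯.isSimplex T hT).affineIndependent.notMem_affineSpan_sdiff ⟨p, hp⟩ Set.univ
  refine h ?_
  have h2 : p ∈ affineSpan ℝ ((T : Set (Euc d)) ∩ (T' : Set (Euc d))) := htop ▸ trivial
  refine affineSpan_mono ℝ ?_ h2
  rintro y ⟨hy, hy'⟩
  exact ⟨⟨y, hy⟩, ⟨mem_univ _, fun h => hp' (by
    have : y = p := congrArg Subtype.val h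
    exact this ▸ hy')⟩, rfl⟩

namespace RefinementRule

variable (R : RefinementRule d)

theorem hull_subset_of_mem_children {T T' : Finset (Euc d)} (hT : IsSimplex T)
    (h : T' ∈ R.children T) : hull T' ⊆ hull T := by
  rw [R.hull_eq T hT]
  exact subset_biUnion_of_mem h

theorem isSimplex_of_mem_iter {S : Set (Finset (Euc d))} (hS : ∀ T ∈ S, IsSimplex T) {n : ℕ} :
    ∀ T ∈ R.iter S n, IsSimplex T := by
  induction n with
  | zero => exact hS
  | succ n ih =>
    intro T hT
    obtain ⟨A, hA, hT⟩ := mem_iUnion₂.1 hT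
    exact R.isSimplex A (ih A hA) T hT

theorem hull_subset_of_mem_iter {A T : Finset (Euc d)} (hA : IsSimplex A) {n : ℕ}
    (hT : T ∈ R.iter {A} n) : hull T ⊆ hull A := by
  induction n generalizing T with
  | zero => rw [mem_singleton_iff.1 hT]
  | succ n ih =>
    obtain ⟨B, hB, hT⟩ := mem_iUnion₂.1 hT
    exact (R.hull_subset_of_mem_children
      (R.isSimplex_of_mem_iter (by simpa using hA) B hB) hT).trans (ih hB)

/-- Refining `n + m` times is refining `n` times and then `m` times. -/
theorem mem_iter_add {S : Set (Finset (Euc d))} {T : Finset (Euc d)} {n m : ℕ} :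
    T ∈ R.iter S (n + m) ↔ ∃ A ∈ R.iter S n, T ∈ R.iter {A} m := by
  induction m generalizing T with
  | zero => simp [iter]
  | succ m ih =>
    rw [← add_assoc]
    simp only [iter, mem_iUnion, exists_prop, ih]
    constructor
    · rintro ⟨B, ⟨A, hA, hB⟩, hT⟩
      exact ⟨A, hA, B, hB, hT⟩
    · rintro ⟨A, hA, B, hB, hT⟩
      exact ⟨B, ⟨A, hA, hB⟩, hT⟩

theorem Descendant.exists_mem_iter {R : RefinementRule d} {A T : Finset (Euc d)}
    (h : R.Descendant A T) : ∃ m, T ∈ R.iter {A} m := by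
  induction h with
  | refl => exact ⟨0, rfl⟩
  | tail _ hc ih =>
    obtain ⟨m, hm⟩ := ih
    exact ⟨m + 1, mem_iUnion₂.2 ⟨_, hm, hc⟩⟩

/-- A simplex does not reappear among its proper descendants, since each refinement has at least
two pieces with disjoint interiors. -/
theorem notMem_iter_succ_self {A : Finset (Euc d)} (hA : IsSimplex A) (n : ℕ) :
    A ∉ R.iter {A} (n + 1) := by
  intro h
  obtain ⟨B, hB, hAB⟩ := mem_iUnion₂.1 h
  have hBs := R.isSimplex_of_mem_iter (by simpa using hA) B hB
  obtain ⟨A', hA', hne⟩ := Set.exists_ne_of_one_lt_ncard (R.two_le_ncard B hBs) A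
  have hsub : hull A' ⊆ hull A :=
    (R.hull_subset_of_mem_children hBs hA').trans (R.hull_subset_of_mem_iter hA hB)
  obtain ⟨x, hx⟩ := (R.isSimplex B hBs A' hA').interior_nonempty
  exact Set.disjoint_left.1 (R.disjoint B hBs hA' hAB hne) hx (interior_mono hsub hx)

theorem pairwiseDisjoint_iter {S : Set (Finset (Euc d))} (hS : ∀ T ∈ S, IsSimplex T)
    (hd : S.PairwiseDisjoint fun T => interior (hull T)) (n : ℕ) :
    (R.iter S n).PairwiseDisjoint fun T => interior (hull T) := by
  induction n with
  | zero => exact hd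
  | succ n ih =>
    intro T hT T' hT' hne
    obtain ⟨A, hA, hTA⟩ := mem_iUnion₂.1 hT
    obtain ⟨A', hA', hTA'⟩ := mem_iUnion₂.1 hT'
    have hAs := R.isSimplex_of_mem_iter hS A hA
    have hAs' := R.isSimplex_of_mem_iter hS A' hA'
    rcases eq_or_ne A A' with rfl | hAA
    · exact R.disjoint A hAs hTA hTA' hne
    · exact (ih hA hA' hAA).mono (interior_mono (R.hull_subset_of_mem_children hAs hTA))
        (interior_mono (R.hull_subset_of_mem_children hAs' hTA'))

/-- A simplex occurs in at most one of the iterated refinements of a nonoverlapping family, so that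
its generation is well defined. -/
theorem eq_of_mem_iter {S : Set (Finset (Euc d))} (hS : ∀ T ∈ S, IsSimplex T)
    (hd : S.PairwiseDisjoint fun T => interior (hull T)) {T : Finset (Euc d)} {n m : ℕ}
    (hn : T ∈ R.iter S n) (hm : T ∈ R.iter S m) : n = m := by
  wlog h : n < m generalizing n m
  · rcases lt_trichotomy n m with h1 | h1 | h1
    · exact absurd h1 h
    · exact h1
    · exact (this hm hn h1).symm
  obtain ⟨p, rfl⟩ := Nat.exists_eq_add_of_lt h
  rw [add_assoc, mem_iter_add] at hm
  obtain ⟨A, hA, hT⟩ := hm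
  have hTs := R.isSimplex_of_mem_iter hS T hn
  have hAT : A = T := by
    by_contra hne
    obtain ⟨x, hx⟩ := hTs.interior_nonempty
    exact Set.disjoint_left.1 (R.pairwiseDisjoint_iter hS hd n hA hn hne)
      (interior_mono (R.hull_subset_of_mem_iter (R.isSimplex_of_mem_iter hS A hA) hT) hx) hx
  exact absurd (hAT ▸ hT) (R.notMem_iter_succ_self hTs p)

theorem gen_eq_of_mem_iter {Ω : LipschitzDomain d} {𝒯₀ : Mesh Ω} {T : Finset (Euc d)} {n : ℕ}
    (h : T ∈ R.iter 𝒯₀.elems n) : R.gen 𝒯₀ T = n :=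
  R.eq_of_mem_iter 𝒯₀.isSimplex 𝒯₀.pairwiseDisjoint_interior
    (Nat.sInf_mem (s := {n | T ∈ R.iter 𝒯₀.elems n}) ⟨n, h⟩) h

variable {R} {Ω : LipschitzDomain d} {Creg qref Cref : ℝ} {kref : ℕ} {𝒯 : ℕ → Mesh Ω}

/-- Every element of every mesh is reached from the initial mesh, so that its generation is the
value of an infimum over a nonempty set. -/
theorem IsUniformSequence.mem_iter_gen (h : R.IsUniformSequence Creg qref Cref kref 𝒯) (ℓ : ℕ) :
    ∀ T ∈ (𝒯 ℓ).elems, T ∈ R.iter (𝒯 0).elems (R.gen (𝒯 0) T) := by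
  induction ℓ with
  | zero =>
    intro T hT
    have h0 : T ∈ R.iter (𝒯 0).elems 0 := hT
    rwa [R.gen_eq_of_mem_iter h0]
  | succ ℓ ih =>
    intro T hT
    obtain ⟨A, hA, hAT⟩ := h.refines ℓ T hT
    obtain ⟨m, hm⟩ := hAT.exists_mem_iter
    have h1 : T ∈ R.iter (𝒯 0).elems (R.gen (𝒯 0) A + m) :=
      R.mem_iter_add.2 ⟨A, ih A hA, hm⟩
    rwa [R.gen_eq_of_mem_iter h1]

/-- The common generation of the elements of each mesh in a uniform sequence starts at zero and
strictly increases, with increments at most `kref`. -/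
theorem IsUniformSequence.exists_gen (h : R.IsUniformSequence Creg qref Cref kref 𝒯) :
    ∃ g : ℕ → ℕ, g 0 = 0 ∧ StrictMono g ∧ (∀ ℓ, g (ℓ + 1) ≤ g ℓ + kref) ∧
      ∀ ℓ, ∀ T ∈ (𝒯 ℓ).elems, R.gen (𝒯 0) T = g ℓ := by
  choose E hE using fun ℓ => (𝒯 ℓ).nonempty_elems
  have hgen : ∀ ℓ, ∀ T ∈ (𝒯 ℓ).elems, R.gen (𝒯 0) T = R.gen (𝒯 0) (E ℓ) :=
    fun ℓ T hT => h.gen_eq ℓ T hT _ (hE ℓ)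
  have hstep : ∀ ℓ, R.gen (𝒯 0) (E ℓ) < R.gen (𝒯 0) (E (ℓ + 1)) ∧
      R.gen (𝒯 0) (E (ℓ + 1)) ≤ R.gen (𝒯 0) (E ℓ) + kref := by
    intro ℓ
    obtain ⟨A, hA, hAT⟩ := h.refines ℓ _ (hE (ℓ + 1))
    obtain ⟨m, hm⟩ := hAT.exists_mem_iter
    have h1 : E (ℓ + 1) ∈ R.iter (𝒯 0).elems (R.gen (𝒯 0) A + m) :=
      R.mem_iter_add.2 ⟨A, h.mem_iter_gen ℓ A hA, hm⟩
    have h2 := R.gen_eq_of_mem_iter h1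
    have h3 := h.gen_father ℓ (E (ℓ + 1)) (by rw [h.all_refined]; exact hE _) A hA hAT
    rw [h2, hgen ℓ A hA] at h3
    rw [h2, hgen ℓ A hA]
    push_cast at h3
    rw [add_sub_cancel_left, abs_of_nonneg (by positivity)] at h3
    omega
  refine ⟨fun ℓ => R.gen (𝒯 0) (E ℓ), ?_, strictMono_nat_of_lt_succ fun ℓ => (hstep ℓ).1,
    fun ℓ => (hstep ℓ).2, hgen⟩
  exact R.gen_eq_of_mem_iter (n := 0) (hE 0)

theorem IsUniformSequence.exists_hull_subset (h : R.IsUniformSequence Creg qref Cref kref 𝒯)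
    (ℓ : ℕ) {T : Finset (Euc d)} (hT : T ∈ (𝒯 (ℓ + 1)).elems) :
    ∃ A ∈ (𝒯 ℓ).elems, hull T ⊆ hull A := by
  obtain ⟨A, hA, hAT⟩ := h.refines ℓ T hT
  obtain ⟨m, hm⟩ := hAT.exists_mem_iter
  exact ⟨A, hA, R.hull_subset_of_mem_iter ((𝒯 ℓ).isSimplex A hA) hm⟩

/-- The spaces of piecewise constants are nested. -/
theorem IsUniformSequence.monotone_P0 (h : R.IsUniformSequence Creg qref Cref kref 𝒯) :
    Monotone fun ℓ => (𝒯 ℓ).P0 := by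
  refine monotone_nat_of_le_succ fun ℓ u hu T hT => ?_
  obtain ⟨A, hA, hTA⟩ := h.exists_hull_subset ℓ hT
  obtain ⟨c, hc⟩ := hu A hA
  refine ⟨c, ?_⟩
  filter_upwards [hc] with x hx hxT
  exact hx (interior_mono hTA hxT)

end RefinementRule

theorem IsSimplex.diam_pos {T : Finset (Euc d)} (hd : 2 ≤ d) (hT : IsSimplex T) :
    0 < Metric.diam (hull T) := by
  have h1 : 1 < T.card := by rw [hT.card_eq]; omega
  obtain ⟨a, ha, b, hb, hab⟩ := Finset.one_lt_card.1 h1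
  refine lt_of_lt_of_le (dist_pos.2 hab) (Metric.dist_le_diam_of_mem (isCompact_hull T).isBounded
    (subset_convexHull ℝ _ ha) (subset_convexHull ℝ _ hb))

theorem Mesh.exists_size_eq {Ω : LipschitzDomain d} (𝒯 : Mesh Ω) :
    ∃ T ∈ 𝒯.elems, Metric.diam (hull T) = 𝒯.size :=
  (𝒯.nonempty_elems.image _).csSup_mem (𝒯.finite.image _)

end NegSobolev

/-! ### Geometry of simplices and meshes -/

namespace NegSobolev

variable {d : ℕ}

/-- A Lipschitz domain lies on one side of its boundary, so that its closure adds no interior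
points. -/
theorem LipschitzDomain.interior_closure_subset (Ω : LipschitzDomain d) :
    interior (closure Ω.carrier) ⊆ Ω.carrier := by
  intro x hx
  by_contra hxΩ
  have hfr : x ∈ frontier Ω.carrier := by
    rw [Ω.isOpen.frontier_eq]
    exact ⟨interior_subset hx, hxΩ⟩
  obtain ⟨e, γ, K, U, he, hγ, hU, hxU, hUS⟩ := Ω.hasLipschitzBoundary x hfr
  have hx1 : inner ℝ e x ≤ γ (x - inner ℝ e x • e) := by
    by_contra! h
    exact hxΩ ((hUS x hxU).2 h)
  -- points strictly below the graph have a neighbourhood outside the domain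
  have hlim : Tendsto (fun ε : ℝ => x - ε • e) (𝓝[>] 0) (𝓝 x) := by
    have : Tendsto (fun ε : ℝ => x - ε • e) (𝓝 0) (𝓝 (x - (0 : ℝ) • e)) :=
      (by fun_prop : Continuous fun ε : ℝ => x - ε • e).tendsto 0
    rw [zero_smul, sub_zero] at this
    exact this.mono_left nhdsWithin_le_nhds
  have hev := hlim.eventually ((hU.inter isOpen_interior).mem_nhds ⟨hxU, hx⟩)
  obtain ⟨ε, ⟨hεU, hεI⟩, hε⟩ := (hev.and self_mem_nhdsWithin).exists
  have hε0 : 0 < ε := hε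
  set y := x - ε • e with hy
  have hey : inner ℝ e y = inner ℝ e x - ε := by
    rw [hy, inner_sub_right, inner_smul_right, real_inner_self_eq_norm_sq, he]
    ring
  have hy' : y - inner ℝ e y • e = x - inner ℝ e x • e := by
    rw [hey, hy, sub_smul]
    abel
  have hopen : IsOpen {z : Euc d | inner ℝ e z < γ (z - inner ℝ e z • e)} :=
    isOpen_lt (by fun_prop) (hγ.continuous.comp (by fun_prop))
  have hyopen : y ∈ {z : Euc d | inner ℝ e z < γ (z - inner ℝ e z • e)} := by
    change inner ℝ e y < γ (y - inner ℝ e y • e)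
    rw [hy', hey]
    linarith
  obtain ⟨z, ⟨hz1, hz2⟩, hzS⟩ := mem_closure_iff.1 (interior_subset hεI) _
    (hU.inter hopen) ⟨hεU, hyopen⟩
  exact absurd ((hUS z hz1).1 hzS) (not_lt.2 (le_of_lt hz2))

/-- Elements cover only the closure of the domain, but their interiors lie in the domain itself. -/
theorem Mesh.interior_hull_subset {Ω : LipschitzDomain d} (𝒯 : Mesh Ω) {T : Finset (Euc d)}
    (hT : T ∈ 𝒯.elems) : interior (hull T) ⊆ Ω.carrier := by
  refine (interior_mono ?_).trans Ω.interior_closure_subset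
  rw [𝒯.cover]
  exact subset_biUnion_of_mem hT

/-- A set of diameter `D` on which `⟨n, ·⟩` oscillates by at most one has volume at most of order `D
^ d / (D ‖n‖)`: more than `D ‖n‖ / 2` disjoint translates of it along `n` fit into a ball of radius
`2 D`. -/
theorem norm_mul_diam_mul_volume_le {K : Set (Euc d)} (hK : IsCompact K) (hne : K.Nonempty)
    {n : Euc d} (hn : ∀ x ∈ K, ∀ y ∈ K, inner ℝ n (x - y) ≤ 1) :
    ‖n‖ * Metric.diam K * volume.real K ≤
      2 ^ (d + 1) * Metric.diam K ^ d * volume.real (Metric.ball (0 : Euc d) 1) := by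
  rcases eq_or_ne n 0 with rfl | hn0
  · rw [norm_zero, zero_mul, zero_mul]; positivity
  have hn0' : 0 < ‖n‖ := norm_pos_iff.2 hn0
  set D := Metric.diam K with hD
  have hD0 : 0 ≤ D := Metric.diam_nonneg
  -- translating by `w` raises `⟨n, ·⟩` by `2`, more than its oscillation on `K`
  set w : Euc d := (2 / ‖n‖ ^ 2) • n with hw
  have hwn : ‖w‖ = 2 / ‖n‖ := by
    rw [hw, norm_smul, Real.norm_of_nonneg (by positivity)]
    field_simp
  have hnw : inner ℝ n w = 2 := by
    rw [hw, inner_smul_right, real_inner_self_eq_norm_sq]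
    field_simp
  obtain ⟨x₀, hx₀⟩ := hne
  set N := ⌊D * ‖n‖ / 2⌋₊ with hN
  let A : ℕ → Set (Euc d) := fun m => (fun x => x + -((m : ℝ) • w)) ⁻¹' K
  have hAmeas : ∀ m, MeasurableSet (A m) := fun m =>
    hK.measurableSet.preimage (by fun_prop)
  have hAvol : ∀ m, volume (A m) = volume K := fun m => measure_preimage_add_right _ _ _
  have hdisj : ∀ m m', m < m' → Disjoint (A m) (A m') := by
    intro m m' hmm
    refine Set.disjoint_left.2 fun x hx hx' => ?_
    have h := hn _ hx _ hx'
    have e : x + -((m : ℝ) • w) - (x + -((m' : ℝ) • w)) = ((m' : ℝ) - m) • w := by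
      rw [sub_smul]; abel
    rw [e, inner_smul_right, hnw] at h
    have : (m : ℝ) + 1 ≤ m' := by exact_mod_cast hmm
    linarith
  have hsub : (⋃ m ∈ Finset.range (N + 1), A m) ⊆ Metric.closedBall x₀ (2 * D) := by
    refine iUnion₂_subset fun m hm x hx => ?_
    have hm' : (m : ℝ) ≤ D * ‖n‖ / 2 :=
      (Nat.le_floor_iff (by positivity)).1 (Nat.lt_succ_iff.1 (Finset.mem_range.1 hm))
    have h1 : dist (x + -((m : ℝ) • w)) x₀ ≤ D :=
      Metric.dist_le_diam_of_mem hK.isBounded hx hx₀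
    have h2 : ‖(m : ℝ) • w‖ ≤ D := by
      rw [norm_smul, Real.norm_of_nonneg (by positivity), hwn]
      calc (m : ℝ) * (2 / ‖n‖) ≤ D * ‖n‖ / 2 * (2 / ‖n‖) := by gcongr
        _ = D := by field_simp
    rw [Metric.mem_closedBall, dist_eq_norm]
    rw [dist_eq_norm] at h1
    calc ‖x - x₀‖ = ‖(x + -((m : ℝ) • w) - x₀) + (m : ℝ) • w‖ := by congr 1; abel
      _ ≤ D + D := (norm_add_le _ _).trans (add_le_add h1 h2)
      _ = 2 * D := by ring
  have hmeas : volume (⋃ m ∈ Finset.range (N + 1), A m) = (N + 1 : ℕ) * volume K := by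
    rw [measure_biUnion_finset _ fun m _ => hAmeas m]
    · simp [hAvol]
    · intro m _ m' _ hne
      rcases lt_or_gt_of_ne hne with h | h
      · exact hdisj m m' h
      · exact (hdisj m' m h).symm
  have hle := measureReal_mono (μ := volume) hsub (Metric.isBounded_closedBall.measure_lt_top.ne)
  rw [measureReal_def, hmeas, ENNReal.toReal_mul, ENNReal.toReal_natCast, ← measureReal_def,
    measureReal_def (s := Metric.closedBall _ _),
    Measure.addHaar_closedBall _ _ (by positivity), ENNReal.toReal_mul,
    ENNReal.toReal_ofReal (by positivity), ← measureReal_def, finrank_euclideanSpace_fin] at hle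
  have hN' : D * ‖n‖ / 2 ≤ (N + 1 : ℕ) := by
    push_cast
    exact (Nat.lt_floor_add_one _).le
  have h3 : D * ‖n‖ / 2 * volume.real K ≤ (2 * D) ^ d * volume.real (Metric.ball (0 : Euc d) 1) :=
    (mul_le_mul_of_nonneg_right hN' measureReal_nonneg).trans hle
  calc ‖n‖ * D * volume.real K = 2 * (D * ‖n‖ / 2 * volume.real K) := by ring
    _ ≤ 2 * ((2 * D) ^ d * volume.real (Metric.ball (0 : Euc d) 1)) := by gcongr
    _ = _ := by rw [mul_pow, pow_succ]; ring

theorem IsSimplex.volume_pos {T : Finset (Euc d)} (hT : IsSimplex T) :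
    0 < volume.real (hull T) := by
  refine ENNReal.toReal_pos ?_ (isCompact_hull T).measure_lt_top.ne
  exact ((isOpen_interior.measure_pos volume hT.interior_nonempty).trans_le
    (measure_mono interior_subset)).ne'

/-- The ratio of inradius and diameter guaranteed by the shape regularity constant. -/
noncomputable def inradiusConst (d : ℕ) (Creg : ℝ) : ℝ :=
  ((d + 1) * (2 ^ (d + 1) * Creg * volume.real (Metric.ball (0 : Euc d) 1) + 1))⁻¹

theorem inradiusConst_pos {Creg : ℝ} (hC : 0 < Creg) : 0 < inradiusConst d Creg := by
  unfold inradiusConst; positivity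

/-- A shape regular simplex contains a ball around its centroid of radius comparable to its
diameter: the barycentric coordinates have slopes at most `C / diam`. -/
theorem IsSimplex.exists_ball_subset (hd : 2 ≤ d) {T : Finset (Euc d)} (hT : IsSimplex T)
    {Creg : ℝ} (hC : 0 < Creg)
    (hreg : Metric.diam (hull T) ^ d / volume.real (hull T) ≤ Creg) :
    ∃ x, Metric.ball x (inradiusConst d Creg * Metric.diam (hull T)) ⊆ interior (hull T) := by
  have hrange : range ((↑) : T → Euc d) = (T : Set (Euc d)) := Subtype.range_coe
  let b : AffineBasis T ℝ (Euc d) := ⟨(↑), hT.affineIndependent, by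
    rw [hrange]; exact hT.affineSpan_eq_top⟩
  have hb : range b = (T : Set (Euc d)) := hrange
  have hne : Nonempty T := by
    have : 0 < T.card := by rw [hT.card_eq]; omega
    exact (Finset.card_pos.1 this).to_subtype
  set D := Metric.diam (hull T) with hD
  have hD0 : 0 < D := hT.diam_pos hd
  set ω := volume.real (Metric.ball (0 : Euc d) 1) with hω
  have hω0 : 0 ≤ ω := measureReal_nonneg
  set B := 2 ^ (d + 1) * Creg * ω with hB
  have hB0 : 0 ≤ B := by positivity
  have hvol := hT.volume_pos
  have hint : interior (hull T) = {x | ∀ i, 0 < b.coord i x} := by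
    rw [← b.interior_convexHull, hb, hull]
  have hhull : hull T = {x | ∀ i, 0 ≤ b.coord i x} := by
    rw [← b.convexHull_eq_nonneg_coord, hb, hull]
  -- the gradients of the barycentric coordinates
  let n : T → Euc d := fun i =>
    (InnerProductSpace.toDual ℝ (Euc d)).symm (LinearMap.toContinuousLinearMap (b.coord i).linear)
  have hn : ∀ i x y, inner ℝ (n i) (x - y) = b.coord i x - b.coord i y := by
    intro i x y
    rw [InnerProductSpace.toDual_symm_apply]
    exact (b.coord i).linearMap_vsub x y
  have hcoord1 : ∀ i, ∀ x ∈ hull T, b.coord i x ≤ 1 := by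
    intro i x hx
    rw [hhull] at hx
    rw [← b.sum_coord_apply_eq_one x]
    exact Finset.single_le_sum (fun k _ => hx k) (Finset.mem_univ i)
  have hcoord0 : ∀ i, ∀ x ∈ hull T, 0 ≤ b.coord i x := by
    intro i x hx
    rw [hhull] at hx
    exact hx i
  have hnorm : ∀ i, ‖n i‖ * D ≤ B := by
    intro i
    have h := norm_mul_diam_mul_volume_le (isCompact_hull T)
      (hT.interior_nonempty.mono interior_subset) (n := n i) (fun x hx y hy => by
        rw [hn]
        linarith [hcoord1 i x hx, hcoord0 i y hy])
    rw [div_le_iff₀ hvol] at hreg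
    have h2 : ‖n i‖ * D * volume.real (hull T) ≤ B * volume.real (hull T) := by
      calc _ ≤ 2 ^ (d + 1) * D ^ d * ω := h
        _ ≤ 2 ^ (d + 1) * (Creg * volume.real (hull T)) * ω := by gcongr
        _ = _ := by rw [hB]; ring
    exact le_of_mul_le_mul_right h2 hvol
  refine ⟨Finset.univ.centroid ℝ b, fun x hx => ?_⟩
  rw [hint]
  intro i
  rw [Metric.mem_ball, dist_eq_norm] at hx
  have hc : b.coord i (Finset.univ.centroid ℝ b) = ((d : ℝ) + 1)⁻¹ := by
    rw [b.coord_apply_centroid (Finset.mem_univ i)]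
    simp [hT.card_eq]
  have h1 : |inner ℝ (n i) (x - Finset.univ.centroid ℝ b)| ≤
      ‖n i‖ * ‖x - Finset.univ.centroid ℝ b‖ := abs_real_inner_le_norm _ _
  rw [hn, hc] at h1
  have h2 : ‖n i‖ * ‖x - Finset.univ.centroid ℝ b‖ < ((d : ℝ) + 1)⁻¹ := by
    calc _ ≤ ‖n i‖ * (inradiusConst d Creg * D) := by gcongr
      _ = inradiusConst d Creg * (‖n i‖ * D) := by ring
      _ ≤ inradiusConst d Creg * B := by
        gcongr
        · exact (inradiusConst_pos hC).le
        · exact hnorm i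
      _ = ((d : ℝ) + 1)⁻¹ * ((B + 1)⁻¹ * B) := by rw [inradiusConst, ← hω, ← hB, mul_inv]; ring
      _ < ((d : ℝ) + 1)⁻¹ * 1 := by
        gcongr
        rw [inv_mul_lt_iff₀ (by positivity)]
        linarith
      _ = _ := mul_one _
  have h3 := (abs_le.1 h1).1
  linarith

end NegSobolev

/-! ### Test functions and norms as integrals -/

namespace NegSobolev

variable {d : ℕ}

theorem gradient_apply_eq (φ : Euc d → ℝ) (x : Euc d) (i : Fin d) :
    gradient φ x i = fderiv ℝ φ x (EuclideanSpace.single i 1) := by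
  have h := InnerProductSpace.toDual_symm_apply (𝕜 := ℝ) (x := EuclideanSpace.single i (1 : ℝ))
    (y := fderiv ℝ φ x)
  rw [← h, EuclideanSpace.inner_single_right]
  simp [gradient]

/-- A family of smooth bump functions, one for each ball, with gradients bounded by the inverse
of the radius. -/
theorem exists_scaled_bump (d : ℕ) : ∃ M : ℝ, 0 < M ∧ ∀ (x : Euc d) (r : ℝ), 0 < r →
    ∃ b : Euc d → ℝ, ContDiff ℝ (⊤ : ℕ∞) b ∧ tsupport b ⊆ Metric.ball x r ∧ (∀ y, 0 ≤ b y) ∧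
      (∀ y ∈ Metric.closedBall x (r / 4), b y = 1) ∧ ∀ y, ‖gradient b y‖ ≤ M / r := by
  let β : ContDiffBump (0 : Euc d) := ⟨1 / 4, 1 / 2, by norm_num, by norm_num⟩
  have hβ : ContDiff ℝ (⊤ : ℕ∞) β := β.contDiff
  obtain ⟨M, hM⟩ := (hβ.continuous_fderiv (by simp)).bounded_above_of_compact_support
    (β.hasCompactSupport.fderiv ℝ)
  refine ⟨|M| + 1, by positivity, fun x r hr => ?_⟩
  have hsm : ContDiff ℝ (⊤ : ℕ∞) fun y : Euc d => r⁻¹ • (y - x) :=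
    (contDiff_id.sub contDiff_const).const_smul _
  refine ⟨fun y => β (r⁻¹ • (y - x)), hβ.comp hsm, ?_, fun y => β.nonneg, fun y hy => ?_,
    fun y => ?_⟩
  · have h1 : tsupport (fun y => β (r⁻¹ • (y - x))) ⊆ Metric.closedBall x (r / 2) := by
      refine closure_minimal (fun y hy => ?_) Metric.isClosed_closedBall
      have h2 : r⁻¹ • (y - x) ∈ Function.support β := hy
      rw [β.support_eq, mem_ball_zero_iff, norm_smul, norm_inv, Real.norm_of_nonneg hr.le,
        inv_mul_lt_iff₀ hr] at h2
      rw [Metric.mem_closedBall, dist_eq_norm]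
      have h3 : β.rOut = 1 / 2 := rfl
      rw [h3] at h2
      linarith
    exact h1.trans (Metric.closedBall_subset_ball (by linarith))
  · refine β.one_of_mem_closedBall ?_
    rw [mem_closedBall_zero_iff, norm_smul, norm_inv, Real.norm_of_nonneg hr.le,
      inv_mul_le_iff₀ hr]
    rw [Metric.mem_closedBall, dist_eq_norm] at hy
    have h3 : β.rIn = 1 / 4 := rfl
    rw [h3]
    linarith
  · have hd1 : HasFDerivAt (fun y : Euc d => r⁻¹ • (y - x))
        (r⁻¹ • ContinuousLinearMap.id ℝ (Euc d)) y :=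
      ((hasFDerivAt_id y).sub_const x).const_smul r⁻¹
    have hd2 := ((hβ.differentiable (by simp)) (r⁻¹ • (y - x))).hasFDerivAt.comp y hd1
    have hd3 : fderiv ℝ (fun y => β (r⁻¹ • (y - x))) y =
      (fderiv ℝ β (r⁻¹ • (y - x))).comp (r⁻¹ • ContinuousLinearMap.id ℝ (Euc d)) := hd2.fderiv
    rw [gradient, LinearIsometryEquiv.norm_map, hd3, ContinuousLinearMap.comp_smul,
      ContinuousLinearMap.comp_id, norm_smul, norm_inv, Real.norm_of_nonneg hr.le,
      div_eq_inv_mul]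
    gcongr
    exact (hM _).trans ((le_abs_self M).trans (by linarith))

/-- The classical gradient of a test function is its weak gradient. -/
theorem IsTestFunction.isWeakGradient {Ω : LipschitzDomain d} {φ : Euc d → ℝ}
    (h : IsTestFunction Ω φ) : IsWeakGradient Ω (h.memLp.toLp φ) (h.memLp_gradient.toLp _) := by
  intro ψ hψ i
  have hφsupp : ∀ x ∉ Ω.carrier, φ x = 0 := fun x hx =>
    image_eq_zero_of_notMem_tsupport fun hx' => hx (h.tsupport_subset hx')
  have hψsupp : ∀ x ∉ Ω.carrier, ψ x = 0 := fun x hx =>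
    image_eq_zero_of_notMem_tsupport fun hx' => hx (hψ.tsupport_subset hx')
  have h1 : ∫ x in Ω.carrier, h.memLp.toLp φ x * gradient ψ x i =
      ∫ x in Ω.carrier, φ x * gradient ψ x i := by
    refine integral_congr_ae ?_
    filter_upwards [h.memLp.coeFn_toLp] with x hx
    rw [hx]
  have h2 : ∫ x in Ω.carrier, h.memLp_gradient.toLp _ x i * ψ x =
      ∫ x in Ω.carrier, gradient φ x i * ψ x := by
    refine integral_congr_ae ?_
    filter_upwards [h.memLp_gradient.coeFn_toLp] with x hx
    rw [hx]
  rw [h1, h2, setIntegral_eq_integral_of_forall_compl_eq_zero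
      (fun x hx => by rw [hφsupp x hx, zero_mul]),
    setIntegral_eq_integral_of_forall_compl_eq_zero (fun x hx => by rw [hψsupp x hx, mul_zero])]
  simp only [gradient_apply_eq]
  have hφ' : Continuous fun x => fderiv ℝ φ x (EuclideanSpace.single i 1) :=
    (h.contDiff.continuous_fderiv (by simp)).clm_apply continuous_const
  have hψ' : Continuous fun x => fderiv ℝ ψ x (EuclideanSpace.single i 1) :=
    (hψ.contDiff.continuous_fderiv (by simp)).clm_apply continuous_const
  refine integral_mul_fderiv_eq_neg_fderiv_mul_of_integrable ?_ ?_ ?_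
    (fun x _ => h.contDiff.differentiable (by simp) x)
    (fun x _ => hψ.contDiff.differentiable (by simp) x)
  · exact (hφ'.mul hψ.contDiff.continuous).integrable_of_hasCompactSupport
      hψ.hasCompactSupport.mul_left
  · exact (h.contDiff.continuous.mul hψ').integrable_of_hasCompactSupport
      h.hasCompactSupport.mul_right
  · exact (h.contDiff.continuous.mul hψ.contDiff.continuous).integrable_of_hasCompactSupport
      h.hasCompactSupport.mul_right

/-- A test function as an element of `H¹₀(Ω)`. -/
theorem IsTestFunction.exists_H10 {Ω : LipschitzDomain d} {φ : Euc d → ℝ}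
    (h : IsTestFunction Ω φ) : ∃ v : H10 Ω, H10.toL2 Ω v = h.memLp.toLp φ ∧
      h1Grad Ω (H10.toH1 Ω v) = h.memLp_gradient.toLp _ := by
  let w : H1 Ω := ⟨WithLp.toLp 2 (h.memLp.toLp φ, h.memLp_gradient.toLp _), h.isWeakGradient⟩
  have hw : w ∈ h10Submodule Ω := by
    refine Submodule.le_topologicalClosure _ ⟨φ, h, ?_, ?_⟩
    · exact h.memLp.coeFn_toLp
    · exact h.memLp_gradient.coeFn_toLp
  exact ⟨(⟨w, hw⟩ : ↥(h10Submodule Ω)), rfl, rfl⟩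

theorem ofReal_norm_sq_eq_lintegral {α E : Type*} [MeasurableSpace α] [NormedAddCommGroup E]
    {μ : Measure α} (f : Lp E 2 μ) : ENNReal.ofReal (‖f‖ ^ 2) = ∫⁻ x, ‖f x‖ₑ ^ 2 ∂μ := by
  rw [ENNReal.ofReal_pow (norm_nonneg _), ofReal_norm, Lp.enorm_def,
    eLpNorm_eq_lintegral_rpow_enorm_toReal (by simp) (by simp), ← ENNReal.rpow_natCast,
    ← ENNReal.rpow_mul]
  simp

namespace Mesh

variable {Ω : LipschitzDomain d} (𝒯 : Mesh Ω)

/-- The elements cover the domain up to a null set. -/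
theorem lintegral_le_sum (F : Euc d → ℝ≥0∞) :
    ∫⁻ x in Ω.carrier, F x ≤ ∑ T ∈ 𝒯.finite.toFinset, ∫⁻ x in interior (hull T), F x := by
  rw [← lintegral_biUnion_finset (by simpa using 𝒯.pairwiseDisjoint_interior)
    (fun _ _ => isOpen_interior.measurableSet)]
  refine lintegral_mono' ?_ le_rfl
  refine Measure.restrict_mono_ae ?_
  have h := 𝒯.ae_mem_interior
  rw [ae_restrict_iff' Ω.isOpen.measurableSet] at h
  filter_upwards [h] with x hx hxΩ
  obtain ⟨T, hT, hxT⟩ := hx hxΩ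
  exact mem_iUnion₂.2 ⟨T, by simpa using hT, hxT⟩

/-- The interiors of the elements are disjoint parts of the domain. -/
theorem sum_lintegral_le (F : Euc d → ℝ≥0∞) :
    ∑ T ∈ 𝒯.finite.toFinset, ∫⁻ x in interior (hull T), F x ≤ ∫⁻ x in Ω.carrier, F x := by
  rw [← lintegral_biUnion_finset (by simpa using 𝒯.pairwiseDisjoint_interior)
    (fun _ _ => isOpen_interior.measurableSet)]
  refine lintegral_mono_set (iUnion₂_subset fun T hT => ?_)
  exact 𝒯.interior_hull_subset (by simpa using hT)

end Mesh

end NegSobolev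

/-! ### The inverse estimate for piecewise constants -/

namespace NegSobolev

variable {d : ℕ}

/-- A shape regular simplex carries a bump function with integral of the order of the volume of the
simplex and gradient of the order of its inverse diameter. -/
theorem IsSimplex.exists_bump {Creg M : ℝ} (hd : 2 ≤ d) (hC : 0 < Creg)
    (hM : ∀ (x : Euc d) (r : ℝ), 0 < r →
      ∃ b : Euc d → ℝ, ContDiff ℝ (⊤ : ℕ∞) b ∧ tsupport b ⊆ Metric.ball x r ∧ (∀ y, 0 ≤ b y) ∧
      (∀ y ∈ Metric.closedBall x (r / 4), b y = 1) ∧ ∀ y, ‖gradient b y‖ ≤ M / r)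
    {T : Finset (Euc d)} (hT : IsSimplex T)
    (hreg : Metric.diam (hull T) ^ d / volume.real (hull T) ≤ Creg) :
    ∃ b : Euc d → ℝ, ContDiff ℝ (⊤ : ℕ∞) b ∧ tsupport b ⊆ interior (hull T) ∧
      (inradiusConst d Creg / 4) ^ d * volume.real (hull T) ≤ ∫ y, b y ∧
      ∀ y, ‖gradient b y‖ ≤ M / (inradiusConst d Creg * Metric.diam (hull T)) := by
  obtain ⟨x, hx⟩ := hT.exists_ball_subset hd hC hreg
  set D := Metric.diam (hull T) with hD
  have hD0 : 0 < D := hT.diam_pos hd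
  have hρ0 := inradiusConst_pos (d := d) hC
  set ρ := inradiusConst d Creg with hρ
  obtain ⟨b, hb1, hb2, hb3, hb4, hb5⟩ := hM x (ρ * D) (by positivity)
  refine ⟨b, hb1, hb2.trans hx, ?_, hb5⟩
  have hcs : HasCompactSupport b :=
    HasCompactSupport.of_support_subset_isCompact (isCompact_hull T)
      (subset_closure.trans ((hb2.trans hx).trans interior_subset))
  obtain ⟨p, hp⟩ := hT.interior_nonempty
  have hp := interior_subset hp
  have h1 : volume.real (hull T) ≤ D ^ d * volume.real (Metric.ball (0 : Euc d) 1) := by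
    have hsub : hull T ⊆ Metric.closedBall p D := fun y hy =>
      Metric.dist_le_diam_of_mem (isCompact_hull T).isBounded hy hp
    have h := measureReal_mono (μ := volume) hsub Metric.isBounded_closedBall.measure_lt_top.ne
    rwa [measureReal_def (s := Metric.closedBall _ _), Measure.addHaar_closedBall _ _ hD0.le,
      ENNReal.toReal_mul, ENNReal.toReal_ofReal (by positivity), ← measureReal_def,
      finrank_euclideanSpace_fin] at h
  have h2 : ∫ y in Metric.closedBall x (ρ * D / 4), b y ≤ ∫ y, b y :=
    setIntegral_le_integral (hb1.continuous.integrable_of_hasCompactSupport hcs)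
      (Eventually.of_forall hb3)
  rw [setIntegral_congr_fun Metric.isClosed_closedBall.measurableSet hb4, setIntegral_const,
    smul_eq_mul, mul_one, measureReal_def, Measure.addHaar_closedBall _ _ (by positivity),
    ENNReal.toReal_mul, ENNReal.toReal_ofReal (by positivity), ← measureReal_def,
      finrank_euclideanSpace_fin] at h2
  refine le_trans ?_ h2
  calc (ρ / 4) ^ d * volume.real (hull T) ≤
        (ρ / 4) ^ d * (D ^ d * volume.real (Metric.ball (0 : Euc d) 1)) := by gcongr
    _ = _ := by rw [← mul_assoc, ← mul_pow]; ring_nf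

/-- Inverse estimate: on piecewise constants the `L²(Ω)` norm is bounded by the `H^{-1}(Ω)` norm
and the inverse mesh size. The test function is a combination of bump functions, one inside each
element. -/
theorem exists_inverse_estimate (hd : 2 ≤ d) {Creg Cref : ℝ} (hC : 0 < Creg) (hCref : 0 < Cref) :
    ∃ K : ℝ, 0 < K ∧ ∀ (Ω : LipschitzDomain d) (𝒯 : Mesh Ω) (τ : ℝ), 0 < τ →
      (∀ T ∈ 𝒯.elems, Metric.diam (hull T) ^ d / volume.real (hull T) ≤ Creg) →
      (∀ T ∈ 𝒯.elems, τ ≤ Cref * Metric.diam (hull T)) →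
      ∀ f ∈ 𝒯.P0, τ * ‖f‖ ≤ K * ‖dualEmbed (H10.toL2 Ω) f‖ := by
  obtain ⟨M, hM0, hM⟩ := exists_scaled_bump d
  have hρ0 := inradiusConst_pos (d := d) hC
  set ρ := inradiusConst d Creg with hρ
  set κ := (ρ / 4) ^ d with hκ
  have hκ0 : 0 < κ := by positivity
  refine ⟨M * Cref / ρ / κ, by positivity, ?_⟩
  intro Ω 𝒯 τ hτ hreg hdiam f hf
  have hsimp := 𝒯.isSimplex
  choose! b hb1 hb2 hb3 hb4 using fun T (hT : T ∈ 𝒯.elems) =>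
    (hsimp T hT).exists_bump hd hC hM (hreg T hT)
  have hint : ∀ T ∈ 𝒯.elems, interior (hull T) ⊆ Ω.carrier := fun T hT =>
    𝒯.interior_hull_subset hT
  have htest : ∀ T ∈ 𝒯.elems, IsTestFunction Ω (b T) := fun T hT =>
    ⟨hb1 T hT, HasCompactSupport.of_support_subset_isCompact (isCompact_hull T)
      (subset_closure.trans ((hb2 T hT).trans interior_subset)), (hb2 T hT).trans (hint T hT)⟩
  have hbsupp : ∀ T ∈ 𝒯.elems, ∀ x ∉ interior (hull T), b T x = 0 := fun T hT x hx =>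
    image_eq_zero_of_notMem_tsupport fun hx' => hx (hb2 T hT hx')
  have hgsupp : ∀ T ∈ 𝒯.elems, ∀ x ∉ interior (hull T), gradient (b T) x = 0 := by
    intro T hT x hx
    have : fderiv ℝ (b T) x = 0 :=
      fderiv_of_notMem_tsupport ℝ fun hx' => hx (hb2 T hT hx')
    rw [gradient, this, map_zero]
  choose! v hv1 hv2 using fun T (hT : T ∈ 𝒯.elems) => (htest T hT).exists_H10
  choose! c hc using hf
  set F := 𝒯.finite.toFinset with hF
  have hmem : ∀ T ∈ F, T ∈ 𝒯.elems := fun T hT => by simpa [hF] using hT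
  set A : ℝ := ∑ T ∈ F, c T ^ 2 * volume.real (hull T) with hA
  have hA0 : 0 ≤ A := Finset.sum_nonneg fun T _ => by positivity
  set w : H10 Ω := ∑ T ∈ F, c T • v T with hw
  -- the `L²` norm of `f`
  have hfA : ‖f‖ ^ 2 ≤ A := by
    rw [← ENNReal.ofReal_le_ofReal_iff hA0, ofReal_norm_sq_eq_lintegral]
    refine (𝒯.lintegral_le_sum _).trans ?_
    rw [hA, ENNReal.ofReal_sum_of_nonneg fun T _ => by positivity]
    refine Finset.sum_le_sum fun T hT => ?_
    have h1 := hc T (hmem T hT)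
    rw [ae_restrict_iff' Ω.isOpen.measurableSet] at h1
    calc ∫⁻ x in interior (hull T), ‖f x‖ₑ ^ 2 ≤ ∫⁻ x in interior (hull T), ‖c T‖ₑ ^ 2 := by
          refine lintegral_mono_ae ?_
          rw [ae_restrict_iff' isOpen_interior.measurableSet]
          filter_upwards [h1] with x hx hxT
          rw [hx (hint T (hmem T hT) hxT) hxT]
      _ ≤ ‖c T‖ₑ ^ 2 * volume (hull T) := by
          rw [setLIntegral_const]
          gcongr
          exact interior_subset
      _ = _ := by
          rw [ENNReal.ofReal_mul (by positivity), measureReal_def,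
            ENNReal.ofReal_toReal (isCompact_hull T).measure_lt_top.ne, ← sq_abs,
            ENNReal.ofReal_pow (abs_nonneg _), ← Real.norm_eq_abs, ofReal_norm]
  -- the pairing of `f` with the test function
  have hpair : κ * A ≤ dualEmbed (H10.toL2 Ω) f w := by
    rw [hw, map_sum, hA, Finset.mul_sum]
    refine Finset.sum_le_sum fun T hT => ?_
    have hTe := hmem T hT
    rw [map_smul, dualEmbed_apply, hv1 T hTe, L2.inner_def]
    have h1 : ∫ x in Ω.carrier, inner ℝ (f x) ((htest T hTe).memLp.toLp (b T) x) =
        ∫ x in Ω.carrier, c T * b T x := by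
      refine integral_congr_ae ?_
      filter_upwards [(htest T hTe).memLp.coeFn_toLp, hc T hTe] with x hx1 hx2
      rw [hx1]
      by_cases hx : x ∈ interior (hull T)
      · rw [hx2 hx]; simp [mul_comm]
      · rw [hbsupp T hTe x hx]; simp
    have h2 : ∫ x in Ω.carrier, b T x = ∫ x, b T x :=
      setIntegral_eq_integral_of_forall_compl_eq_zero fun x hx =>
        hbsupp T hTe x fun hx' => hx (hint T hTe hx')
    rw [h1, integral_const_mul, h2, smul_eq_mul]
    calc κ * (c T ^ 2 * volume.real (hull T)) = c T ^ 2 * (κ * volume.real (hull T)) := by ring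
      _ ≤ c T ^ 2 * ∫ x, b T x := by gcongr; exact hb3 T hTe
      _ = _ := by ring
  -- the norm of the test function
  have hgrad : ∀ T ∈ F, ‖h1Grad Ω (H10.toH1 Ω (v T))‖ ^ 2 ≤
      (M * Cref / ρ / τ) ^ 2 * volume.real (hull T) := by
    intro T hT
    have hTe := hmem T hT
    have hD0 := (hsimp T hTe).diam_pos hd
    have hbound : M / (ρ * Metric.diam (hull T)) ≤ M * Cref / ρ / τ := by
      rw [div_div, div_le_div_iff₀ (by positivity) (by positivity)]
      have := hdiam T hTe
      calc M * (ρ * τ) ≤ M * (ρ * (Cref * Metric.diam (hull T))) := by gcongr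
        _ = _ := by ring
    rw [hv2 T hTe, ← ENNReal.ofReal_le_ofReal_iff (by positivity), ofReal_norm_sq_eq_lintegral]
    calc ∫⁻ x in Ω.carrier, ‖(htest T hTe).memLp_gradient.toLp _ x‖ₑ ^ 2
        = ∫⁻ x in Ω.carrier, ‖gradient (b T) x‖ₑ ^ 2 := by
          refine lintegral_congr_ae ?_
          filter_upwards [(htest T hTe).memLp_gradient.coeFn_toLp] with x hx
          rw [hx]
      _ ≤ ∫⁻ x in Ω.carrier, (hull T).indicator
            (fun _ => ENNReal.ofReal ((M * Cref / ρ / τ) ^ 2)) x := by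
          refine lintegral_mono fun x => ?_
          by_cases hx : x ∈ interior (hull T)
          · rw [indicator_of_mem (interior_subset hx), ENNReal.ofReal_pow (by positivity),
              ← ofReal_norm]
            gcongr
            exact (hb4 T hTe x).trans hbound
          · rw [hgsupp T hTe x hx]; simp
      _ ≤ ∫⁻ x, (hull T).indicator
            (fun _ => ENNReal.ofReal ((M * Cref / ρ / τ) ^ 2)) x := setLIntegral_le_lintegral _ _
      _ = _ := by
          rw [lintegral_indicator_const (isCompact_hull T).measurableSet,
            ENNReal.ofReal_mul (by positivity), measureReal_def,
            ENNReal.ofReal_toReal (isCompact_hull T).measure_lt_top.ne]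
  -- bumps in distinct elements have disjoint supports
  have horth : ∀ T ∈ F, ∀ T' ∈ F, T ≠ T' →
      inner ℝ (h1Grad Ω (H10.toH1 Ω (v T))) (h1Grad Ω (H10.toH1 Ω (v T'))) = 0 := by
    intro T hT T' hT' hne
    rw [hv2 T (hmem T hT), hv2 T' (hmem T' hT'), L2.inner_def]
    refine integral_eq_zero_of_ae ?_
    filter_upwards [(htest T (hmem T hT)).memLp_gradient.coeFn_toLp,
      (htest T' (hmem T' hT')).memLp_gradient.coeFn_toLp] with x hx hx'
    rw [hx, hx']
    by_cases h : x ∈ interior (hull T)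
    · rw [hgsupp T' (hmem T' hT') x fun h' => Set.disjoint_left.1
        (𝒯.pairwiseDisjoint_interior (hmem T hT) (hmem T' hT') hne) h h']
      simp
    · rw [hgsupp T (hmem T hT) x h]
      simp
  have hwn : ‖w‖ ^ 2 ≤ (M * Cref / ρ / τ) ^ 2 * A := by
    rw [H10.norm_eq, hw, map_sum, map_sum, ← real_inner_self_eq_norm_sq, sum_inner, hA,
      Finset.mul_sum]
    refine Finset.sum_le_sum fun T hT => ?_
    rw [inner_sum, Finset.sum_eq_single T]
    · rw [map_smul, map_smul, inner_smul_left, inner_smul_right, real_inner_self_eq_norm_sq]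
      simp only [conj_trivial]
      calc c T * (c T * ‖h1Grad Ω (H10.toH1 Ω (v T))‖ ^ 2) =
            c T ^ 2 * ‖h1Grad Ω (H10.toH1 Ω (v T))‖ ^ 2 := by ring
        _ ≤ c T ^ 2 * ((M * Cref / ρ / τ) ^ 2 * volume.real (hull T)) := by
            gcongr; exact hgrad T hT
        _ = _ := by ring
    · intro T' hT' hne
      rw [map_smul, map_smul, map_smul, map_smul, inner_smul_left, inner_smul_right,
        horth T hT T' hT' hne.symm]
      simp
    · exact fun h => absurd hT h
  have hwn' : ‖w‖ ≤ M * Cref / ρ / τ * √A := by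
    refine le_of_sq_le_sq ?_ (by positivity)
    rwa [mul_pow, Real.sq_sqrt hA0]
  have hfA' : ‖f‖ ≤ √A := Real.le_sqrt_of_sq_le hfA
  have hfin : κ * A ≤ ‖dualEmbed (H10.toL2 Ω) f‖ * (M * Cref / ρ / τ * √A) :=
    hpair.trans ((le_abs_self _).trans (((dualEmbed (H10.toL2 Ω) f).le_opNorm w).trans
      (mul_le_mul_of_nonneg_left hwn' (norm_nonneg _))))
  have hkey : √A ≤ M * Cref / ρ / κ * ‖dualEmbed (H10.toL2 Ω) f‖ / τ := by
    rcases (Real.sqrt_nonneg A).eq_or_lt with h0 | h0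
    · rw [← h0]; positivity
    · refine le_of_mul_le_mul_right ?_ (mul_pos hκ0 h0)
      calc √A * (κ * √A) = κ * (√A * √A) := by ring
        _ = κ * A := by rw [Real.mul_self_sqrt hA0]
        _ ≤ _ := hfin
        _ = _ := by field_simp
  rw [le_div_iff₀ hτ] at hkey
  calc τ * ‖f‖ ≤ τ * √A := by gcongr
    _ = √A * τ := mul_comm _ _
    _ ≤ _ := hkey

end NegSobolev

/-! ### Poincaré's inequality for smooth functions -/

namespace NegSobolev

variable {d : ℕ}

/-- The Cauchy–Schwarz inequality against the constant function. -/
theorem sq_lintegral_le {α : Type*} [MeasurableSpace α] (ν : Measure α) {g : α → ℝ≥0∞}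
    (hg : AEMeasurable g ν) : (∫⁻ x, g x ∂ν) ^ 2 ≤ ν univ * ∫⁻ x, g x ^ 2 ∂ν := by
  have h := ENNReal.lintegral_mul_le_Lp_mul_Lq ν Real.HolderConjugate.two_two
    (aemeasurable_const (b := (1 : ℝ≥0∞))) hg
  have h2 : ∫⁻ x, g x ∂ν ≤ (ν univ) ^ (1 / 2 : ℝ) * (∫⁻ x, g x ^ 2 ∂ν) ^ (1 / 2 : ℝ) := by
    simpa using h
  calc (∫⁻ x, g x ∂ν) ^ 2 ≤
        ((ν univ) ^ (1 / 2 : ℝ) * (∫⁻ x, g x ^ 2 ∂ν) ^ (1 / 2 : ℝ)) ^ 2 := by gcongr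
    _ = _ := by
      rw [mul_pow, ← ENNReal.rpow_natCast, ← ENNReal.rpow_natCast, ← ENNReal.rpow_mul,
        ← ENNReal.rpow_mul]
      norm_num

/-- The Cauchy–Schwarz inequality with a weight, in the form of Jensen's inequality. -/
theorem sq_lintegral_mul_le {α : Type*} [MeasurableSpace α] (μ : Measure α) {w g : α → ℝ≥0∞}
    (hw : Measurable w) (hg : AEMeasurable g μ) :
    (∫⁻ x, w x * g x ∂μ) ^ 2 ≤ (∫⁻ x, w x ∂μ) * ∫⁻ x, w x * g x ^ 2 ∂μ := by
  have h := sq_lintegral_le (μ.withDensity w)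
    (hg.mono_ac (withDensity_absolutelyContinuous μ w))
  rw [lintegral_withDensity_eq_lintegral_mul₀ hw.aemeasurable hg,
    lintegral_withDensity_eq_lintegral_mul₀ hw.aemeasurable (hg.pow_const 2),
    withDensity_apply _ MeasurableSet.univ, Measure.restrict_univ] at h
  exact h

/-- Contracting a set into itself by a factor `a ≥ 1/2` loses at most a factor `2 ^ d`. -/
theorem setLIntegral_comp_affine_le {K : Set (Euc d)} (hK : MeasurableSet K) {h : Euc d → ℝ≥0∞}
    (hh : Measurable h) {a : ℝ} (ha : 1 / 2 ≤ a) (c : Euc d) (hmem : ∀ x ∈ K, c + a • x ∈ K) :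
    ∫⁻ x in K, h (c + a • x) ≤ ENNReal.ofReal (2 ^ d) * ∫⁻ x in K, h x := by
  have ha0 : 0 < a := by linarith
  set H : Euc d → ℝ≥0∞ := K.indicator h with hH
  have hHm : Measurable H := hh.indicator hK
  calc ∫⁻ x in K, h (c + a • x) = ∫⁻ x in K, H (c + a • x) := by
        refine setLIntegral_congr_fun hK fun x hx => ?_
        rw [hH, indicator_of_mem (hmem x hx)]
    _ ≤ ∫⁻ x, H (c + a • x) := setLIntegral_le_lintegral _ _
    _ = ∫⁻ x, H (c + x) ∂(Measure.map (fun x : Euc d => a • x) volume) := by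
        rw [lintegral_map (by fun_prop) (by fun_prop)]
    _ = ENNReal.ofReal |(a ^ d)⁻¹| * ∫⁻ x, H x := by
        rw [Measure.map_addHaar_smul _ ha0.ne', lintegral_smul_measure,
          lintegral_add_left_eq_self, finrank_euclideanSpace_fin, smul_eq_mul]
    _ ≤ ENNReal.ofReal (2 ^ d) * ∫⁻ x, H x := by
        gcongr
        rw [abs_of_nonneg (by positivity), ← inv_pow]
        gcongr
        rw [inv_le_comm₀ ha0 (by norm_num)]
        linarith
    _ = _ := by rw [hH, lintegral_indicator hK]

/-- A Poincaré inequality on a convex set for smooth functions: differences are integrals of the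
gradient along segments. -/
theorem lintegral_lintegral_sub_sq_le {K : Set (Euc d)} (hK : MeasurableSet K)
    (hconv : Convex ℝ K) {D : ℝ} (hD : ∀ x ∈ K, ∀ y ∈ K, ‖x - y‖ ≤ D) {u : Euc d → ℝ}
    (hu : ContDiff ℝ 1 u) :
    ∫⁻ x in K, ∫⁻ y in K, ‖u x - u y‖ₑ ^ 2 ≤
      ENNReal.ofReal (D ^ 2) * (ENNReal.ofReal (2 ^ d) * volume K *
        ∫⁻ x in K, ‖gradient u x‖ₑ ^ 2) := by
  set h : Euc d → ℝ≥0∞ := fun x => ‖gradient u x‖ₑ ^ 2 with hh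
  have hgc : Continuous (gradient u) :=
    (InnerProductSpace.toDual ℝ (Euc d)).symm.continuous.comp (hu.continuous_fderiv (by simp))
  have hhc : Measurable h := (hgc.enorm.measurable).pow_const 2
  set I : Set ℝ := Ioc 0 1 with hI
  have hpt : ∀ x ∈ K, ∀ y ∈ K, ‖u x - u y‖ₑ ^ 2 ≤
      ENNReal.ofReal (D ^ 2) * ∫⁻ t in I, h ((1 - t) • y + t • x) := by
    intro x hx y hy
    have hline : ∀ t : ℝ, HasDerivAt (fun t : ℝ => u ((1 - t) • y + t • x))
        (fderiv ℝ u ((1 - t) • y + t • x) (x - y)) t := by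
      intro t
      have h1 : HasDerivAt (fun t : ℝ => (1 - t) • y + t • x) (x - y) t := by
        have := (((hasDerivAt_const t (1 : ℝ)).sub (hasDerivAt_id t)).smul_const y).add
          ((hasDerivAt_id t).smul_const x)
        have e : x - y = (0 - 1 : ℝ) • y + (1 : ℝ) • x := by module
        rw [e]
        exact this
      exact ((hu.differentiable (by simp)) _).hasFDerivAt.comp_hasDerivAt t h1
    have hcont : Continuous fun t : ℝ => fderiv ℝ u ((1 - t) • y + t • x) (x - y) :=
      ((hu.continuous_fderiv (by simp)).comp (by fun_prop)).clm_apply continuous_const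
    have hftc := intervalIntegral.integral_eq_sub_of_hasDerivAt (a := 0) (b := 1)
      (fun t _ => hline t) (hcont.intervalIntegrable _ _)
    have hftc2 : u x - u y = ∫ t in I, fderiv ℝ u ((1 - t) • y + t • x) (x - y) := by
      rw [hI, ← intervalIntegral.integral_of_le zero_le_one, hftc]
      simp
    have hm : AEMeasurable (fun t : ℝ => ‖gradient u ((1 - t) • y + t • x)‖ₑ)
        (volume.restrict I) :=
      ((hgc.comp (by fun_prop)).enorm.measurable).aemeasurable
    calc ‖u x - u y‖ₑ ^ 2
        ≤ (∫⁻ t in I, ‖fderiv ℝ u ((1 - t) • y + t • x) (x - y)‖ₑ) ^ 2 := by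
          rw [hftc2]; gcongr; exact enorm_integral_le_lintegral_enorm _
      _ ≤ (∫⁻ t in I, ENNReal.ofReal D * ‖gradient u ((1 - t) • y + t • x)‖ₑ) ^ 2 := by
          gcongr with t
          refine (ContinuousLinearMap.le_opENorm _ _).trans ?_
          rw [mul_comm, gradient,
            ← ofReal_norm ((InnerProductSpace.toDual ℝ (Euc d)).symm _),
            LinearIsometryEquiv.norm_map, ofReal_norm]
          gcongr
          rw [← ofReal_norm]
          exact ENNReal.ofReal_le_ofReal (hD x hx y hy)
      _ = ENNReal.ofReal D ^ 2 * (∫⁻ t in I, ‖gradient u ((1 - t) • y + t • x)‖ₑ) ^ 2 := by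
          rw [lintegral_const_mul' _ _ (by simp), mul_pow]
      _ ≤ ENNReal.ofReal D ^ 2 * (volume.restrict I univ * ∫⁻ t in I,
            ‖gradient u ((1 - t) • y + t • x)‖ₑ ^ 2) := by
          gcongr; exact sq_lintegral_le _ hm
      _ = _ := by
          rw [ENNReal.ofReal_pow ((norm_nonneg _).trans (hD x hx y hy))]
          simp [hI, hh]
  have hslice : ∀ t ∈ I, ∫⁻ x in K, ∫⁻ y in K, h ((1 - t) • y + t • x) ≤
      ENNReal.ofReal (2 ^ d) * volume K * ∫⁻ x in K, h x := by
    intro t ht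
    have hc : ∀ x ∈ K, ∀ y ∈ K, (1 - t) • y + t • x ∈ K := fun x hx y hy =>
      hconv hy hx (by linarith [ht.2]) ht.1.le (by ring)
    -- one of the two variables is contracted by a factor at least `1/2`
    rcases le_total (1 / 2) t with h2 | h2
    · rw [lintegral_lintegral_swap (by
        refine Measurable.aemeasurable ?_
        exact hhc.comp (by fun_prop))]
      calc _ ≤ ∫⁻ y in K, ENNReal.ofReal (2 ^ d) * ∫⁻ x in K, h x := by
            refine setLIntegral_mono' hK fun y hy => ?_
            exact setLIntegral_comp_affine_le hK hhc h2 _ fun x hx => hc x hx y hy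
        _ = _ := by rw [setLIntegral_const]; ring
    · calc _ ≤ ∫⁻ x in K, ENNReal.ofReal (2 ^ d) * ∫⁻ x in K, h x := by
            refine setLIntegral_mono' hK fun x hx => ?_
            simp_rw [add_comm _ (t • x)]
            refine setLIntegral_comp_affine_le hK hhc (by linarith) _ fun y hy => ?_
            rw [add_comm]
            exact hc x hx y hy
        _ = _ := by rw [setLIntegral_const]; ring
  have hm1 : Measurable fun p : Euc d × Euc d × ℝ => h ((1 - p.2.2) • p.2.1 + p.2.2 • p.1) :=
    hhc.comp (by fun_prop)
  calc ∫⁻ x in K, ∫⁻ y in K, ‖u x - u y‖ₑ ^ 2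
      ≤ ∫⁻ x in K, ∫⁻ y in K, ENNReal.ofReal (D ^ 2) *
          ∫⁻ t in I, h ((1 - t) • y + t • x) :=
        setLIntegral_mono' hK fun x hx => setLIntegral_mono' hK fun y hy => hpt x hx y hy
    _ = ENNReal.ofReal (D ^ 2) * ∫⁻ x in K, ∫⁻ y in K, ∫⁻ t in I, h ((1 - t) • y + t • x) := by
        rw [← lintegral_const_mul' _ _ (by simp)]
        refine lintegral_congr fun x => ?_
        rw [← lintegral_const_mul' _ _ (by simp)]
    _ = ENNReal.ofReal (D ^ 2) * ∫⁻ t in I, ∫⁻ x in K, ∫⁻ y in K, h ((1 - t) • y + t • x) := by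
        congr 1
        rw [lintegral_lintegral_swap (α := ℝ) (by
          refine Measurable.aemeasurable ?_
          have hm2 : Measurable fun p : (ℝ × Euc d) × Euc d =>
            h ((1 - p.1.1) • p.2 + p.1.1 • p.1.2) := hhc.comp (by fun_prop)
          exact hm2.lintegral_prod_right')]
        refine lintegral_congr fun x => ?_
        rw [lintegral_lintegral_swap (by
          refine Measurable.aemeasurable ?_
          exact hhc.comp (by fun_prop))]
    _ ≤ ENNReal.ofReal (D ^ 2) * ∫⁻ t in I,
          ENNReal.ofReal (2 ^ d) * volume K * ∫⁻ x in K, h x := by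
        gcongr ENNReal.ofReal (D ^ 2) * ?_
        exact setLIntegral_mono' measurableSet_Ioc hslice
    _ = _ := by
        rw [setLIntegral_const, hI, Real.volume_Ioc]
        simp

end NegSobolev

/-! ### Mollification and Poincaré's inequality in the Sobolev space -/

namespace NegSobolev

variable {d : ℕ} {Ω : LipschitzDomain d}

theorem integrable_of_L2 {E : Type*} [NormedAddCommGroup E]
    (f : Lp E 2 (volume.restrict Ω.carrier)) : Integrable f (volume.restrict Ω.carrier) := by
  have : IsFiniteMeasure (volume.restrict Ω.carrier) :=
    ⟨by rw [Measure.restrict_apply_univ]; exact Ω.isBounded.measure_lt_top⟩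
  exact (Lp.memLp f).integrable one_le_two

/-- The mollification of a function on `Ω`, extended by zero. -/
noncomputable def mollify (β : ContDiffBump (0 : Euc d)) (f : L2 Ω) : Euc d → ℝ :=
  convolution (β.normed volume) (Ω.carrier.indicator f) (ContinuousLinearMap.lsmul ℝ ℝ) volume

theorem locallyIntegrable_indicator (f : L2 Ω) :
    LocallyIntegrable (Ω.carrier.indicator f) volume :=
  ((integrable_indicator_iff Ω.isOpen.measurableSet).2 (integrable_of_L2 f)).locallyIntegrable

theorem contDiff_mollify (β : ContDiffBump (0 : Euc d)) (f : L2 Ω) :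
    ContDiff ℝ 1 (mollify β f) :=
  β.hasCompactSupport_normed.contDiff_convolution_left _ β.contDiff_normed
    (locallyIntegrable_indicator f)

theorem fderiv_mollify_apply (β : ContDiffBump (0 : Euc d)) (f : L2 Ω) (x w : Euc d) :
    fderiv ℝ (mollify β f) x w =
      ∫ t in Ω.carrier, fderiv ℝ (β.normed volume) (x - t) w * f t := by
  have hsm : ContDiff ℝ 1 (β.normed (volume : Measure (Euc d))) := β.contDiff_normed
  -- the derivative falls on the mollifier
  have h1 := β.hasCompactSupport_normed.hasFDerivAt_convolution_right
    (μ := (volume : Measure (Euc d))) (ContinuousLinearMap.lsmul ℝ ℝ : ℝ →L[ℝ] ℝ →L[ℝ] ℝ).flip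
    (locallyIntegrable_indicator f) hsm x
  rw [convolution_flip] at h1
  have h2 : fderiv ℝ (mollify β f) x = _ := h1.fderiv
  rw [h2, convolution_precompR_apply _ (locallyIntegrable_indicator f)
    (β.hasCompactSupport_normed.fderiv ℝ) (hsm.continuous_fderiv (by simp)), convolution_def,
    ← integral_indicator Ω.isOpen.measurableSet]
  refine integral_congr_ae (Eventually.of_forall fun t => ?_)
  by_cases ht : t ∈ Ω.carrier <;> simp [ht]

theorem tsupport_normed_comp_sub_subset (β : ContDiffBump (0 : Euc d)) (x : Euc d) :
    tsupport (fun y => β.normed volume (x - y)) ⊆ Metric.closedBall x β.rOut := by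
  refine closure_minimal (fun y hy => ?_) Metric.isClosed_closedBall
  have h : x - y ∈ Function.support (β.normed volume) := hy
  rw [β.support_normed_eq, mem_ball_zero_iff] at h
  rw [Metric.mem_closedBall', dist_eq_norm]
  exact h.le

/-- Away from the boundary, mollification commutes with the weak gradient. -/
theorem gradient_mollify (β : ContDiffBump (0 : Euc d)) (v : H1 Ω) {K : Set (Euc d)}
    (hKΩ : K ⊆ Ω.carrier) {x : Euc d} (hx : Metric.closedBall x β.rOut ⊆ K) :
    gradient (mollify β (h1ToL2 Ω v)) x =
      ∫ y in K, β.normed volume (x - y) • h1Grad Ω v y := by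
  set ρ := β.normed (volume : Measure (Euc d)) with hρ
  have hρs : ContDiff ℝ (⊤ : ℕ∞) ρ := β.contDiff_normed
  have hsupp := tsupport_normed_comp_sub_subset β x
  have htest : IsTestFunction Ω fun y => ρ (x - y) :=
    ⟨hρs.comp (contDiff_const.sub contDiff_id),
      HasCompactSupport.of_support_subset_isCompact (isCompact_closedBall x β.rOut)
        (subset_closure.trans hsupp), hsupp.trans (hx.trans hKΩ)⟩
  have hzero : ∀ y ∉ K, ρ (x - y) = 0 := fun y hy =>
    image_eq_zero_of_notMem_tsupport (f := fun y => ρ (x - y)) fun hy' => hy (hx (hsupp hy'))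
  have hint : Integrable (fun y => ρ (x - y) • h1Grad Ω v y) (volume.restrict Ω.carrier) := by
    obtain ⟨M, hM⟩ := htest.contDiff.continuous.bounded_above_of_compact_support
      htest.hasCompactSupport
    exact (integrable_of_L2 (h1Grad Ω v)).bdd_smul M
      htest.contDiff.continuous.aestronglyMeasurable (Eventually.of_forall hM)
  have hKint : ∫ y in K, ρ (x - y) • h1Grad Ω v y =
      ∫ y in Ω.carrier, ρ (x - y) • h1Grad Ω v y :=
    (setIntegral_eq_of_subset_of_forall_sdiff_eq_zero Ω.isOpen.measurableSet hKΩ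
      fun y hy => by rw [hzero y hy.2, zero_smul]).symm
  rw [hKint]
  ext i
  rw [gradient_apply_eq, fderiv_mollify_apply,
    eval_integral_piLp fun i => (EuclideanSpace.proj (𝕜 := ℝ) i).integrable_comp hint]
  have hweak := v.2 (fun y => ρ (x - y)) htest i
  have hgrad : ∀ y, gradient (fun y => ρ (x - y)) y i =
      -(fderiv ℝ ρ (x - y) (EuclideanSpace.single i 1)) := by
    intro y
    have h1 : HasFDerivAt (fun y : Euc d => x - y) (-ContinuousLinearMap.id ℝ (Euc d)) y :=
      (hasFDerivAt_id y).const_sub x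
    have h2 := ((hρs.differentiable (by simp)) (x - y)).hasFDerivAt.comp y h1
    have h3 : fderiv ℝ (fun y => ρ (x - y)) y =
      (fderiv ℝ ρ (x - y)).comp (-ContinuousLinearMap.id ℝ (Euc d)) := h2.fderiv
    rw [gradient_apply_eq, h3]
    simp
  simp only [hgrad] at hweak
  have e1 : ∫ y in Ω.carrier, fderiv ℝ ρ (x - y) (EuclideanSpace.single i 1) * h1ToL2 Ω v y =
      -∫ y in Ω.carrier, h1ToL2 Ω v y * -(fderiv ℝ ρ (x - y) (EuclideanSpace.single i 1)) := by
    rw [← integral_neg]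
    refine integral_congr_ae (Eventually.of_forall fun y => ?_)
    simp only
    ring
  have e2 : ∫ y in Ω.carrier, (ρ (x - y) • h1Grad Ω v y) i =
      ∫ y in Ω.carrier, h1Grad Ω v y i * ρ (x - y) := by
    refine integral_congr_ae (Eventually.of_forall fun y => ?_)
    simp [mul_comm]
  rw [e1, e2]
  have hweak' : ∫ y in Ω.carrier,
      h1ToL2 Ω v y * -(fderiv ℝ ρ (x - y) (EuclideanSpace.single i 1)) =
      -∫ y in Ω.carrier, h1Grad Ω v y i * ρ (x - y) := hweak
  rw [hweak', neg_neg]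

/-- Mollification does not increase the `L²` norm of the gradient, up to enlarging the set by the
mollification radius. -/
theorem lintegral_gradient_mollify_le (β : ContDiffBump (0 : Euc d)) (v : H1 Ω)
    {K K' : Set (Euc d)} (hKΩ : K ⊆ Ω.carrier) (hK' : MeasurableSet K')
    (hKK' : ∀ x ∈ K', Metric.closedBall x β.rOut ⊆ K) :
    ∫⁻ x in K', ‖gradient (mollify β (h1ToL2 Ω v)) x‖ₑ ^ 2 ≤
      ∫⁻ x in K, ‖h1Grad Ω v x‖ₑ ^ 2 := by
  set ρ := β.normed (volume : Measure (Euc d)) with hρ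
  have hρc : Continuous ρ := β.continuous.div_const _
  have hρ1 : ∫⁻ t, ‖ρ t‖ₑ = 1 := by
    have h := β.integral_normed (μ := (volume : Measure (Euc d)))
    rw [← ofReal_integral_norm_eq_lintegral_enorm β.integrable_normed]
    simp_rw [Real.norm_of_nonneg (β.nonneg_normed _), h, ENNReal.ofReal_one]
  have hGm : AEStronglyMeasurable (h1Grad Ω v) (volume.restrict K) :=
    (Lp.aestronglyMeasurable (h1Grad Ω v)).mono_measure (Measure.restrict_mono hKΩ le_rfl)
  have hpt : ∀ x ∈ K', ‖gradient (mollify β (h1ToL2 Ω v)) x‖ₑ ^ 2 ≤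
      ∫⁻ y in K, ‖ρ (x - y)‖ₑ * ‖h1Grad Ω v y‖ₑ ^ 2 := by
    intro x hx
    have hρx : Continuous fun y => ρ (x - y) := hρc.comp (by fun_prop)
    calc ‖gradient (mollify β (h1ToL2 Ω v)) x‖ₑ ^ 2
        ≤ (∫⁻ y in K, ‖ρ (x - y)‖ₑ * ‖h1Grad Ω v y‖ₑ) ^ 2 := by
          rw [gradient_mollify β v hKΩ (hKK' x hx)]
          gcongr
          refine (enorm_integral_le_lintegral_enorm _).trans (le_of_eq ?_)
          simp only [enorm_smul, hρ]
      _ ≤ (∫⁻ y in K, ‖ρ (x - y)‖ₑ) * ∫⁻ y in K, ‖ρ (x - y)‖ₑ * ‖h1Grad Ω v y‖ₑ ^ 2 :=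
          sq_lintegral_mul_le _ hρx.enorm.measurable hGm.enorm
      _ ≤ 1 * ∫⁻ y in K, ‖ρ (x - y)‖ₑ * ‖h1Grad Ω v y‖ₑ ^ 2 := by
          gcongr
          refine (setLIntegral_le_lintegral _ _).trans (le_of_eq ?_)
          rw [lintegral_sub_left_eq_self (fun y => ‖ρ y‖ₑ), hρ1]
      _ = _ := one_mul _
  calc _ ≤ ∫⁻ x in K', ∫⁻ y in K, ‖ρ (x - y)‖ₑ * ‖h1Grad Ω v y‖ₑ ^ 2 :=
        setLIntegral_mono' hK' hpt
    _ = ∫⁻ y in K, ∫⁻ x in K', ‖ρ (x - y)‖ₑ * ‖h1Grad Ω v y‖ₑ ^ 2 := by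
        refine lintegral_lintegral_swap ?_
        have h1 : Continuous fun p : Euc d × Euc d => ρ (p.1 - p.2) := hρc.comp (by fun_prop)
        exact h1.enorm.measurable.aemeasurable.mul
          ((hGm.enorm.pow_const 2).comp_quasiMeasurePreserving
            Measure.quasiMeasurePreserving_snd)
    _ ≤ _ := by
        refine lintegral_mono fun y => ?_
        rw [lintegral_mul_const' _ _ (by finiteness)]
        calc _ ≤ 1 * ‖h1Grad Ω v y‖ₑ ^ 2 := by
              gcongr
              refine (setLIntegral_le_lintegral _ _).trans (le_of_eq ?_)
              rw [lintegral_sub_right_eq_self (fun y => ‖ρ y‖ₑ), hρ1]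
          _ = _ := one_mul _

/-- The points at distance at least `δ` from the complement of `K`. -/
def erosion (δ : ℝ) (K : Set (Euc d)) : Set (Euc d) := {x | ∀ y ∉ K, δ ≤ dist x y}

theorem isClosed_erosion (δ : ℝ) (K : Set (Euc d)) : IsClosed (erosion δ K) := by
  simp only [erosion, ofPred_forall]
  exact isClosed_iInter fun y => isClosed_iInter fun _ => isClosed_le (by fun_prop) (by fun_prop)

theorem closedBall_subset_of_mem_erosion {δ r : ℝ} {K : Set (Euc d)} {x : Euc d}
    (hx : x ∈ erosion δ K) (hr : r < δ) : Metric.closedBall x r ⊆ K := by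
  intro y hy
  by_contra hyK
  have h1 := hx y hyK
  rw [Metric.mem_closedBall'] at hy
  linarith

theorem _root_.Convex.erosion {K : Set (Euc d)} (hconv : Convex ℝ K) (δ : ℝ) :
    Convex ℝ (erosion δ K) := by
  intro x hx y hy a b ha hb hab z hz
  by_contra! hlt
  -- a point `z` outside `K` close to `a • x + b • y` is a combination of `x + e` and `y + e` in `K`
  set e := z - (a • x + b • y) with he
  have hen : ‖e‖ < δ := by rwa [he, ← dist_eq_norm, dist_comm]
  have hmem : ∀ w ∈ NegSobolev.erosion δ K, w + e ∈ K := by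
    intro w hw
    by_contra hwK
    have := hw _ hwK
    rw [dist_eq_norm, sub_add_cancel_left, norm_neg] at this
    linarith
  refine hz ?_
  have hz' : z = a • (x + e) + b • (y + e) := by
    have : a • (x + e) + b • (y + e) = a • x + b • y + (a + b) • e := by module
    rw [this, hab, one_smul, he]
    abel
  rw [hz']
  exact hconv (hmem x hx) (hmem y hy) ha hb hab

theorem eventually_mem_erosion {K : Set (Euc d)} (hK : IsOpen K) {x : Euc d} (hx : x ∈ K) :
    ∀ᶠ δ in 𝓝 (0 : ℝ), x ∈ erosion δ K := by
  obtain ⟨ε, hε, hball⟩ := Metric.isOpen_iff.1 hK x hx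
  filter_upwards [gt_mem_nhds hε] with δ hδ y hy
  by_contra! hlt
  exact hy (hball (by rw [Metric.mem_ball']; linarith))

/-- Fatou's lemma for the double integral of squared differences, along an exhaustion. -/
theorem lintegral_lintegral_sub_sq_le_of_tendsto {K : Set (Euc d)} (hK : MeasurableSet K)
    {f : Euc d → ℝ} {u : ℕ → Euc d → ℝ} (hu : ∀ n, Continuous (u n)) {A : ℕ → Set (Euc d)}
    (hA : ∀ n, MeasurableSet (A n)) (hAK : ∀ x ∈ K, ∀ᶠ n in atTop, x ∈ A n)
    (hlim : ∀ᵐ x ∂volume.restrict K, Tendsto (fun n => u n x) atTop (𝓝 (f x))) {B : ℝ≥0∞}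
    (hB : ∀ n, ∫⁻ x in A n, ∫⁻ y in A n, ‖u n x - u n y‖ₑ ^ 2 ≤ B) :
    ∫⁻ x in K, ∫⁻ y in K, ‖f x - f y‖ₑ ^ 2 ≤ B := by
  let F : ℕ → Euc d → Euc d → ℝ≥0∞ := fun n x y =>
    (A n ×ˢ A n).indicator (fun p : Euc d × Euc d => ‖u n p.1 - u n p.2‖ₑ ^ 2) (x, y)
  have hFm : ∀ n, Measurable fun p : Euc d × Euc d => F n p.1 p.2 := by
    intro n
    have h1 : Continuous fun p : Euc d × Euc d => u n p.1 - u n p.2 :=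
      ((hu n).comp continuous_fst).sub ((hu n).comp continuous_snd)
    exact (h1.enorm.measurable.pow_const 2).indicator ((hA n).prod (hA n))
  have hbound : ∀ n, ∫⁻ x in K, ∫⁻ y in K, F n x y ≤ B := by
    intro n
    calc ∫⁻ x in K, ∫⁻ y in K, F n x y
        ≤ ∫⁻ x, ∫⁻ y, F n x y :=
          (setLIntegral_le_lintegral _ _).trans
            (lintegral_mono fun x => setLIntegral_le_lintegral _ _)
      _ = ∫⁻ x in A n, ∫⁻ y in A n, ‖u n x - u n y‖ₑ ^ 2 := by
          rw [← lintegral_indicator (hA n)]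
          refine lintegral_congr fun x => ?_
          by_cases hx : x ∈ A n
          · rw [indicator_of_mem hx, ← lintegral_indicator (hA n)]
            refine lintegral_congr fun y => ?_
            by_cases hy : y ∈ A n <;> simp [F, hx, hy]
          · simp [F, hx]
      _ ≤ B := hB n
  calc ∫⁻ x in K, ∫⁻ y in K, ‖f x - f y‖ₑ ^ 2
      = ∫⁻ x in K, ∫⁻ y in K, liminf (fun n => F n x y) atTop := by
        refine lintegral_congr_ae ?_
        filter_upwards [hlim, ae_restrict_mem hK] with x hx hxK
        refine lintegral_congr_ae ?_
        filter_upwards [hlim, ae_restrict_mem hK] with y hy hyK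
        have h1 : Tendsto (fun n => ‖u n x - u n y‖ₑ ^ 2) atTop (𝓝 (‖f x - f y‖ₑ ^ 2)) :=
          ((ENNReal.continuous_pow 2).tendsto _).comp
            ((continuous_enorm.tendsto _).comp (hx.sub hy))
        refine (Tendsto.liminf_eq (h1.congr' ?_)).symm
        filter_upwards [hAK x hxK, hAK y hyK] with n hxn hyn
        simp [F, hxn, hyn]
    _ ≤ ∫⁻ x in K, liminf (fun n => ∫⁻ y in K, F n x y) atTop :=
        lintegral_mono fun x => lintegral_liminf_le fun n =>
          (hFm n).comp measurable_prodMk_left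
    _ ≤ liminf (fun n => ∫⁻ x in K, ∫⁻ y in K, F n x y) atTop :=
        lintegral_liminf_le fun n => (hFm n).lintegral_prod_right'
    _ ≤ B := by
        refine liminf_le_of_le (by isBoundedDefault) fun b hb => ?_
        obtain ⟨n, hn⟩ := hb.exists
        exact hn.trans (hbound n)

/-- A Poincaré inequality on convex subsets for `H¹(Ω)`, by mollification: the mollified
functions converge almost everywhere, and Fatou's lemma passes to the limit. -/
theorem lintegral_lintegral_h1_sub_sq_le (v : H1 Ω) {K : Set (Euc d)} (hK : IsOpen K)
    (hKΩ : K ⊆ Ω.carrier) (hconv : Convex ℝ K) {D : ℝ}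
    (hD : ∀ x ∈ K, ∀ y ∈ K, ‖x - y‖ ≤ D) :
    ∫⁻ x in K, ∫⁻ y in K, ‖h1ToL2 Ω v x - h1ToL2 Ω v y‖ₑ ^ 2 ≤
      ENNReal.ofReal (D ^ 2) * (ENNReal.ofReal (2 ^ d) * volume K *
        ∫⁻ x in K, ‖h1Grad Ω v x‖ₑ ^ 2) := by
  let δ : ℕ → ℝ := fun n => 1 / ((n : ℝ) + 1)
  have hδ : ∀ n, 0 < δ n := fun n => by positivity
  have hδlim : Tendsto δ atTop (𝓝 0) := tendsto_one_div_add_atTop_nhds_zero_nat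
  let β : ℕ → ContDiffBump (0 : Euc d) := fun n =>
    ⟨δ n / 4, δ n / 2, by have := hδ n; positivity, by have := hδ n; linarith⟩
  have hβ : ∀ n, (β n).rOut = δ n / 2 := fun n => rfl
  have hAmeas : ∀ n, MeasurableSet (erosion (δ n) K) := fun n =>
    (isClosed_erosion _ _).measurableSet
  have hAball : ∀ n, ∀ x ∈ erosion (δ n) K, Metric.closedBall x (β n).rOut ⊆ K := fun n x hx =>
    closedBall_subset_of_mem_erosion hx (by rw [hβ]; linarith [hδ n])
  have hAK : ∀ n, erosion (δ n) K ⊆ K := fun n x hx =>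
    hAball n x hx (Metric.mem_closedBall_self (β n).rOut_pos.le)
  refine lintegral_lintegral_sub_sq_le_of_tendsto hK.measurableSet
    (u := fun n => mollify (β n) (h1ToL2 Ω v)) (fun n => (contDiff_mollify _ _).continuous)
    (A := fun n => erosion (δ n) K) hAmeas
    (fun x hx => hδlim.eventually (eventually_mem_erosion hK hx)) ?_ fun n => ?_
  · have h := ContDiffBump.ae_convolution_tendsto_right_of_locallyIntegrable (φ := β) (K := 2)
      (l := atTop) (by
        have := hδlim.div_const 2
        rw [zero_div] at this
        exact this) (Eventually.of_forall fun n => by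
          change δ n / 2 ≤ 2 * (δ n / 4)
          linarith) (locallyIntegrable_indicator (h1ToL2 Ω v))
    filter_upwards [ae_restrict_of_ae h, ae_restrict_mem hK.measurableSet] with x hx hxK
    rw [indicator_of_mem (hKΩ hxK)] at hx
    exact hx
  · refine (lintegral_lintegral_sub_sq_le (hAmeas n) (hconv.erosion _)
      (fun x hx y hy => hD x (hAK n hx) y (hAK n hy)) (contDiff_mollify _ _)).trans ?_
    refine mul_le_mul_right (mul_le_mul' (mul_le_mul_right (measure_mono (hAK n)) _) ?_) _
    exact lintegral_gradient_mollify_le (β n) v hKΩ (hAmeas n) (hAball n)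

/-- On a convex open subset, a function in `H¹(Ω)` is close in `L²` to a constant. The constant is a
value of the function at a point where the error is at most its average over all such points. -/
theorem exists_const_lintegral_sub_sq_le (v : H1 Ω) {K : Set (Euc d)} (hK : IsOpen K)
    (hne : K.Nonempty) (hKΩ : K ⊆ Ω.carrier) (hconv : Convex ℝ K) {D : ℝ}
    (hD : ∀ x ∈ K, ∀ y ∈ K, ‖x - y‖ ≤ D) :
    ∃ c : ℝ, ∫⁻ x in K, ‖h1ToL2 Ω v x - c‖ₑ ^ 2 ≤
      ENNReal.ofReal (2 ^ d * D ^ 2) * ∫⁻ x in K, ‖h1Grad Ω v x‖ₑ ^ 2 := by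
  have h0 : volume K ≠ 0 := (hK.measure_pos volume hne).ne'
  have htop : volume K ≠ ∞ := (Ω.isBounded.subset hKΩ).measure_lt_top.ne
  have hm : Measurable fun p : Euc d × Euc d => ‖h1ToL2 Ω v p.2 - h1ToL2 Ω v p.1‖ₑ ^ 2 := by
    have h1 := (Lp.stronglyMeasurable (h1ToL2 Ω v)).measurable
    exact ((h1.comp measurable_snd).sub (h1.comp measurable_fst)).enorm.pow_const 2
  obtain ⟨y, -, hy⟩ := exists_le_setLAverage (μ := volume) (s := K) h0 htop
    (f := fun y => ∫⁻ x in K, ‖h1ToL2 Ω v x - h1ToL2 Ω v y‖ₑ ^ 2)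
    hm.lintegral_prod_right'.aemeasurable
  refine ⟨h1ToL2 Ω v y, hy.trans ?_⟩
  rw [setLAverage_eq]
  refine ENNReal.div_le_of_le_mul ?_
  have h := lintegral_lintegral_h1_sub_sq_le v hK hKΩ hconv hD
  refine le_trans (le_of_eq ?_) (h.trans (le_of_eq ?_))
  · exact lintegral_congr fun y => lintegral_congr fun x => by rw [enorm_sub_rev]
  · rw [ENNReal.ofReal_mul (by positivity)]
    ring

end NegSobolev

/-! ### Approximation in dual norms and the norm equivalence for meshes -/

namespace NegSobolev

section Abstract

variable {V H : Type*} [NormedAddCommGroup V] [InnerProductSpace ℝ V] [CompleteSpace V]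
  [NormedAddCommGroup H] [InnerProductSpace ℝ H] {j : V →L[ℝ] H}

/-- Duality: if `S` approximates the elements of `V` in `H`, then it approximates the elements of
`H` in the dual of `V`. The `H`-orthogonal projection onto `S` is a competitor for `dualProj`. -/
theorem norm_dualEmbed_sub_dualProj_le {S : Submodule ℝ H} [FiniteDimensional ℝ S] {ε : ℝ}
    (hε : 0 ≤ ε) (hS : ∀ v : V, ∃ w ∈ S, ‖j v - w‖ ≤ ε * ‖v‖) (f : H) :
    ‖dualEmbed j f - dualProj j S (dualEmbed j f)‖ ≤ ε * ‖f‖ := by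
  have hmin : ‖dualEmbed j f - dualProj j S (dualEmbed j f)‖ ≤
      ‖dualEmbed j f - dualEmbed j (S.starProjection f)‖ := by
    rw [dualProj, Submodule.starProjection_minimal]
    exact ciInf_le ⟨0, by rintro _ ⟨x, rfl⟩; exact norm_nonneg _⟩
      (⟨_, Submodule.mem_map_of_mem (S.starProjection_apply_mem f)⟩ :
        ↥(S.map (dualEmbed j)))
  refine hmin.trans ?_
  rw [← map_sub]
  refine ContinuousLinearMap.opNorm_le_bound _ (by positivity) fun v => ?_
  obtain ⟨w, hw, hvw⟩ := hS v
  have h1 : inner ℝ (f - S.starProjection f) w = 0 :=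
    Submodule.starProjection_inner_eq_zero f w hw
  have h2 : ‖f - S.starProjection f‖ ≤ ‖f‖ := by
    rw [← Submodule.starProjection_orthogonal_val]
    exact Submodule.norm_starProjection_apply_le _ _
  calc ‖dualEmbed j (f - S.starProjection f) v‖ = ‖inner ℝ (f - S.starProjection f) (j v - w)‖ := by
        rw [dualEmbed_apply, inner_sub_right, h1, sub_zero]
    _ ≤ ‖f - S.starProjection f‖ * ‖j v - w‖ := norm_inner_le_norm _ _
    _ ≤ ‖f‖ * (ε * ‖v‖) := by gcongr
    _ = _ := by ring

variable (j) in
/-- The norm equivalence for an abstract scale of finite-dimensional spaces with approximation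
property, inverse estimate and geometrically decreasing mesh sizes. -/
theorem exists_norm_equiv {θ q : ℝ} (hθ : θ ∈ Ioo (0 : ℝ) 1) (hq : q ∈ Ioo (0 : ℝ) 1)
    {CJ CB Cref : ℝ} (hCJ : 0 ≤ CJ) (hCB : 0 ≤ CB) (hCref : 0 < Cref) (k : ℕ) :
    ∃ c C : ℝ, 0 < c ∧ 0 < C ∧ ∀ (S : ℕ → Submodule ℝ H) [∀ ℓ, FiniteDimensional ℝ (S ℓ)]
      (g : ℕ → ℕ) (h : ℕ → ℝ), g 0 = 0 → StrictMono g → (∀ ℓ, g (ℓ + 1) ≤ g ℓ + k) →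
      Monotone S →
      (∀ ℓ, ∀ f : H, ‖dualEmbed j f - dualProj j (S ℓ) (dualEmbed j f)‖ ≤
        CJ * q ^ g ℓ * ‖f‖) →
      (∀ ℓ, ∀ f ∈ S ℓ, q ^ g ℓ * ‖f‖ ≤ CB * ‖dualEmbed j f‖) →
      (∀ ℓ, Cref⁻¹ * h ℓ ≤ q ^ g ℓ ∧ q ^ g ℓ ≤ Cref * h ℓ) →
      ∀ φ : StrongDual ℝ (Interp j θ),
        Summable (fun ℓ => h ℓ ^ (-2 + 2 * θ) * ‖φ.comp (interpIncl j hθ) -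
          dualProj j (S ℓ) (φ.comp (interpIncl j hθ))‖ ^ 2) ∧
        c * ‖φ‖ ^ 2 ≤ ‖φ.comp (interpIncl j hθ)‖ ^ 2 +
          ∑' ℓ, h ℓ ^ (-2 + 2 * θ) * ‖φ.comp (interpIncl j hθ) -
            dualProj j (S ℓ) (φ.comp (interpIncl j hθ))‖ ^ 2 ∧
        ‖φ.comp (interpIncl j hθ)‖ ^ 2 +
          ∑' ℓ, h ℓ ^ (-2 + 2 * θ) * ‖φ.comp (interpIncl j hθ) -
            dualProj j (S ℓ) (φ.comp (interpIncl j hθ))‖ ^ 2 ≤ C * ‖φ‖ ^ 2 := by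
  have hq0 : 0 < q := hq.1
  have hq1 : 0 < 1 - q := by linarith [hq.2]
  set U : ℝ := scaleConst θ q * (CJ + 1) ^ 2 with hU
  have hU0 : 0 ≤ U := mul_nonneg (scaleConst_nonneg hθ hq) (sq_nonneg _)
  set W : ℝ := (CB + 1) ^ 2 * ((q ^ k) ^ (θ - 1)) ^ 2 / (q ^ (2 * θ) * (1 - q)) with hW
  have hW0 : 0 < W := by positivity
  set M : ℝ := Cref ^ (2 - 2 * θ) with hM
  have hM0 : 0 < M := by positivity
  refine ⟨(W * (1 + M))⁻¹, ‖interpIncl j hθ‖ ^ 2 + M * U + 1, by positivity, by positivity, ?_⟩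
  intro S _ g h hg0 hg hk hS hJ hB hh φ
  set φ' : StrongDual ℝ V := φ.comp (interpIncl j hθ) with hφ'
  set a : ℕ → ℝ := fun ℓ => ‖φ' - dualProj j (S ℓ) φ'‖ with ha
  -- `x` carries the weights at the exact scales `q ^ g ℓ`, `y` those at the comparable sizes `h ℓ`
  set x : ℕ → ℝ := fun ℓ => ((q ^ g ℓ) ^ (θ - 1) * a ℓ) ^ 2 with hx
  set y : ℕ → ℝ := fun ℓ => h ℓ ^ (-2 + 2 * θ) * a ℓ ^ 2 with hy
  have hh0 : ∀ ℓ, 0 < h ℓ := fun ℓ => by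
    have h1 : 0 < Cref * h ℓ := (pow_pos hq0 _).trans_le (hh ℓ).2
    exact pos_of_mul_pos_right h1 hCref.le
  have hx0 : ∀ ℓ, 0 ≤ x ℓ := fun ℓ => sq_nonneg _
  have hxeq : ∀ ℓ, x ℓ = (q ^ g ℓ) ^ (-2 + 2 * θ) * a ℓ ^ 2 := by
    intro ℓ
    change ((q ^ g ℓ) ^ (θ - 1) * a ℓ) ^ 2 = _
    rw [mul_pow, ← Real.rpow_natCast ((q ^ g ℓ) ^ (θ - 1)), ← Real.rpow_mul (by positivity)]
    congr 2
    push_cast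
    ring
  have hCM : Cref⁻¹ ^ (-2 + 2 * θ) = M := by
    rw [Real.inv_rpow hCref.le, ← Real.rpow_neg hCref.le, hM]
    ring_nf
  have hyx : ∀ ℓ, y ℓ ≤ M * x ℓ := by
    intro ℓ
    rw [hxeq, ← mul_assoc, ← hCM, ← Real.mul_rpow (by positivity) (by positivity)]
    refine mul_le_mul_of_nonneg_right ?_ (sq_nonneg _)
    refine Real.rpow_le_rpow_of_nonpos (by positivity) ?_ (by linarith [hθ.2])
    rw [inv_mul_le_iff₀ hCref]
    exact (hh ℓ).2
  have hxy : ∀ ℓ, x ℓ ≤ M * y ℓ := by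
    intro ℓ
    rw [hxeq, hy, ← mul_assoc, ← hCM, ← Real.mul_rpow (by positivity) (hh0 ℓ).le]
    refine mul_le_mul_of_nonneg_right ?_ (sq_nonneg _)
    have := hh0 ℓ
    exact Real.rpow_le_rpow_of_nonpos (by positivity) (hh ℓ).1 (by linarith [hθ.2])
  have hy0 : ∀ ℓ, 0 ≤ y ℓ := fun ℓ => by
    have := hh0 ℓ
    positivity
  have hxsum : ∀ F : Finset ℕ, ∑ ℓ ∈ F, x ℓ ≤ U * ‖φ‖ ^ 2 := fun F =>
    sum_error_sq_le hθ hq hg hCJ hJ φ F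
  have hxs : Summable x := summable_of_sum_le hx0 hxsum
  have hxt : ∑' ℓ, x ℓ ≤ U * ‖φ‖ ^ 2 := hxs.tsum_le_of_sum_le hxsum
  have hys : Summable y := Summable.of_nonneg_of_le hy0 hyx (hxs.mul_left M)
  have hyt : ∑' ℓ, y ℓ ≤ M * ∑' ℓ, x ℓ := by
    rw [← tsum_mul_left]
    exact hys.tsum_le_tsum hyx (hxs.mul_left M)
  have hxyt : ∑' ℓ, x ℓ ≤ M * ∑' ℓ, y ℓ := by
    rw [← tsum_mul_left]
    exact hxs.tsum_le_tsum hxy (hys.mul_left M)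
  refine ⟨hys, ?_, ?_⟩
  · have hlow : ‖φ‖ ^ 2 ≤ W * (‖φ'‖ ^ 2 + ∑' ℓ, x ℓ) :=
      norm_sq_le_error hθ hq hg hCB hB hS hg0 hk φ hxs
    rw [inv_mul_le_iff₀ (by positivity)]
    have hyt0 : 0 ≤ ∑' ℓ, y ℓ := tsum_nonneg hy0
    calc ‖φ‖ ^ 2 ≤ W * (‖φ'‖ ^ 2 + M * ∑' ℓ, y ℓ) := hlow.trans (by gcongr)
      _ ≤ W * ((1 + M) * (‖φ'‖ ^ 2 + ∑' ℓ, y ℓ)) := by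
          gcongr
          nlinarith [mul_nonneg hM0.le (sq_nonneg ‖φ'‖)]
      _ = _ := by ring
  · have hφn : ‖φ'‖ ≤ ‖φ‖ * ‖interpIncl j hθ‖ := φ.opNorm_comp_le _
    calc ‖φ'‖ ^ 2 + ∑' ℓ, y ℓ ≤ (‖φ‖ * ‖interpIncl j hθ‖) ^ 2 + M * (U * ‖φ‖ ^ 2) := by
          gcongr
          exact hyt.trans (by gcongr)
      _ ≤ _ := by nlinarith [sq_nonneg ‖φ‖]

end Abstract

variable {d : ℕ} {Ω : LipschitzDomain d}

/-- Piecewise constants approximate `H¹(Ω)` to first order in `L²(Ω)`. -/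
theorem Mesh.exists_P0_norm_sub_le (𝒯 : Mesh Ω) {h : ℝ} (hh : 0 ≤ h)
    (hdiam : ∀ T ∈ 𝒯.elems, Metric.diam (hull T) ≤ h) (v : H1 Ω) :
    ∃ w ∈ 𝒯.P0, ‖h1ToL2 Ω v - w‖ ≤ √(2 ^ d) * h * ‖h1Grad Ω v‖ := by
  have hfin : IsFiniteMeasure (volume.restrict Ω.carrier) :=
    ⟨by rw [Measure.restrict_apply_univ]; exact Ω.isBounded.measure_lt_top⟩
  have hint : ∀ T ∈ 𝒯.elems, interior (hull T) ⊆ Ω.carrier := fun T hT =>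
    𝒯.interior_hull_subset hT
  choose! c hc using fun T (hT : T ∈ 𝒯.elems) =>
    exists_const_lintegral_sub_sq_le v isOpen_interior (𝒯.isSimplex T hT).interior_nonempty
      (hint T hT) (convex_hull T).interior (D := h) fun x hx y hy => by
        rw [← dist_eq_norm]
        exact (Metric.dist_le_diam_of_mem (isCompact_hull T).isBounded (interior_subset hx)
          (interior_subset hy)).trans (hdiam T hT)
  set F := 𝒯.finite.toFinset with hF
  have hmem : ∀ T ∈ F, T ∈ 𝒯.elems := fun T hT => by simpa [hF] using hT
  -- the piecewise constant function with the values `c T`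
  let w₀ : Euc d → ℝ := fun x => ∑ T ∈ F, (interior (hull T)).indicator (fun _ => c T) x
  have hw₀ : ∀ T ∈ 𝒯.elems, ∀ x ∈ interior (hull T), w₀ x = c T := by
    intro T hT x hx
    have hTF : T ∈ F := by simpa [hF] using hT
    change ∑ T ∈ F, (interior (hull T)).indicator (fun _ => c T) x = c T
    rw [Finset.sum_eq_single_of_mem T hTF, indicator_of_mem hx]
    intro T' hT' hne
    exact indicator_of_notMem (fun hx' => Set.disjoint_left.1
      (𝒯.pairwiseDisjoint_interior (hmem T' hT') hT hne) hx' hx) _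
  have hmemLp : MemLp w₀ 2 (volume.restrict Ω.carrier) :=
    memLp_finsetSum F fun T _ => memLp_indicator_const 2 isOpen_interior.measurableSet (c T)
      (Or.inr (measure_ne_top _ _))
  refine ⟨hmemLp.toLp w₀, fun T hT => ⟨c T, ?_⟩, ?_⟩
  · filter_upwards [hmemLp.coeFn_toLp] with x hx hxT
    rw [hx, hw₀ T hT x hxT]
  · refine le_of_sq_le_sq ?_ (by positivity)
    rw [← ENNReal.ofReal_le_ofReal_iff (by positivity), ofReal_norm_sq_eq_lintegral]
    calc ∫⁻ x in Ω.carrier, ‖(h1ToL2 Ω v - hmemLp.toLp w₀ : L2 Ω) x‖ₑ ^ 2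
        = ∫⁻ x in Ω.carrier, ‖h1ToL2 Ω v x - w₀ x‖ₑ ^ 2 := by
          refine lintegral_congr_ae ?_
          filter_upwards [Lp.coeFn_sub (h1ToL2 Ω v) (hmemLp.toLp w₀), hmemLp.coeFn_toLp]
            with x hx hx'
          rw [hx, Pi.sub_apply, hx']
      _ ≤ ∑ T ∈ F, ∫⁻ x in interior (hull T), ‖h1ToL2 Ω v x - w₀ x‖ₑ ^ 2 :=
          𝒯.lintegral_le_sum _
      _ ≤ ∑ T ∈ F, ENNReal.ofReal (2 ^ d * h ^ 2) *
            ∫⁻ x in interior (hull T), ‖h1Grad Ω v x‖ₑ ^ 2 := by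
          refine Finset.sum_le_sum fun T hT => ?_
          refine le_trans (le_of_eq ?_) (hc T (hmem T hT))
          refine setLIntegral_congr_fun isOpen_interior.measurableSet fun x hx => ?_
          rw [hw₀ T (hmem T hT) x hx]
      _ ≤ ENNReal.ofReal (2 ^ d * h ^ 2) * ∫⁻ x in Ω.carrier, ‖h1Grad Ω v x‖ₑ ^ 2 := by
          rw [← Finset.mul_sum]
          exact mul_le_mul_right (𝒯.sum_lintegral_le _) _
      _ = _ := by
          rw [← ofReal_norm_sq_eq_lintegral, ← ENNReal.ofReal_mul (by positivity), mul_pow,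
            mul_pow, Real.sq_sqrt (by positivity)]

/-- The inclusion of `H¹₀(Ω)` into `H¹(Ω)` is bounded, by Friedrichs' inequality. -/
theorem H10.exists_norm_toH1_le (Ω : LipschitzDomain d) :
    ∃ C : ℝ, 0 < C ∧ ∀ v : H10 Ω, ‖H10.toH1 Ω v‖ ≤ C * ‖v‖ := by
  obtain ⟨C, hC, h⟩ := friedrichs Ω
  refine ⟨C + 1, by positivity, fun v => ?_⟩
  rw [H10.norm_eq]
  refine le_of_sq_le_sq ?_ (by positivity)
  rw [H10.h1_norm_sq]
  have h1 := h _ (H10.toH1_mem Ω v)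
  have h2 := pow_le_pow_left₀ (norm_nonneg _) h1 2
  nlinarith [mul_nonneg hC (sq_nonneg ‖h1Grad Ω (H10.toH1 Ω v)‖)]

/-- On `L²(Ω)`, the norm of `H⁻¹(Ω)` is bounded by that of the dual of `H¹(Ω)`. The inverse estimate
therefore carries over from the former to the latter. -/
theorem exists_norm_dualEmbed_le (Ω : LipschitzDomain d) : ∃ C : ℝ, 0 < C ∧ ∀ f : L2 Ω,
    ‖dualEmbed (H10.toL2 Ω) f‖ ≤ C * ‖dualEmbed (h1ToL2 Ω) f‖ := by
  obtain ⟨C, hC, h⟩ := H10.exists_norm_toH1_le Ω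
  refine ⟨C, hC, fun f => ContinuousLinearMap.opNorm_le_bound _ (by positivity) fun v => ?_⟩
  have h1 : dualEmbed (H10.toL2 Ω) f v = dualEmbed (h1ToL2 Ω) f (H10.toH1 Ω v) := rfl
  rw [h1]
  calc _ ≤ ‖dualEmbed (h1ToL2 Ω) f‖ * ‖H10.toH1 Ω v‖ := ContinuousLinearMap.le_opNorm _ _
    _ ≤ ‖dualEmbed (h1ToL2 Ω) f‖ * (C * ‖v‖) := by gcongr; exact h v
    _ = _ := by ring

end NegSobolev

theorem mainTheorem5 {d : ℕ} (Ω : LipschitzDomain d) (s : ℝ) (hs : s ∈ Set.Ioo (0 : ℝ) 1)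
    (Creg qref Cref : ℝ) (kref : ℕ) (hCreg : 0 < Creg) (hqref : qref ∈ Set.Ioo (0 : ℝ) 1)
    (hCref : 0 < Cref) :
    ∃ c C : ℝ, 0 < c ∧ 0 < C ∧
      ∀ (R : RefinementRule d) (𝒯 : ℕ → Mesh Ω),
        R.IsUniformSequence Creg qref Cref kref 𝒯 →
        (∀ φ : HNeg Ω s,
          Summable (fun ℓ => (𝒯 ℓ).size ^ (-2 + 2 * s) *
            ‖φ.toNegOne hs - (𝒯 ℓ).projNegOne (φ.toNegOne hs)‖ ^ 2) ∧
          c * ‖φ‖ ^ 2 ≤ ‖φ.toNegOne hs‖ ^ 2 + ∑' ℓ, (𝒯 ℓ).size ^ (-2 + 2 * s) *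
            ‖φ.toNegOne hs - (𝒯 ℓ).projNegOne (φ.toNegOne hs)‖ ^ 2 ∧
          ‖φ.toNegOne hs‖ ^ 2 + ∑' ℓ, (𝒯 ℓ).size ^ (-2 + 2 * s) *
            ‖φ.toNegOne hs - (𝒯 ℓ).projNegOne (φ.toNegOne hs)‖ ^ 2 ≤ C * ‖φ‖ ^ 2) ∧
        (∀ φ : HTildeNeg Ω s,
          Summable (fun ℓ => (𝒯 ℓ).size ^ (-2 + 2 * s) *
            ‖φ.toNegOne hs - (𝒯 ℓ).projTildeNegOne (φ.toNegOne hs)‖ ^ 2) ∧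
          c * ‖φ‖ ^ 2 ≤ ‖φ.toNegOne hs‖ ^ 2 + ∑' ℓ, (𝒯 ℓ).size ^ (-2 + 2 * s) *
            ‖φ.toNegOne hs - (𝒯 ℓ).projTildeNegOne (φ.toNegOne hs)‖ ^ 2 ∧
          ‖φ.toNegOne hs‖ ^ 2 + ∑' ℓ, (𝒯 ℓ).size ^ (-2 + 2 * s) *
            ‖φ.toNegOne hs - (𝒯 ℓ).projTildeNegOne (φ.toNegOne hs)‖ ^ 2 ≤ C * ‖φ‖ ^ 2) := by
  obtain ⟨K, hK, hinv⟩ := exists_inverse_estimate Ω.two_le_dim hCreg hCref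
  obtain ⟨B, hB, hemb⟩ := exists_norm_dualEmbed_le Ω
  have hJ0 : 0 ≤ √(2 ^ d) * Cref := by positivity
  obtain ⟨c₁, C₁, hc₁, hC₁, H₁⟩ := exists_norm_equiv (H10.toL2 Ω) hs hqref hJ0 hK.le hCref kref
  obtain ⟨c₂, C₂, hc₂, hC₂, H₂⟩ := exists_norm_equiv (h1ToL2 Ω) hs hqref hJ0
    (mul_pos hK hB).le hCref kref
  refine ⟨min c₁ c₂, max C₁ C₂, lt_min hc₁ hc₂, lt_max_of_lt_left hC₁, fun R 𝒯 hT => ?_⟩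
  obtain ⟨g, hg0, hg, hk, hgen⟩ := hT.exists_gen
  have hτ : ∀ ℓ, 0 < qref ^ g ℓ := fun ℓ => pow_pos hqref.1 _
  have hdiam : ∀ ℓ, ∀ T ∈ (𝒯 ℓ).elems, Metric.diam (hull T) ≤ Cref * qref ^ g ℓ := by
    intro ℓ T hTe
    have h := (hT.diam_gen ℓ T hTe).1
    rwa [hgen ℓ T hTe, inv_mul_le_iff₀ hCref] at h
  have hdiam' : ∀ ℓ, ∀ T ∈ (𝒯 ℓ).elems, qref ^ g ℓ ≤ Cref * Metric.diam (hull T) := by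
    intro ℓ T hTe
    have h := (hT.diam_gen ℓ T hTe).2
    rwa [hgen ℓ T hTe] at h
  have hsize : ∀ ℓ, Cref⁻¹ * (𝒯 ℓ).size ≤ qref ^ g ℓ ∧ qref ^ g ℓ ≤ Cref * (𝒯 ℓ).size := by
    intro ℓ
    obtain ⟨T, hTe, hTs⟩ := (𝒯 ℓ).exists_size_eq
    rw [← hTs, inv_mul_le_iff₀ hCref]
    exact ⟨hdiam ℓ T hTe, hdiam' ℓ T hTe⟩
  have happrox : ∀ ℓ, ∀ v : H1 Ω, ∃ w ∈ (𝒯 ℓ).P0,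
      ‖h1ToL2 Ω v - w‖ ≤ √(2 ^ d) * Cref * qref ^ g ℓ * ‖h1Grad Ω v‖ := by
    intro ℓ v
    have := hτ ℓ
    rw [mul_assoc (√(2 ^ d))]
    exact (𝒯 ℓ).exists_P0_norm_sub_le (by positivity) (hdiam ℓ) v
  have hinv' : ∀ ℓ, ∀ f ∈ (𝒯 ℓ).P0, qref ^ g ℓ * ‖f‖ ≤ K * ‖dualEmbed (H10.toL2 Ω) f‖ :=
    fun ℓ => hinv Ω (𝒯 ℓ) _ (hτ ℓ) (hT.shapeRegular ℓ) (hdiam' ℓ)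
  have hJ₁ : ∀ ℓ, ∀ f : L2 Ω, ‖dualEmbed (H10.toL2 Ω) f -
      dualProj (H10.toL2 Ω) (𝒯 ℓ).P0 (dualEmbed (H10.toL2 Ω) f)‖ ≤
      √(2 ^ d) * Cref * qref ^ g ℓ * ‖f‖ := by
    intro ℓ
    have := hτ ℓ
    refine norm_dualEmbed_sub_dualProj_le (by positivity) fun v => ?_
    obtain ⟨w, hw, hvw⟩ := happrox ℓ (H10.toH1 Ω v)
    rw [← H10.norm_eq] at hvw
    exact ⟨w, hw, hvw⟩
  have hJ₂ : ∀ ℓ, ∀ f : L2 Ω, ‖dualEmbed (h1ToL2 Ω) f -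
      dualProj (h1ToL2 Ω) (𝒯 ℓ).P0 (dualEmbed (h1ToL2 Ω) f)‖ ≤
      √(2 ^ d) * Cref * qref ^ g ℓ * ‖f‖ := by
    intro ℓ
    have := hτ ℓ
    refine norm_dualEmbed_sub_dualProj_le (by positivity) fun v => ?_
    obtain ⟨w, hw, hvw⟩ := happrox ℓ v
    refine ⟨w, hw, hvw.trans ?_⟩
    gcongr
    refine le_of_sq_le_sq ?_ (norm_nonneg v)
    rw [H10.h1_norm_sq]
    linarith [sq_nonneg ‖h1ToL2 Ω v‖]
  have hB₂ : ∀ ℓ, ∀ f ∈ (𝒯 ℓ).P0, qref ^ g ℓ * ‖f‖ ≤ K * B * ‖dualEmbed (h1ToL2 Ω) f‖ := by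
    intro ℓ f hf
    rw [mul_assoc]
    exact (hinv' ℓ f hf).trans (by gcongr; exact hemb f)
  constructor
  · intro φ
    obtain ⟨h1, h2, h3⟩ := H₁ (fun ℓ => (𝒯 ℓ).P0) g (fun ℓ => (𝒯 ℓ).size) hg0 hg hk
      hT.monotone_P0 hJ₁ hinv' hsize φ
    refine ⟨h1, le_trans ?_ h2, h3.trans ?_⟩
    · gcongr; exact min_le_left _ _
    · gcongr; exact le_max_left _ _
  · intro φ
    obtain ⟨h1, h2, h3⟩ := H₂ (fun ℓ => (𝒯 ℓ).P0) g (fun ℓ => (𝒯 ℓ).size) hg0 hg hk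
      hT.monotone_P0 hJ₂ hB₂ hsize φ
    refine ⟨h1, le_trans ?_ h2, h3.trans ?_⟩
    · gcongr; exact min_le_right _ _
    · gcongr; exact le_max_right _ _
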